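/- **Setting.** Let $C_4'$ be the graph with vertices $0_j,u_j,0'_j,d_j$ ($j\in\mathbb Z$), the cycle edges $\{0_j,u_j\},\{u_j,0'_j\},\{0'_j,d_j\},\{d_j,0_j\}$ (the copy $C_4^{(j)}$) and the bridges $\{0_j,0'_{j+1}\}$. Let $A$ be its set of arcs; an arc $e$ has origin $o(e)$, terminus $t(e)$ and reversal $\bar e$. The Grover walk is $\Psi_{t+1}=U\Psi_t$ on $\ell^2(A)$ with $$(U\psi)(f)=\sum_{e:\,o(e)=t(f)}\Big(\frac{2}{\deg o(e)}-\delta_{e,\bar f}\Big)\psi(e),$$ and $X_t$ is the label of the copy, $\mathbb P(X_t=j)=\sum_{e:\,o(e)\in V(C_4^{(j)})}|\Psi_t(e)|^2$, for an initial state $\Psi_0\in\ell^2(A)$ with $\|\Psi_0\|=1$. Let $\mathcal D$ be $C_4$ (vertices $0,u,0',d$) with the extra edge $\{0,0'\}$. Identify $A\cong\mathbb Z\times A(\mathcal D)$, where $(x,f)$ is the arc with origin in copy $x$ that projects to $f$; thus $(x,(0,0'))=(0_x,0'_{x+1})$ and $(x,(0',0))=(0'_x,0_{x-1})$. Let $\hat\Psi_0(k,f)=\sum_x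 e^{-ikx}\Psi_0(x,f)$ be the Fourier transform in $L^2$, and fix any $2\pi$-periodic pointwise version of it. (It exists; if $\sum_e|\Psi_0(e)|<\infty$, the series itself is a continuous version.) Put $$(\hat U(k)\phi)(f)=e^{i\theta_k(f)}\sum_{e\in A(\mathcal D):\,o(e)=t(f)}\Big(\frac{2}{\deg o(e)}-\delta_{e,\bar f}\Big)\phi(e),$$ with $\theta_k(0,0')=k$, $\theta_k(0',0)=-k$ and $\theta_k=0$ otherwise. For $j\in\{0,1,2\}$ and $l\in\{0,1\}$ let $$\lambda_j(k)=\tfrac{2\sqrt7}{3\sqrt3}\cos\Big\{\tfrac13\arccos\big(\tfrac{9\sqrt3}{7\sqrt7}\cos k\big)+\tfrac{2j\pi}{3}\Big\},\qquad \nu_{j,l}=\lambda_j+(-1)^l i\sqrt{1-\lambda_j^2},\qquad x_{j,l}(k)=\frac{i\nu_{j,l}'(k)}{\nu_{j,l}(k)}\in\mathbb R,$$ let $v_{j,l}(k)$ be any normalized eigenvectors of $\hat U(k)$ for $\nu_{j,l}(k)$, and let $w_{j,l}(k)=|\langle v_{j,l}(k),\hat\Psi_0(k)\rangle|^2$. Let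 $\Gamma_m$ ($m=0,1,2,3$) be the span of $w^{(m)}(c)-w^{(m)}(\bar c)$, where $c=((0',u),(u,0),(0,d),(d,0'))$, $\bar c=((0',d),(d,0),(0,u),(u,0'))$ and $w^{(m)}(e_1,\dots,e_4)=\sum_{r=1}^4 e^{2\pi i m r/4}\delta_{e_r}$; let $(j,\Gamma_m)$ be its copy in $C_4^{(j)}$, and let $\Delta=\sum_{j\in\mathbb Z}\sum_{m=0}^3\|\Pi_{(j,\Gamma_m)}\Psi_0\|^2$, where $\Pi$ denotes orthogonal projection. **Proposition.** Let $I_0=(-1/\sqrt{10},1/\sqrt{10})$ and $I_1=(-2/7,2/7)$. For each $l\in\{0,1\}$, the map $x_{0,l}$ is a bijection of $(0,2\pi)$ onto $I_0$, and $x_{2,l}$ is a bijection of $(-\pi/2,\pi/2)$ onto $I_1$; moreover $dx_{0,0}/dk\ne0$ and $dx_{2,0}/dk\neq 0$ on these respective intervals. There are nonnegative integrable functions $\rho_{m,l}$ on $\mathbb R$ ($m,l\in\{0,1\}$) such that for every $x\neq0$, and also for $x=0$ if $\Delta=0$, $$\lim_{t\to\infty}\mathbb P(X_t/t\le x)=\int_{-\infty}^x\Big\{\Delta\,\delta_0(y)+\sum_{m,l\in\{0,1\}}\rho_{m,l}(y)\Big\}\,dy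 ,$$ and such that: 1. $\rho_{m,l}$ vanishes outside $I_m$; precisely, $\{\rho_{0,l}\ne0\}=x_{0,l}\big(\{k\in(0,2\pi):w_{0,l}(k)+w_{1,l}(\pi-k)\neq0\}\big)$ and $\{\rho_{1,l}\neq0\}=x_{2,l}\big(\{k\in(-\tfrac\pi2,\tfrac\pi2):w_{2,l}(k)+w_{2,l}(\pi-k)\ne0\}\big)$. If the chosen version $\hat\Psi_0$ is continuous in $k$, then $\rho_{m,l}$ is continuous on $I_m$. 2. The graphs over $I_0$ and $I_1$ are $$\{(x,\rho_{0,l}(x)):x\in I_0\}=\Big\{\Big(x_{0,l}(k),\frac{w_{0,l}(k)+w_{1,l}(\pi-k)}{2\pi|dx_{0,0}(k)/dk|}\Big):k\in(0,2\pi)\Big\},$$ $$\{(x,\rho_{1,l}(x)):x\in I_1\}=\Big\{\Big(x_{2,l}(k),\frac{w_{2,l}(k)+w_{2,l}(\pi-k)}{2\pi|dx_{2,0}(k)/dk|}\Big):k\in(-\tfrac\pi2,\tfrac\pi2)\Big\}.$$ -/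

import Mathlib

open Filter Topology MeasureTheory

noncomputable section

/-! ### Grover walk on a locally finite graph -/

section Grover

variable {V : Type} [DecidableEq V] (G : SimpleGraph V) [G.LocallyFinite]

/-- One step of the Grover walk. An arc `e = (o(e), t(e))` is a dart of `G`, and
`(U ψ)(f) = ∑_{e : o(e) = t(f)} (2 / deg o(e) - δ_{e, f̄}) ψ(e)`.
The arcs `e` with `o(e) = t(f)` are the `(t(f), w)` with `w` a neighbour of `t(f)`, and such an
arc is the reversal of `f` exactly when `w = o(f)`. -/
def groverStep (ψ : G.Dart → ℂ) : G.Dart → ℂ := fun f =>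
  ∑ w : G.neighborSet f.snd,
    (2 / (G.degree f.snd : ℂ) - if (w : V) = f.fst then 1 else 0) *
      ψ (G.dartOfNeighborSet f.snd w)

/-- The weight `∑_{e : o(e) = u} |ψ(e)|²` of a state at a vertex `u`. -/
def vertexWeight (ψ : G.Dart → ℂ) (u : V) : ℝ :=
  ∑ w : G.neighborSet u, ‖ψ (G.dartOfNeighborSet u w)‖ ^ 2

/-- The Hilbert space `ℓ²(A(G))`. -/
abbrev ArcSpace {V : Type} (G : SimpleGraph V) : Type := lp (fun _ : G.Dart => ℂ) 2

/-- `w^{(m)}(p) = ∑_{r=1}^n e^{2πi m r / n} δ_{e_r}` for a path `p = (e_1, …, e_n)`. -/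
def pathVec {n : ℕ} (m : ℕ) (p : Fin n → G.Dart) : ArcSpace G :=
  ∑ r : Fin n, Complex.exp (2 * Real.pi * Complex.I * m * ((r : ℕ) + 1) / n) •
    lp.single 2 (p r) (1 : ℂ)

end Grover

/-! ### The cycle `C₄`, its periodic arrangement, and the fundamental domain -/

/-- The vertices `0, u, 0', d` of the cycle `C₄`. -/
inductive Cell : Type
  | o | u | o' | d
  deriving DecidableEq

instance cellFintype : Fintype Cell where
  elems := {.o, .u, .o', .d}
  complete := by intro a; cases a <;> simp

/-- The cycle `0 - u - 0' - d - 0`. -/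
def cycleAdj : Cell → Cell → Bool
  | .o, .u | .u, .o | .u, .o' | .o', .u | .o', .d | .d, .o' | .d, .o | .o, .d => true
  | _, _ => false

theorem cycleAdj_symm (a b : Cell) : cycleAdj a b = cycleAdj b a := by
  cases a <;> cases b <;> rfl

theorem cycleAdj_self (a : Cell) : cycleAdj a a = false := by
  cases a <;> rfl

/-- The graph `C₄'`: copies of `C₄` labelled by `ℤ`, with a bridge between `0` in the copy `i`
and `0'` in the copy `i + 1` for every `i`. -/
def chain : SimpleGraph (ℤ × Cell) where
  Adj p q := (p.1 = q.1 ∧ cycleAdj p.2 q.2 = true) ∨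
    (q.1 = p.1 + 1 ∧ p.2 = .o ∧ q.2 = .o') ∨ (p.1 = q.1 + 1 ∧ q.2 = .o ∧ p.2 = .o')
  symm := ⟨by
    rintro ⟨i, a⟩ ⟨j, b⟩ h
    rcases h with ⟨h1, h2⟩ | h | h
    · left
      exact ⟨h1.symm, (cycleAdj_symm b a).trans h2⟩
    · exact Or.inr (Or.inr h)
    · exact Or.inr (Or.inl h)⟩
  loopless := ⟨by
    rintro ⟨i, a⟩ h
    rcases h with ⟨-, h⟩ | ⟨-, h1, h2⟩ | ⟨-, h1, h2⟩
    · simp [cycleAdj_self] at h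
    · simp_all
    · simp_all⟩

instance chainDecidable : DecidableRel chain.Adj := fun p q => by
  unfold chain
  infer_instance

instance chainLocallyFinite : chain.LocallyFinite := fun p =>
  Fintype.ofFinset
    ((Finset.Icc (p.1 - 1) (p.1 + 1) ×ˢ (Finset.univ : Finset Cell)).filter (chain.Adj p)) (by
      rintro ⟨j, b⟩
      simp only [Finset.mem_filter, Finset.mem_product, Finset.mem_Icc, Finset.mem_univ, and_true,
        SimpleGraph.mem_neighborSet, and_iff_right_iff_imp]
      rintro (⟨h, -⟩ | ⟨h, -⟩ | ⟨h, -⟩) <;> dsimp only at h <;> omega)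

/-- The fundamental domain `𝒟`: the cycle `C₄` together with the edge `{0, 0'}`. -/
def domain : SimpleGraph Cell where
  Adj a b := cycleAdj a b = true ∨ (a = .o ∧ b = .o') ∨ (a = .o' ∧ b = .o)
  symm := ⟨by intro a b; cases a <;> cases b <;> decide⟩
  loopless := ⟨by intro a; cases a <;> decide⟩

instance domainDecidable : DecidableRel domain.Adj := fun a b => by
  unfold domain
  infer_instance

/-- The winding of an arc of `𝒟`: `1` on `(0, 0')`, `-1` on `(0', 0)`, and `0` otherwise. -/
def winding (f : domain.Dart) : ℤ :=
  if f.fst = .o ∧ f.snd = .o' then 1 else if f.fst = .o' ∧ f.snd = .o then -1 else 0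

/-- The identification `ℤ × A(𝒟) ≅ A(C₄')`: `(x, (a, b))` is the arc with origin `a` in the
copy `x` that projects to `(a, b)`, so `(x, (0, 0'))` is `(0_x, 0'_{x+1})` and `(x, (0', 0))` is
`(0'_x, 0_{x-1})`. -/
def liftArc (x : ℤ) (f : domain.Dart) : chain.Dart where
  fst := (x, f.fst)
  snd := (x + winding f, f.snd)
  adj := by
    obtain ⟨⟨a, b⟩, h⟩ := f
    revert h
    cases a <;> cases b <;> simp [domain, chain, winding, cycleAdj]

/-! ### The label process -/

/-- `ℙ(X_t = j)`: the probability to find the walk started in `Ψ` in the copy `j` at time `t`. -/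
def labelProb (Ψ : ArcSpace chain) (t : ℕ) (j : ℤ) : ℝ :=
  ∑ a : Cell, vertexWeight chain ((groverStep chain)^[t] Ψ) (j, a)

/-- `ℙ(X_t / t ≤ x)`. -/
def scaledCdf (Ψ : ArcSpace chain) (t : ℕ) (x : ℝ) : ℝ :=
  ∑' j : ℤ, if (j : ℝ) / (t : ℝ) ≤ x then labelProb Ψ t j else 0

/-! ### Homological eigenspaces -/

/-- The closed cycle `c = ((0', u), (u, 0), (0, d), (d, 0'))` in the fundamental domain. -/
def cyc : Fin 4 → domain.Dart :=
  ![⟨(.o', .u), by decide⟩, ⟨(.u, .o), by decide⟩, ⟨(.o, .d), by decide⟩, ⟨(.d, .o'), by decide⟩]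

/-- The inverse closed cycle `c̄ = ((0', d), (d, 0), (0, u), (u, 0'))`. -/
def cycRev : Fin 4 → domain.Dart :=
  ![⟨(.o', .d), by decide⟩, ⟨(.d, .o), by decide⟩, ⟨(.o, .u), by decide⟩, ⟨(.u, .o'), by decide⟩]

/-- The homological eigenspace `(j, Γ_m)`, the span of `w^{(m)}(c) - w^{(m)}(c̄)` in the copy `j`. -/
def homSpace (j : ℤ) (m : Fin 4) : Submodule ℂ (ArcSpace chain) :=
  Submodule.span ℂ {pathVec chain m (fun r => liftArc j (cyc r)) -
    pathVec chain m (fun r => liftArc j (cycRev r))}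

instance homSpaceProj (j : ℤ) (m : Fin 4) : (homSpace j m).HasOrthogonalProjection := by
  unfold homSpace
  infer_instance

/-- `Δ`, the total mass of the projections onto the homological eigenspaces. -/
def homMass (Ψ : ArcSpace chain) : ℝ :=
  ∑' j : ℤ, ∑ m : Fin 4, ‖(homSpace j m).starProjection Ψ‖ ^ 2

/-! ### The Fourier picture -/

/-- `Φ` is (a pointwise version of) the Fourier transform `Ψ̂(k, f) = ∑_x e^{-ikx} Ψ(x, f)`: it is
`2π`-periodic in `k`, square integrable over a period, and its Fourier inversion is `Ψ`. -/
structure IsFourierTransform (Ψ : ArcSpace chain) (Φ : ℝ → domain.Dart → ℂ) : Prop where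
  periodic : ∀ f k, Φ (k + 2 * Real.pi) f = Φ k f
  memLp : ∀ f, MemLp (fun k => Φ k f) 2 (volume.restrict (Set.Ioc (-Real.pi) Real.pi))
  inversion : ∀ (x : ℤ) (f : domain.Dart),
    Ψ (liftArc x f) =
      (1 / (2 * Real.pi) : ℂ) *
        ∫ k in (-Real.pi)..Real.pi, Complex.exp (Complex.I * k * x) * Φ k f

/-- The pointwise Fourier series `∑_x e^{-ikx} Ψ(x, f)`, meaningful when `Ψ` is summable. -/
def fourierSeries (Ψ : ArcSpace chain) (k : ℝ) (f : domain.Dart) : ℂ :=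
  ∑' x : ℤ, Complex.exp (-(Complex.I * k * x)) * Ψ (liftArc x f)

/-- The twisted walk `Û(k)` on `ℓ²(A(𝒟))`, through which the Grover walk on `C₄'` acts on Fourier
transforms. The phase is `e^{ik}` on `(0, 0')` since the arc `(x, (0, 0'))` ends in the
copy `x + 1`. -/
def twistedStep (k : ℝ) (φ : domain.Dart → ℂ) : domain.Dart → ℂ := fun f =>
  Complex.exp (Complex.I * k * winding f) * groverStep domain φ f

/-- The roots `λ_j(k)` of `9 λ³ - 7 λ - 2 cos k = 0`. -/
def eigRW (j : Fin 3) (k : ℝ) : ℝ :=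
  2 * √7 / (3 * √3) *
    Real.cos (1 / 3 * Real.arccos (9 * √3 / (7 * √7) * Real.cos k) + 2 * (j : ℕ) * Real.pi / 3)

/-- `ν_{j,l}(k) = λ_j(k) + (-1)^l i √(1 - λ_j(k)²)`. -/
def eigQW (j : Fin 3) (l : Fin 2) (k : ℝ) : ℂ :=
  (eigRW j k : ℂ) + (-1) ^ (l : ℕ) * Complex.I * (√(1 - eigRW j k ^ 2) : ℝ)

/-- `x_{j,l}(k) = i ν'_{j,l}(k) / ν_{j,l}(k)`; this number is real since `|ν_{j,l}| = 1`. -/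
def velocity (j : Fin 3) (l : Fin 2) (k : ℝ) : ℝ :=
  (Complex.I * deriv (eigQW j l) k / eigQW j l k).re

/-- `v_{j,l}(k)` are normalized eigenvectors of `Û(k)` for the eigenvalues `ν_{j,l}(k)`. -/
def IsEigenvectorFamily (v : Fin 3 → Fin 2 → ℝ → domain.Dart → ℂ) : Prop :=
  ∀ j l k, ∑ f, ‖v j l k f‖ ^ 2 = 1 ∧
    ∀ f, twistedStep k (v j l k) f = eigQW j l k * v j l k f

/-- `w_{j,l}(k) = |⟨v_{j,l}(k), Φ(k)⟩|²`. -/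
def weight (v : Fin 3 → Fin 2 → ℝ → domain.Dart → ℂ) (Φ : ℝ → domain.Dart → ℂ)
    (j : Fin 3) (l : Fin 2) (k : ℝ) : ℝ :=
  ‖∑ f, (starRingEnd ℂ) (v j l k f) * Φ k f‖ ^ 2

end

noncomputable section

/-! ### The roots of `9 λ³ - 7 λ = 2 cos k` -/

/-! Fourier transformation in the label turns the walk into the unitary 10×10 matrices Û(k). By
Parseval, the characteristic function of X_t/t at ξ is (1/2π) ∫ ⟨Û(k)^t Φ(k), Û(k-ξ/t)^t Φ(k-ξ/t)⟩
dk. Translations are continuous in L² and Û is isometric, so Φ(k-ξ/t) may be replaced by Φ(k)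
(`IsFourierFamily.norm_integral_error_le`). Expand both entries in eigenvectors. Mixed terms vanish
in the limit because different eigenspaces are orthogonal. In the diagonal terms conj(ν(k))^t
ν(k-ξ/t)^t tends to exp(iξx(k)) with x = iν'/ν (`tendsto_eigenvalue_ratio`). Dominated convergence
gives `IsFourierFamily.tendsto_correlation`: the limit law is the image of the spectral weights
under the velocities.

The spectrum comes from the twisted random walk on 𝒟: ν + 1/ν = 2λ, where 9λ³ - 7λ = 2 cos k.
Besides these six eigenvalues there are the four constants i^m, carried by cycle vectors independent
of k. When sin k and cos k are nonzero the ten values are distinct, hence a complete orthogonal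
eigenbasis exists (`sum_modeProj`). The constant modes have velocity 0 and total mass Δ
(`homMass_eq_integral`), which is the atom at 0.

For the other modes, differentiating the cubic gives x explicitly, and dx/dk has the sign of (-1)^l
λ(27λ² - 7). Thus x is monotone on the parameter intervals, and its limits at their ends are ±1/√10
and ±2/7. The reflection k ↦ π - k takes λ₁ to -λ₀ and λ₂ to -λ₂ and preserves velocities. It
therefore folds band 1 onto band 0, and one half of band 2 onto the other. A change of variables
then yields the densities (`exists_density`, `IsFourierFamily.exists_band_density`), and Lévy's
continuity theorem concludes (`tendsto_distribution`). -/

theorem abs_mul_cos_lt_one (k : ℝ) : |9 * √3 / (7 * √7) * Real.cos k| < 1 := by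
  have h3 : √3 ^ 2 = 3 := Real.sq_sqrt (by norm_num)
  have h7 : √7 ^ 2 = 7 := Real.sq_sqrt (by norm_num)
  have h7p : 0 < √7 := by positivity
  -- The squared coefficient is 243/343 < 1, so the argument of arccos stays where arccos is
  -- differentiable.
  rw [← sq_lt_one_iff_abs_lt_one, mul_pow, div_pow, mul_pow, mul_pow, h3, h7]
  nlinarith [Real.cos_sq_le_one k, sq_nonneg (Real.cos k)]

theorem eigRW_amplitude_sq : (2 * √7 / (3 * √3)) ^ 2 = 28 / 27 := by
  have h3 : √3 ^ 2 = 3 := Real.sq_sqrt (by norm_num)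
  have h7 : √7 ^ 2 = 7 := Real.sq_sqrt (by norm_num)
  rw [div_pow, mul_pow, mul_pow, h3, h7]
  norm_num

/-- Viète's trigonometric solution: for A² = 28/27 the substitution λ = A cos x reduces the cubic to
the triple-angle formula. -/
theorem eigRW_cubic (j : Fin 3) (k : ℝ) :
    9 * eigRW j k ^ 3 - 7 * eigRW j k = 2 * Real.cos k := by
  have h3 : √3 ^ 2 = 3 := Real.sq_sqrt (by norm_num)
  have h7 : √7 ^ 2 = 7 := Real.sq_sqrt (by norm_num)
  have h3p : 0 < √3 := by positivity
  have h7p : 0 < √7 := by positivity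
  have hA := eigRW_amplitude_sq
  have hz := abs_lt.1 (abs_mul_cos_lt_one k)
  unfold eigRW
  set A := 2 * √7 / (3 * √3) with hAdef
  set z := 9 * √3 / (7 * √7) * Real.cos k with hzdef
  set x := 1 / 3 * Real.arccos z + 2 * (j : ℕ) * Real.pi / 3 with hx
  have h1 : Real.cos (3 * x) = z := by
    have : 3 * x = Real.arccos z + (j : ℕ) * (2 * Real.pi) := by rw [hx]; ring
    rw [this, Real.cos_add_nat_mul_two_pi, Real.cos_arccos hz.1.le hz.2.le]
  rw [Real.cos_three_mul] at h1
  have h2 : A * z = 6 / 7 * Real.cos k := by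
    rw [hAdef, hzdef]
    field_simp
    ring
  have : 9 * (A * Real.cos x) ^ 3 - 7 * (A * Real.cos x) =
      7 / 3 * (A * (4 * Real.cos x ^ 3 - 3 * Real.cos x)) +
        9 * (A ^ 2 - 28 / 27) * A * Real.cos x ^ 3 := by ring
  rw [this, h1, h2, hA]
  ring

/-- Since arccos(-z) = π - arccos z, the angle θ/3 of branch 0 becomes π - θ/3. -/
theorem eigRW_one_pi_sub (k : ℝ) : eigRW 1 (Real.pi - k) = -eigRW 0 k := by
  unfold eigRW
  rw [Real.cos_pi_sub, mul_neg, Real.arccos_neg, ← mul_neg, ← Real.cos_pi_sub]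
  congr 2
  simp
  ring

theorem eigRW_two_pi_sub (k : ℝ) : eigRW 2 (Real.pi - k) = -eigRW 2 k := by
  unfold eigRW
  rw [Real.cos_pi_sub, mul_neg, Real.arccos_neg, ← mul_neg, ← Real.cos_pi_sub,
    ← Real.cos_add_two_pi (Real.pi - _)]
  congr 2
  simp
  ring

theorem eigRW_periodic (j : Fin 3) (k : ℝ) : eigRW j (k + 2 * Real.pi) = eigRW j k := by
  unfold eigRW
  rw [Real.cos_add_two_pi]

/-- The range of arccos gives the crude bound λ > 1/2. The sharp bounds follow from the
factorizations of the cubic at cos k = ∓1, namely 9L³ - 7L + 2 = (1+L)(3L-1)(3L-2) and 9L³ - 7L - 2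
= (L-1)(3L+1)(3L+2). -/
theorem eigRW_zero_mem (k : ℝ) : 2 / 3 ≤ eigRW 0 k ∧ eigRW 0 k ≤ 1 := by
  have hc := eigRW_cubic 0 k
  have hA := eigRW_amplitude_sq
  have hAp : 0 < 2 * √7 / (3 * √3) := by positivity
  have hcos : 1 / 2 ≤ Real.cos (1 / 3 * Real.arccos (9 * √3 / (7 * √7) * Real.cos k)) := by
    rw [← Real.cos_pi_div_three]
    have h0 := Real.arccos_nonneg (9 * √3 / (7 * √7) * Real.cos k)
    have h1 := Real.arccos_le_pi (9 * √3 / (7 * √7) * Real.cos k)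
    apply Real.cos_le_cos_of_nonneg_of_le_pi <;> linarith [Real.pi_pos]
  have hl : eigRW 0 k = 2 * √7 / (3 * √3) *
      Real.cos (1 / 3 * Real.arccos (9 * √3 / (7 * √7) * Real.cos k)) := by
    simp [eigRW]
  have hpos : 0 < eigRW 0 k := by rw [hl]; positivity
  have hsq : 7 / 27 ≤ eigRW 0 k ^ 2 := by rw [hl, mul_pow, hA]; nlinarith
  set L := eigRW 0 k
  have hL : 1 / 2 < L := by nlinarith
  constructor
  · by_contra! h
    have : (1 + L) * (3 * L - 1) * (3 * L - 2) = 2 + 2 * Real.cos k := by rw [← hc]; ring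
    have h2 : (1 + L) * (3 * L - 1) * (3 * L - 2) < 0 :=
      mul_neg_of_pos_of_neg (mul_pos (by linarith) (by linarith)) (by linarith)
    linarith [Real.neg_one_le_cos k]
  · by_contra! h
    have : (L - 1) * (3 * L + 1) * (3 * L + 2) = 2 * Real.cos k - 2 := by rw [← hc]; ring
    have h2 : 0 < (L - 1) * (3 * L + 1) * (3 * L + 2) :=
      mul_pos (mul_pos (by linarith) (by linarith)) (by linarith)
    linarith [Real.cos_le_one k]

/-- The crude bound |λ| < 0.6 fixes the signs of two factors in the factorization at cos k = 1,
which gives the lower bound. The upper one is its reflection under k ↦ π - k. -/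
theorem eigRW_two_mem (k : ℝ) : -(1 / 3) ≤ eigRW 2 k ∧ eigRW 2 k ≤ 1 / 3 := by
  have hA := eigRW_amplitude_sq
  have key : ∀ k, -(1 / 3) ≤ eigRW 2 k := by
    intro k
    have hc := eigRW_cubic 2 k
    have hl : eigRW 2 k = 2 * √7 / (3 * √3) *
        -Real.cos (1 / 3 * Real.arccos (9 * √3 / (7 * √7) * Real.cos k) + Real.pi / 3) := by
      rw [← Real.cos_add_pi]
      unfold eigRW
      congr 2
      simp
      ring
    have h0 := Real.arccos_nonneg (9 * √3 / (7 * √7) * Real.cos k)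
    have h1 := Real.arccos_le_pi (9 * √3 / (7 * √7) * Real.cos k)
    have hc1 : Real.cos (1 / 3 * Real.arccos (9 * √3 / (7 * √7) * Real.cos k) + Real.pi / 3)
        ≤ 1 / 2 := by
      rw [← Real.cos_pi_div_three]
      apply Real.cos_le_cos_of_nonneg_of_le_pi <;> linarith [Real.pi_pos]
    have hc2 : -(1 / 2) ≤
        Real.cos (1 / 3 * Real.arccos (9 * √3 / (7 * √7) * Real.cos k) + Real.pi / 3) := by
      rw [← Real.cos_pi_div_three, ← Real.cos_pi_sub]
      apply Real.cos_le_cos_of_nonneg_of_le_pi <;> linarith [Real.pi_pos]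
    have hsq : eigRW 2 k ^ 2 ≤ 7 / 27 := by rw [hl, mul_pow, hA]; nlinarith
    set L := eigRW 2 k
    have hL1 : L < 0.6 := by nlinarith
    have hL2 : -0.6 < L := by nlinarith
    by_contra! h
    have : (L - 1) * (3 * L + 1) * (3 * L + 2) = 2 * Real.cos k - 2 := by rw [← hc]; ring
    have h2 : 0 < (L - 1) * (3 * L + 1) * (3 * L + 2) :=
      mul_pos (mul_pos_of_neg_of_neg (by linarith) (by linarith)) (by linarith)
    linarith [Real.cos_le_one k]
  refine ⟨key k, ?_⟩
  have := key (Real.pi - k)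
  rw [eigRW_two_pi_sub] at this
  linarith

theorem eigRW_one_mem (k : ℝ) : -1 ≤ eigRW 1 k ∧ eigRW 1 k ≤ -(2 / 3) := by
  have h := eigRW_one_pi_sub (Real.pi - k)
  rw [sub_sub_cancel] at h
  have := eigRW_zero_mem (Real.pi - k)
  constructor <;> linarith

/-- This is the derivative of the cubic: λ² is at least 4/9 or at most 1/9, and 7/27 lies strictly
between, so the three roots never collide. -/
theorem eigRW_denominator_ne_zero (j : Fin 3) (k : ℝ) : 27 * eigRW j k ^ 2 - 7 ≠ 0 := by
  fin_cases j
  · have := eigRW_zero_mem k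
    simp only [Fin.zero_eta]
    nlinarith
  · have := eigRW_one_mem k
    simp only [Fin.mk_one]
    nlinarith
  · have := eigRW_two_mem k
    simp only [Fin.reduceFinMk]
    nlinarith

theorem eigRW_zero_lt_one {k : ℝ} (hk : Real.cos k ≠ 1) : eigRW 0 k < 1 := by
  refine lt_of_le_of_ne (eigRW_zero_mem k).2 fun h => hk ?_
  have := eigRW_cubic 0 k
  rw [h] at this
  linarith

theorem neg_one_lt_eigRW_one {k : ℝ} (hk : Real.cos k ≠ -1) : -1 < eigRW 1 k := by
  refine lt_of_le_of_ne (eigRW_one_mem k).1 fun h => hk ?_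
  have := eigRW_cubic 1 k
  rw [← h] at this
  linarith

theorem eigRW_two_neg {k : ℝ} (hk : 0 < Real.cos k) : eigRW 2 k < 0 := by
  by_contra! h
  have := eigRW_cubic 2 k
  have h2 := eigRW_two_mem k
  nlinarith [mul_nonneg h (show (0:ℝ) ≤ 7 - 9 * eigRW 2 k ^ 2 by nlinarith)]

theorem eigRW_two_ne_zero {k : ℝ} (hk : Real.cos k ≠ 0) : eigRW 2 k ≠ 0 := fun h => hk <| by
  have := eigRW_cubic 2 k
  rw [h] at this
  linarith

/-- The product of the two factorizations of 2 - 2 cos k and 2 + 2 cos k in terms of λ. -/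
theorem four_sin_sq_eq (j : Fin 3) (k : ℝ) : 4 * Real.sin k ^ 2 =
    (1 - eigRW j k ^ 2) * ((9 * eigRW j k ^ 2 - 1) * (9 * eigRW j k ^ 2 - 4)) := by
  have h := eigRW_cubic j k
  have h2 := Real.sin_sq_add_cos_sq k
  have : 4 * Real.sin k ^ 2 = 4 - (2 * Real.cos k) ^ 2 := by linarith
  rw [this, ← h]
  ring

/-- The explicit formula gives differentiability only; the value comes from differentiating the
cubic implicitly. -/
theorem hasDerivAt_eigRW (j : Fin 3) (k : ℝ) :
    HasDerivAt (eigRW j) (-2 * Real.sin k / (27 * eigRW j k ^ 2 - 7)) k := by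
  have hz := abs_lt.1 (abs_mul_cos_lt_one k)
  have hd : DifferentiableAt ℝ (eigRW j) k := by
    unfold eigRW
    have h1 : DifferentiableAt ℝ
        (fun k => Real.arccos (9 * √3 / (7 * √7) * Real.cos k)) k :=
      DifferentiableAt.comp (g := Real.arccos) k
        (Real.differentiableAt_arccos.2 ⟨hz.1.ne', hz.2.ne⟩) (by fun_prop)
    fun_prop
  have h1 := hd.hasDerivAt
  have h2 : HasDerivAt (fun k => 9 * eigRW j k ^ 3 - 7 * eigRW j k) _ k :=
    ((h1.pow 3).const_mul 9).sub (h1.const_mul 7)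
  have h3 : HasDerivAt (fun k => 2 * Real.cos k) _ k := (Real.hasDerivAt_cos k).const_mul 2
  have h4 : (fun k => 9 * eigRW j k ^ 3 - 7 * eigRW j k) = fun k => 2 * Real.cos k :=
    funext (eigRW_cubic j)
  rw [h4] at h2
  have h5 := h2.unique h3
  refine h1.congr_deriv ?_
  rw [eq_div_iff (eigRW_denominator_ne_zero j k)]
  norm_num at h5
  linarith

theorem continuous_eigRW (j : Fin 3) : Continuous (eigRW j) :=
  continuous_iff_continuousAt.2 fun k => (hasDerivAt_eigRW j k).continuousAt

/-! ### The eigenvalues and velocities -/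

theorem hasDerivAt_sqrt_one_sub_eigRW_sq (j : Fin 3) {k : ℝ} (hk : eigRW j k ^ 2 < 1) :
    HasDerivAt (fun k => √(1 - eigRW j k ^ 2))
      (-(eigRW j k * (-2 * Real.sin k / (27 * eigRW j k ^ 2 - 7)) / √(1 - eigRW j k ^ 2))) k := by
  have h : HasDerivAt (fun k => √(1 - eigRW j k ^ 2)) _ k :=
    (((hasDerivAt_eigRW j k).pow 2).const_sub 1).sqrt (by simp only [Pi.pow_apply]; linarith)
  refine h.congr_deriv ?_
  have hr : 0 < √(1 - eigRW j k ^ 2) := Real.sqrt_pos.2 (by linarith)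
  simp only [Pi.pow_apply]
  field_simp
  norm_num
  ring

theorem continuous_eigQW (j : Fin 3) (l : Fin 2) : Continuous (eigQW j l) := by
  have := continuous_eigRW j
  unfold eigQW
  fun_prop

theorem eigQW_periodic (j : Fin 3) (l : Fin 2) (k : ℝ) :
    eigQW j l (k + 2 * Real.pi) = eigQW j l k := by
  unfold eigQW
  rw [eigRW_periodic]

theorem eigRW_sq_le_one (j : Fin 3) (k : ℝ) : eigRW j k ^ 2 ≤ 1 := by
  fin_cases j
  · have := eigRW_zero_mem k
    simp only [Fin.zero_eta]
    nlinarith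
  · have := eigRW_one_mem k
    simp only [Fin.mk_one]
    nlinarith
  · have := eigRW_two_mem k
    simp only [Fin.reduceFinMk]
    nlinarith

theorem norm_eigQW (j : Fin 3) (l : Fin 2) (k : ℝ) : ‖eigQW j l k‖ = 1 := by
  have h := Real.sq_sqrt (sub_nonneg.2 (eigRW_sq_le_one j k))
  rw [← sq_eq_sq₀ (norm_nonneg _) zero_le_one, ← Complex.normSq_eq_norm_sq, Complex.normSq_apply]
  fin_cases l <;> simp [eigQW] <;> nlinarith

theorem eigQW_ne_zero (j : Fin 3) (l : Fin 2) (k : ℝ) : eigQW j l k ≠ 0 := by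
  rw [← norm_ne_zero_iff, norm_eigQW]
  exact one_ne_zero

theorem eigQW_re (j : Fin 3) (l : Fin 2) (k : ℝ) : (eigQW j l k).re = eigRW j k := by
  fin_cases l <;> simp [eigQW]

theorem eigQW_im (j : Fin 3) (l : Fin 2) (k : ℝ) :
    (eigQW j l k).im = (-1) ^ (l : ℕ) * √(1 - eigRW j k ^ 2) := by
  fin_cases l <;> simp [eigQW]

/-- Writing ν = exp(±i arccos λ) gives ν'/ν = ∓iλ'/√(1-λ²), and the real factor after -i is the
velocity. -/
theorem hasDerivAt_eigQW_explicit (j : Fin 3) (l : Fin 2) {k : ℝ} (hk : eigRW j k ^ 2 < 1) :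
    HasDerivAt (eigQW j l) (-Complex.I * ((-1) ^ (l : ℕ) * (-2 * Real.sin k) /
      ((27 * eigRW j k ^ 2 - 7) * √(1 - eigRW j k ^ 2)) : ℝ) * eigQW j l k) k := by
  have h1 := (hasDerivAt_eigRW j k).ofReal_comp
  have h2 := (hasDerivAt_sqrt_one_sub_eigRW_sq j hk).ofReal_comp
  have h3 := h1.add (h2.const_mul ((-1) ^ (l : ℕ) * Complex.I))
  have h0 := eigRW_denominator_ne_zero j k
  have hr : 0 < √(1 - eigRW j k ^ 2) := Real.sqrt_pos.2 (by linarith)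
  refine HasDerivAt.congr_deriv (f := eigQW j l) h3 ?_
  unfold eigQW
  have hrc : ((√(1 - eigRW j k ^ 2) : ℝ) : ℂ) ≠ 0 := by exact_mod_cast hr.ne'
  have h0c : (27 * (eigRW j k : ℂ) ^ 2 - 7) ≠ 0 := by exact_mod_cast h0
  push_cast
  generalize ((√(1 - eigRW j k ^ 2) : ℝ) : ℂ) = r at *
  field_simp
  have hs : ((-1 : ℂ) ^ (l : ℕ)) ^ 2 = 1 := by fin_cases l <;> simp
  linear_combination (-Complex.sin k * r * ((-1) ^ (l : ℕ)) ^ 2) * Complex.I_sq +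
    Complex.sin k * r * hs

theorem velocity_eq (j : Fin 3) (l : Fin 2) {k : ℝ} (hk : eigRW j k ^ 2 < 1) :
    velocity j l k = (-1) ^ (l : ℕ) * (-2 * Real.sin k) /
      ((27 * eigRW j k ^ 2 - 7) * √(1 - eigRW j k ^ 2)) := by
  unfold velocity
  rw [(hasDerivAt_eigQW_explicit j l hk).deriv, ← mul_assoc,
    mul_div_assoc, div_self (eigQW_ne_zero j l k), mul_one, ← mul_assoc, mul_neg,
    Complex.I_mul_I, neg_neg, one_mul, Complex.ofReal_re]

theorem hasDerivAt_eigQW (j : Fin 3) (l : Fin 2) {k : ℝ} (hk : eigRW j k ^ 2 < 1) :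
    HasDerivAt (eigQW j l) (-Complex.I * velocity j l k * eigQW j l k) k := by
  rw [velocity_eq j l hk]
  exact hasDerivAt_eigQW_explicit j l hk

theorem velocity_one_eq_neg (j : Fin 3) {k : ℝ} (hk : eigRW j k ^ 2 < 1) :
    velocity j 1 k = -velocity j 0 k := by
  rw [velocity_eq j 1 hk, velocity_eq j 0 hk]
  simp
  ring

/-- The factor 1 - λ² of sin² k cancels, leaving a rational function of λ that stays bounded as λ² →
1. -/
theorem velocity_sq (j : Fin 3) (l : Fin 2) {k : ℝ} (hk : eigRW j k ^ 2 < 1) :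
    velocity j l k ^ 2 = (9 * eigRW j k ^ 2 - 1) * (9 * eigRW j k ^ 2 - 4) /
      (27 * eigRW j k ^ 2 - 7) ^ 2 := by
  rw [velocity_eq j l hk]
  have h0 := eigRW_denominator_ne_zero j k
  have hr : (1 - eigRW j k ^ 2) ≠ 0 := by linarith
  have h4 := four_sin_sq_eq j k
  have hs : ((-1 : ℝ) ^ (l : ℕ)) ^ 2 = 1 := by fin_cases l <;> simp
  rw [div_pow, mul_pow, mul_pow, mul_pow, hs, Real.sq_sqrt (by linarith)]
  rw [div_eq_div_iff (by positivity) (by positivity)]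
  linear_combination (27 * eigRW j k ^ 2 - 7) ^ 2 * h4

/-- After the quotient rule, cos k and sin² k are eliminated through the cubic, so that the sign can
be read off from λ alone. -/
theorem hasDerivAt_velocity (j : Fin 3) (l : Fin 2) {k : ℝ} (hk : eigRW j k ^ 2 < 1) :
    HasDerivAt (velocity j l) ((-1) ^ (l : ℕ) * (3 * eigRW j k * √(1 - eigRW j k ^ 2) *
      (27 * eigRW j k ^ 2 + 33)) / (27 * eigRW j k ^ 2 - 7) ^ 3) k := by
  have h0 := eigRW_denominator_ne_zero j k
  have hr : 0 < √(1 - eigRW j k ^ 2) := Real.sqrt_pos.2 (by linarith)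
  have hr2 : √(1 - eigRW j k ^ 2) ^ 2 = 1 - eigRW j k ^ 2 := Real.sq_sqrt (by linarith)
  have h4 := four_sin_sq_eq j k
  have hc := eigRW_cubic j k
  -- The closed form is available only where λ² < 1, an open condition.
  have hev : velocity j l =ᶠ[𝓝 k] fun k => (-1) ^ (l : ℕ) * (-2 * Real.sin k) /
      ((27 * eigRW j k ^ 2 - 7) * √(1 - eigRW j k ^ 2)) := by
    filter_upwards [((continuous_eigRW j).pow 2).continuousAt.eventually_lt
      continuousAt_const hk] with y hy using velocity_eq j l hy
  refine HasDerivAt.congr_of_eventuallyEq ?_ hev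
  have h1 := (((hasDerivAt_eigRW j k).pow 2).const_mul 27).sub_const 7
  have h2 := h1.mul (hasDerivAt_sqrt_one_sub_eigRW_sq j hk)
  have h3 := (((Real.hasDerivAt_sin k).const_mul (-2)).const_mul ((-1) ^ (l : ℕ))).div h2
    (mul_ne_zero h0 hr.ne')
  refine h3.congr_deriv ?_
  simp only [Pi.mul_apply, Pi.pow_apply]
  generalize √(1 - eigRW j k ^ 2) = r at *
  generalize eigRW j k = L at *
  generalize (-1 : ℝ) ^ (l : ℕ) = s at *
  have hcos : Real.cos k = (9 * L ^ 3 - 7 * L) / 2 := by linarith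
  rw [hcos]
  generalize Real.sin k = S at *
  norm_num
  rw [div_eq_div_iff (by positivity) (by positivity)]
  field_simp
  have hS : S ^ 2 = r ^ 2 * ((9 * L ^ 2 - 1) * (9 * L ^ 2 - 4)) / 4 := by rw [hr2]; linarith
  rw [hS]
  linear_combination (s * L * (L ^ 2 * 27 - 7) ^ 2 * r ^ 2 *
    (-54 * ((9 * L ^ 2 - 1) * (9 * L ^ 2 - 4)) - 3 * (27 * L ^ 2 + 33))) * hr2

/-! ### The parameter intervals -/

theorem cos_ne_one_of_mem_Ioo {k : ℝ} (hk : k ∈ Set.Ioo 0 (2 * Real.pi)) : Real.cos k ≠ 1 := by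
  intro h
  have := (Real.cos_eq_one_iff_of_lt_of_lt (by linarith [hk.1, Real.pi_pos]) hk.2).1 h
  exact hk.1.ne' this

theorem eigRW_zero_sq_lt_one {k : ℝ} (hk : k ∈ Set.Ioo 0 (2 * Real.pi)) : eigRW 0 k ^ 2 < 1 := by
  have h1 := eigRW_zero_lt_one (cos_ne_one_of_mem_Ioo hk)
  have h2 := eigRW_zero_mem k
  nlinarith

theorem eigRW_two_sq_lt_one (k : ℝ) : eigRW 2 k ^ 2 < 1 := by
  have h2 := eigRW_two_mem k
  nlinarith

/-! ### Monotonicity and ranges of the velocities. -/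

theorem deriv_velocity_zero_pos {k : ℝ} (hk : k ∈ Set.Ioo 0 (2 * Real.pi)) :
    0 < deriv (velocity 0 0) k := by
  have h1 := eigRW_zero_sq_lt_one hk
  have h2 := eigRW_zero_mem k
  have hr : 0 < √(1 - eigRW 0 k ^ 2) := Real.sqrt_pos.2 (by linarith)
  have hy : 0 < 27 * eigRW 0 k ^ 2 - 7 := by nlinarith
  have hL : 0 < eigRW 0 k := by linarith
  rw [(hasDerivAt_velocity 0 0 h1).deriv]
  simp only [Fin.coe_ofNat_eq_mod, Nat.zero_mod, pow_zero, one_mul]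
  positivity

theorem deriv_velocity_two_pos {k : ℝ} (hk : k ∈ Set.Ioo (-(Real.pi / 2)) (Real.pi / 2)) :
    0 < deriv (velocity 2 0) k := by
  have h1 := eigRW_two_sq_lt_one k
  have h2 := eigRW_two_mem k
  have hr : 0 < √(1 - eigRW 2 k ^ 2) := Real.sqrt_pos.2 (by linarith)
  have hy : 27 * eigRW 2 k ^ 2 - 7 < 0 := by nlinarith
  have hL : eigRW 2 k < 0 := eigRW_two_neg (Real.cos_pos_of_mem_Ioo hk)
  rw [(hasDerivAt_velocity 2 0 h1).deriv]
  simp only [Fin.coe_ofNat_eq_mod, Nat.zero_mod, pow_zero, one_mul]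
  -- On this interval λ₂ < 0 and 27λ₂² - 7 < 0, so numerator and cubed denominator are both
  -- negative.
  refine div_pos_of_neg_of_neg ?_ (Odd.pow_neg (by decide) hy)
  have : 0 < √(1 - eigRW 2 k ^ 2) * (27 * eigRW 2 k ^ 2 + 33) := by positivity
  nlinarith

theorem strictMonoOn_velocity_zero :
    StrictMonoOn (velocity 0 0) (Set.Ioo 0 (2 * Real.pi)) := by
  refine strictMonoOn_of_deriv_pos (convex_Ioo _ _) (fun k hk =>
    (hasDerivAt_velocity 0 0 (eigRW_zero_sq_lt_one hk)).continuousAt.continuousWithinAt) ?_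
  rw [interior_Ioo]
  exact fun k hk => deriv_velocity_zero_pos hk

theorem strictMonoOn_velocity_two :
    StrictMonoOn (velocity 2 0) (Set.Ioo (-(Real.pi / 2)) (Real.pi / 2)) := by
  refine strictMonoOn_of_deriv_pos (convex_Ioo _ _) (fun k hk =>
    (hasDerivAt_velocity 2 0 (eigRW_two_sq_lt_one k)).continuousAt.continuousWithinAt) ?_
  rw [interior_Ioo]
  exact fun k hk => deriv_velocity_two_pos hk

/-- At k = 0 and k = 2π the closed form of the velocity is 0/0, since λ₀ = 1 there. Cancelling
sin(k/2) leaves an expression continuous on all of ℝ, from which the endpoint limits are read off.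
-/
theorem velocity_zero_eq_half_angle {k : ℝ} (hk : k ∈ Set.Ioo 0 (2 * Real.pi)) :
    velocity 0 0 k = -2 * Real.cos (k / 2) * √((3 * eigRW 0 k + 1) * (3 * eigRW 0 k + 2)) /
      ((27 * eigRW 0 k ^ 2 - 7) * √(1 + eigRW 0 k)) := by
  rw [velocity_eq 0 0 (eigRW_zero_sq_lt_one hk)]
  have h1 := eigRW_zero_lt_one (cos_ne_one_of_mem_Ioo hk)
  have h2 := eigRW_zero_mem k
  have h0 := eigRW_denominator_ne_zero 0 k
  have hc := eigRW_cubic 0 k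
  have hsin : 0 < Real.sin (k / 2) :=
    Real.sin_pos_of_pos_of_lt_pi (by linarith [hk.1]) (by linarith [hk.2])
  have hs : Real.sin k = 2 * Real.sin (k / 2) * Real.cos (k / 2) := by
    rw [← Real.sin_two_mul]; ring_nf
  have hcs : Real.cos k = 1 - 2 * Real.sin (k / 2) ^ 2 := by
    have := Real.cos_two_mul (k / 2)
    rw [mul_div_cancel₀ k two_ne_zero] at this
    linarith [Real.sin_sq_add_cos_sq (k / 2)]
  have hfac : √(1 - eigRW 0 k ^ 2) = √(1 - eigRW 0 k) * √(1 + eigRW 0 k) := by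
    rw [← Real.sqrt_mul (by linarith)]; ring_nf
  -- The cubic gives (1-λ)(3λ+1)(3λ+2) = 2 - 2 cos k = 4 sin²(k/2), and sin(k/2) > 0 on the
  -- interval.
  have hprod : √(1 - eigRW 0 k) * √((3 * eigRW 0 k + 1) * (3 * eigRW 0 k + 2)) =
      2 * Real.sin (k / 2) := by
    rw [← Real.sqrt_mul (by linarith), Real.sqrt_eq_iff_eq_sq (by nlinarith) (by positivity)]
    linarith
  have ha : 0 < √(1 - eigRW 0 k) := Real.sqrt_pos.2 (by linarith)
  have hb : 0 < √(1 + eigRW 0 k) := Real.sqrt_pos.2 (by linarith)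
  rw [hfac, hs, ← hprod]
  simp only [Fin.coe_ofNat_eq_mod, Nat.zero_mod, pow_zero, one_mul]
  field_simp

theorem bijOn_velocity_zero : Set.BijOn (velocity 0 0) (Set.Ioo 0 (2 * Real.pi))
    (Set.Ioo (-(1 / √10)) (1 / √10)) := by
  refine ⟨fun k hk => ?_, strictMonoOn_velocity_zero.injOn, fun y hy => ?_⟩
  · have h1 := eigRW_zero_lt_one (cos_ne_one_of_mem_Ioo hk)
    have h2 := eigRW_zero_mem k
    have h0 : 0 < 27 * eigRW 0 k ^ 2 - 7 := by nlinarith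
    rw [Set.mem_Ioo, ← abs_lt, ← sq_lt_sq₀ (abs_nonneg _) (by positivity), sq_abs,
      velocity_sq 0 0 (eigRW_zero_sq_lt_one hk), div_pow, Real.sq_sqrt (by norm_num),
      div_lt_div_iff₀ (by positivity) (by norm_num)]
    -- With L = λ₀: (27L²-7)² - 10(9L²-1)(9L²-4) = 9(1-L²)(9L²+1).
    nlinarith [mul_pos (sub_pos.2 (eigRW_zero_sq_lt_one hk))
      (show (0 : ℝ) < 9 * eigRW 0 k ^ 2 + 1 by positivity)]
  -- The continuous extension of the velocity takes the values ∓√20·2/(20√2) = ∓1/√10 at the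
  -- endpoints, so the intermediate value theorem applies.
  · set g : ℝ → ℝ := fun k =>
      -2 * Real.cos (k / 2) * √((3 * eigRW 0 k + 1) * (3 * eigRW 0 k + 2)) /
      ((27 * eigRW 0 k ^ 2 - 7) * √(1 + eigRW 0 k)) with hg
    have hcont : Continuous g := by
      have h := continuous_eigRW 0
      refine Continuous.div (by fun_prop) (by fun_prop) fun k => ?_
      have h2 := eigRW_zero_mem k
      exact mul_ne_zero (eigRW_denominator_ne_zero 0 k) (Real.sqrt_pos.2 (by linarith)).ne'
    have hL : eigRW 0 0 = 1 := by
      have hc := eigRW_cubic 0 0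
      have h2 := eigRW_zero_mem 0
      rw [Real.cos_zero] at hc
      by_contra hne
      have : (eigRW 0 0 - 1) * ((3 * eigRW 0 0 + 1) * (3 * eigRW 0 0 + 2)) = 0 := by linarith
      rcases mul_eq_zero.1 this with h | h
      · exact hne (by linarith)
      · nlinarith
    have hL2 : eigRW 0 (2 * Real.pi) = 1 := by
      rw [← hL, ← eigRW_periodic 0 0, zero_add]
    have h20 : √20 / (20 * √2) = 1 / √10 / 2 := by
      have : √20 = √10 * √2 := by rw [← Real.sqrt_mul (by norm_num)]; norm_num
      rw [this]
      have h10 : √10 ^ 2 = 10 := Real.sq_sqrt (by norm_num)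
      field_simp
      linarith
    have hg0 : g 0 = -(1 / √10) := by
      simp only [hg, hL]
      norm_num at h20 ⊢
      rw [neg_div, mul_div_assoc, h20]
      ring
    have hg1 : g (2 * Real.pi) = 1 / √10 := by
      simp only [hg, hL2]
      rw [mul_div_cancel_left₀ _ two_ne_zero, Real.cos_pi]
      norm_num at h20 ⊢
      rw [mul_div_assoc, h20]
      ring
    have := intermediate_value_Ioo (by positivity) hcont.continuousOn (a := 0) (b := 2 * Real.pi)
    rw [hg0, hg1] at this
    obtain ⟨k, hk, rfl⟩ := this hy
    exact ⟨k, hk, velocity_zero_eq_half_angle hk⟩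

theorem bijOn_velocity_two : Set.BijOn (velocity 2 0)
    (Set.Ioo (-(Real.pi / 2)) (Real.pi / 2)) (Set.Ioo (-(2 / 7)) (2 / 7)) := by
  refine ⟨fun k hk => ?_, strictMonoOn_velocity_two.injOn, fun y hy => ?_⟩
  · have h1 := eigRW_two_neg (Real.cos_pos_of_mem_Ioo hk)
    have h2 := eigRW_two_mem k
    have h0 := eigRW_denominator_ne_zero 2 k
    rw [Set.mem_Ioo, ← abs_lt, ← sq_lt_sq₀ (abs_nonneg _) (by positivity), sq_abs,
      velocity_sq 2 0 (eigRW_two_sq_lt_one k), div_pow,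
      div_lt_div_iff₀ (by positivity) (by norm_num)]
    have h3 : 0 < eigRW 2 k ^ 2 := by nlinarith
    have h4 : eigRW 2 k ^ 2 ≤ 1 / 9 := by nlinarith
    nlinarith
  · have hcont : Continuous (velocity 2 0) := continuous_iff_continuousAt.2 fun k =>
      (hasDerivAt_velocity 2 0 (eigRW_two_sq_lt_one k)).continuousAt
    -- At the endpoints the middle root is λ₂ = 0, and the velocity is regular there.
    have hval : ∀ k, Real.cos k = 0 → velocity 2 0 k = 2 / 7 * Real.sin k := by
      intro k hk
      have hL : eigRW 2 k = 0 := by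
        have hc := eigRW_cubic 2 k
        have h2 := eigRW_two_mem k
        rw [hk] at hc
        have : eigRW 2 k * (9 * eigRW 2 k ^ 2 - 7) = 0 := by linarith
        rcases mul_eq_zero.1 this with h | h
        · exact h
        · nlinarith
      rw [velocity_eq 2 0 (eigRW_two_sq_lt_one k), hL]
      norm_num
      ring
    have := intermediate_value_Ioo (by linarith [Real.pi_pos]) hcont.continuousOn
      (a := -(Real.pi / 2)) (b := Real.pi / 2)
    rw [hval _ (by simp), hval _ (by simp)] at this
    obtain ⟨k, hk, rfl⟩ := this (by simpa using hy)
    exact ⟨k, hk, rfl⟩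

theorem Set.BijOn.neg_Ioo {f g : ℝ → ℝ} {s : Set ℝ} {c : ℝ} (hf : Set.BijOn f s (Set.Ioo (-c) c))
    (hg : ∀ k ∈ s, g k = -f k) : Set.BijOn g s (Set.Ioo (-c) c) := by
  refine ⟨fun k hk => ?_, fun a ha b hb hab => ?_, fun y hy => ?_⟩
  · rw [hg k hk]
    have := hf.mapsTo hk
    exact ⟨by linarith [this.2], by linarith [this.1]⟩
  · rw [hg a ha, hg b hb, neg_inj] at hab
    exact hf.injOn ha hb hab
  · obtain ⟨k, hk, h⟩ := hf.surjOn (show -y ∈ Set.Ioo (-c) c from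
      ⟨by linarith [hy.2], by linarith [hy.1]⟩)
    exact ⟨k, hk, by rw [hg k hk, h, neg_neg]⟩

theorem bijOn_velocity (l : Fin 2) :
    Set.BijOn (velocity 0 l) (Set.Ioo 0 (2 * Real.pi)) (Set.Ioo (-(1 / √10)) (1 / √10)) ∧
      Set.BijOn (velocity 2 l) (Set.Ioo (-(Real.pi / 2)) (Real.pi / 2))
        (Set.Ioo (-(2 / 7)) (2 / 7)) := by
  fin_cases l
  · exact ⟨bijOn_velocity_zero, bijOn_velocity_two⟩
  · exact ⟨bijOn_velocity_zero.neg_Ioo fun k hk => velocity_one_eq_neg 0 (eigRW_zero_sq_lt_one hk),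
      bijOn_velocity_two.neg_Ioo fun k _ => velocity_one_eq_neg 2 (eigRW_two_sq_lt_one k)⟩

/-- The closed form depends only on sin k and λ², both unchanged by the reflection. This allows two
bands to share one density. -/
theorem velocity_pi_sub {i j : Fin 3}
    (h : ∀ k, eigRW j (Real.pi - k) = -eigRW i k) (l : Fin 2) {k : ℝ} (hk : eigRW i k ^ 2 < 1) :
    velocity j l (Real.pi - k) = velocity i l k := by
  rw [velocity_eq i l hk, velocity_eq j l (by rw [h, neg_sq]; exact hk), h, neg_sq,
    Real.sin_pi_sub]

/-! ### Arcs of the fundamental domain -/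

theorem sum_darts_eq {V M : Type} [Fintype V] [DecidableEq V] [AddCommMonoid M] (G : SimpleGraph V)
    [DecidableRel G.Adj] (F : G.Dart → M) :
    ∑ f, F f = ∑ a, ∑ w : G.neighborSet a, F (G.dartOfNeighborSet a w) := by
  rw [Finset.sum_sigma']
  symm
  refine Finset.sum_bij (fun p _ => G.dartOfNeighborSet p.1 p.2) (fun _ _ => Finset.mem_univ _)
    ?_ ?_ (fun _ _ => rfl)
  · rintro ⟨a, w, hw⟩ - ⟨b, w', hw'⟩ - h
    have h1 : a = b := congrArg (fun f : G.Dart => f.fst) h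
    have h2 : w = w' := congrArg (fun f : G.Dart => f.snd) h
    subst h1 h2
    rfl
  · rintro ⟨⟨a, b⟩, h⟩ -
    exact ⟨⟨a, b, h⟩, by simp, rfl⟩

/-- The arc `(a, b)` of the fundamental domain. -/
def arc (a b : Cell) (h : domain.Adj a b := by decide) : domain.Dart := ⟨(a, b), h⟩

theorem sum_neighbors_o {M : Type} [AddCommMonoid M] (F : domain.Dart → M) :
    ∑ w : domain.neighborSet .o, F (domain.dartOfNeighborSet .o w) =
      F (arc .o .u) + F (arc .o .d) + F (arc .o .o') := by
  have : (Finset.univ : Finset (domain.neighborSet .o)) =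
      {⟨.u, by decide⟩, ⟨.d, by decide⟩, ⟨.o', by decide⟩} := by decide
  rw [this, Finset.sum_insert (by decide), Finset.sum_insert (by decide), Finset.sum_singleton,
    ← add_assoc]
  rfl

theorem sum_neighbors_o' {M : Type} [AddCommMonoid M] (F : domain.Dart → M) :
    ∑ w : domain.neighborSet .o', F (domain.dartOfNeighborSet .o' w) =
      F (arc .o' .u) + F (arc .o' .d) + F (arc .o' .o) := by
  have : (Finset.univ : Finset (domain.neighborSet .o')) =
      {⟨.u, by decide⟩, ⟨.d, by decide⟩, ⟨.o, by decide⟩} := by decide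
  rw [this, Finset.sum_insert (by decide), Finset.sum_insert (by decide), Finset.sum_singleton,
    ← add_assoc]
  rfl

theorem sum_neighbors_u {M : Type} [AddCommMonoid M] (F : domain.Dart → M) :
    ∑ w : domain.neighborSet .u, F (domain.dartOfNeighborSet .u w) =
      F (arc .u .o) + F (arc .u .o') := by
  have : (Finset.univ : Finset (domain.neighborSet .u)) =
      {⟨.o, by decide⟩, ⟨.o', by decide⟩} := by decide
  rw [this, Finset.sum_insert (by decide), Finset.sum_singleton]
  rfl

theorem sum_neighbors_d {M : Type} [AddCommMonoid M] (F : domain.Dart → M) :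
    ∑ w : domain.neighborSet .d, F (domain.dartOfNeighborSet .d w) =
      F (arc .d .o) + F (arc .d .o') := by
  have : (Finset.univ : Finset (domain.neighborSet .d)) =
      {⟨.o, by decide⟩, ⟨.o', by decide⟩} := by decide
  rw [this, Finset.sum_insert (by decide), Finset.sum_singleton]
  rfl

theorem sum_domain_darts {M : Type} [AddCommMonoid M] (F : domain.Dart → M) :
    ∑ f, F f = F (arc .o .u) + F (arc .o .d) + F (arc .o .o') + (F (arc .u .o) + F (arc .u .o')) +
      (F (arc .o' .u) + F (arc .o' .d) + F (arc .o' .o)) + (F (arc .d .o) + F (arc .d .o')) := by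
  have : (Finset.univ : Finset Cell) = {.o, .u, .o', .d} := rfl
  rw [sum_darts_eq, this, Finset.sum_insert (by decide), Finset.sum_insert (by decide),
    Finset.sum_insert (by decide), Finset.sum_singleton, sum_neighbors_o, sum_neighbors_u,
    sum_neighbors_o', sum_neighbors_d]
  simp only [add_assoc]

theorem forall_domain_darts {p : domain.Dart → Prop} : (∀ f, p f) ↔
    p (arc .o .u) ∧ p (arc .o .d) ∧ p (arc .o .o') ∧ p (arc .u .o) ∧ p (arc .u .o') ∧
      p (arc .o' .u) ∧ p (arc .o' .d) ∧ p (arc .o' .o) ∧ p (arc .d .o) ∧ p (arc .d .o') := by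
  refine ⟨fun h => ⟨h _, h _, h _, h _, h _, h _, h _, h _, h _, h _⟩, fun h f => ?_⟩
  obtain ⟨h1, h2, h3, h4, h5, h6, h7, h8, h9, h10⟩ := h
  obtain ⟨⟨a, b⟩, hf⟩ := f
  cases a <;> cases b <;> first | assumption | exact absurd hf (by decide)

theorem degree_domain (a : Cell) : domain.degree a = match a with
    | .o => 3 | .o' => 3 | .u => 2 | .d => 2 := by
  cases a <;> decide

/-! ### The walk on `chain` as a walk over the fundamental domain. -/

theorem groverStep_eq {V : Type} [DecidableEq V] (G : SimpleGraph V) [G.LocallyFinite]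
    (ψ : G.Dart → ℂ) (f : G.Dart) :
    groverStep G ψ f = 2 / (G.degree f.snd : ℂ) *
      ∑ w : G.neighborSet f.snd, ψ (G.dartOfNeighborSet f.snd w) - ψ f.symm := by
  unfold groverStep
  simp only [sub_mul, Finset.sum_sub_distrib, ← Finset.mul_sum, ite_mul, one_mul, zero_mul]
  congr 1
  rw [Finset.sum_eq_single_of_mem (⟨f.fst, f.adj.symm⟩ : G.neighborSet f.snd)
    (Finset.mem_univ _)]
  · rw [if_pos rfl]
    rfl
  · intro b _ hb
    exact if_neg fun h => hb (Subtype.ext h)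

/-- The arcs leaving `a` in `𝒟` lift to the arcs leaving `(x, a)` in `C₄'`. -/
def neighborLift (x : ℤ) (a : Cell) (w : domain.neighborSet a) : chain.neighborSet (x, a) :=
  ⟨(liftArc x (domain.dartOfNeighborSet a w)).snd,
    (liftArc x (domain.dartOfNeighborSet a w)).adj⟩

theorem chain_adj_winding {x y : ℤ} {a b : Cell} (h : chain.Adj (x, a) (y, b)) :
    ∃ h' : domain.Adj a b, y = x + winding ⟨(a, b), h'⟩ := by
  revert h
  cases a <;> cases b <;> simp [domain, chain, winding, cycleAdj] <;> omega

theorem bijective_neighborLift (x : ℤ) (a : Cell) : Function.Bijective (neighborLift x a) := by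
  constructor
  · intro w w' h
    have h1 := congrArg (fun p : chain.neighborSet (x, a) => p.1.2) h
    exact Subtype.ext h1
  · rintro ⟨⟨y, b⟩, h⟩
    obtain ⟨h', rfl⟩ := chain_adj_winding h
    exact ⟨⟨b, h'⟩, rfl⟩

theorem degree_chain (x : ℤ) (a : Cell) : chain.degree (x, a) = domain.degree a := by
  rw [← SimpleGraph.card_neighborSet_eq_degree, ← SimpleGraph.card_neighborSet_eq_degree]
  exact (Fintype.card_of_bijective (bijective_neighborLift x a)).symm

theorem sum_neighbors_chain {M : Type} [AddCommMonoid M] (F : chain.Dart → M) (x : ℤ) (a : Cell) :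
    ∑ w : chain.neighborSet (x, a), F (chain.dartOfNeighborSet (x, a) w) =
      ∑ w : domain.neighborSet a, F (liftArc x (domain.dartOfNeighborSet a w)) :=
  ((bijective_neighborLift x a).sum_comp
    fun w => F (chain.dartOfNeighborSet (x, a) w)).symm

theorem winding_symm (f : domain.Dart) : winding f.symm = -winding f := by
  revert f
  decide

theorem liftArc_symm (x : ℤ) (f : domain.Dart) :
    (liftArc x f).symm = liftArc (x + winding f) f.symm := by
  ext <;> simp [liftArc, winding_symm]

/-- The Grover walk on `C₄'` acts fibrewise as a twisted Grover walk on `𝒟`. -/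
theorem groverStep_chain (ψ : chain.Dart → ℂ) (x : ℤ) (f : domain.Dart) :
    groverStep chain ψ (liftArc x f) =
      groverStep domain (fun e => ψ (liftArc (x + winding f) e)) f := by
  rw [groverStep_eq, groverStep_eq, liftArc_symm]
  congr 2
  · congr 2
    exact degree_chain _ _
  · exact sum_neighbors_chain ψ _ _

theorem bijective_liftArc :
    Function.Bijective fun p : ℤ × domain.Dart => liftArc p.1 p.2 := by
  constructor
  · rintro ⟨x, f⟩ ⟨y, g⟩ h
    have h1 : x = y := congrArg (fun e : chain.Dart => e.fst.1) h
    have h2 : f.fst = g.fst := congrArg (fun e : chain.Dart => e.fst.2) h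
    have h3 : f.snd = g.snd := congrArg (fun e : chain.Dart => e.snd.2) h
    exact Prod.ext h1 (SimpleGraph.Dart.ext _ _ (Prod.ext h2 h3))
  · rintro ⟨⟨⟨x, a⟩, ⟨y, b⟩⟩, h⟩
    obtain ⟨h', rfl⟩ := chain_adj_winding h
    exact ⟨(x, ⟨(a, b), h'⟩), rfl⟩

/-- The identification `ℤ × A(𝒟) ≅ A(C₄')`. -/
def liftEquiv : ℤ × domain.Dart ≃ chain.Dart := Equiv.ofBijective _ bijective_liftArc

theorem sum_vertexWeight (ψ : chain.Dart → ℂ) (j : ℤ) :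
    ∑ a : Cell, vertexWeight chain ψ (j, a) = ∑ f, ‖ψ (liftArc j f)‖ ^ 2 := by
  rw [sum_darts_eq]
  exact Finset.sum_congr rfl fun a _ => sum_neighbors_chain (fun e => ‖ψ e‖ ^ 2) j a

/-! ### The twisted walk -/

theorem groverStep_domain_of_snd_o (φ : domain.Dart → ℂ) {f : domain.Dart} (h : f.snd = .o) :
    groverStep domain φ f = 2 / 3 * (φ (arc .o .u) + φ (arc .o .d) + φ (arc .o .o')) -
      φ f.symm := by
  rw [groverStep_eq, h, sum_neighbors_o, degree_domain]
  norm_num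

theorem groverStep_domain_of_snd_o' (φ : domain.Dart → ℂ) {f : domain.Dart} (h : f.snd = .o') :
    groverStep domain φ f = 2 / 3 * (φ (arc .o' .u) + φ (arc .o' .d) + φ (arc .o' .o)) -
      φ f.symm := by
  rw [groverStep_eq, h, sum_neighbors_o', degree_domain]
  norm_num

theorem groverStep_domain_of_snd_u (φ : domain.Dart → ℂ) {f : domain.Dart} (h : f.snd = .u) :
    groverStep domain φ f = φ (arc .u .o) + φ (arc .u .o') - φ f.symm := by
  rw [groverStep_eq, h, sum_neighbors_u, degree_domain]
  norm_num

theorem groverStep_domain_of_snd_d (φ : domain.Dart → ℂ) {f : domain.Dart} (h : f.snd = .d) :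
    groverStep domain φ f = φ (arc .d .o) + φ (arc .d .o') - φ f.symm := by
  rw [groverStep_eq, h, sum_neighbors_d, degree_domain]
  norm_num

section TwistedStep

variable (k : ℝ) (φ : domain.Dart → ℂ)

theorem twistedStep_of_winding_zero {f : domain.Dart} (h : winding f = 0) :
    twistedStep k φ f = groverStep domain φ f := by
  simp [twistedStep, h]

theorem twistedStep_ou : twistedStep k φ (arc .o .u) = φ (arc .u .o') := by
  rw [twistedStep_of_winding_zero k φ rfl, groverStep_domain_of_snd_u φ rfl]
  exact add_sub_cancel_left _ _

theorem twistedStep_od : twistedStep k φ (arc .o .d) = φ (arc .d .o') := by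
  rw [twistedStep_of_winding_zero k φ rfl, groverStep_domain_of_snd_d φ rfl]
  exact add_sub_cancel_left _ _

theorem twistedStep_o'u : twistedStep k φ (arc .o' .u) = φ (arc .u .o) := by
  rw [twistedStep_of_winding_zero k φ rfl, groverStep_domain_of_snd_u φ rfl]
  exact add_sub_cancel_right _ _

theorem twistedStep_o'd : twistedStep k φ (arc .o' .d) = φ (arc .d .o) := by
  rw [twistedStep_of_winding_zero k φ rfl, groverStep_domain_of_snd_d φ rfl]
  exact add_sub_cancel_right _ _

theorem twistedStep_uo : twistedStep k φ (arc .u .o) =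
    2 / 3 * (φ (arc .o .u) + φ (arc .o .d) + φ (arc .o .o')) - φ (arc .o .u) := by
  rw [twistedStep_of_winding_zero k φ rfl, groverStep_domain_of_snd_o φ rfl]
  rfl

theorem twistedStep_do : twistedStep k φ (arc .d .o) =
    2 / 3 * (φ (arc .o .u) + φ (arc .o .d) + φ (arc .o .o')) - φ (arc .o .d) := by
  rw [twistedStep_of_winding_zero k φ rfl, groverStep_domain_of_snd_o φ rfl]
  rfl

theorem twistedStep_uo' : twistedStep k φ (arc .u .o') =
    2 / 3 * (φ (arc .o' .u) + φ (arc .o' .d) + φ (arc .o' .o)) - φ (arc .o' .u) := by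
  rw [twistedStep_of_winding_zero k φ rfl, groverStep_domain_of_snd_o' φ rfl]
  rfl

theorem twistedStep_do' : twistedStep k φ (arc .d .o') =
    2 / 3 * (φ (arc .o' .u) + φ (arc .o' .d) + φ (arc .o' .o)) - φ (arc .o' .d) := by
  rw [twistedStep_of_winding_zero k φ rfl, groverStep_domain_of_snd_o' φ rfl]
  rfl

theorem twistedStep_oo' : twistedStep k φ (arc .o .o') = Complex.exp (Complex.I * k) *
    (2 / 3 * (φ (arc .o' .u) + φ (arc .o' .d) + φ (arc .o' .o)) - φ (arc .o' .o)) := by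
  have h : winding (arc .o .o') = 1 := rfl
  rw [twistedStep, groverStep_domain_of_snd_o' φ rfl, h, Int.cast_one, mul_one]
  rfl

theorem twistedStep_o'o : twistedStep k φ (arc .o' .o) = Complex.exp (-(Complex.I * k)) *
    (2 / 3 * (φ (arc .o .u) + φ (arc .o .d) + φ (arc .o .o')) - φ (arc .o .o')) := by
  have h : winding (arc .o' .o) = -1 := rfl
  rw [twistedStep, groverStep_domain_of_snd_o φ rfl, h, Int.cast_neg, Int.cast_one, mul_neg,
    mul_one]
  rfl

end TwistedStep

theorem star_exp_I_mul (k : ℝ) :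
    (starRingEnd ℂ) (Complex.exp (Complex.I * k)) = Complex.exp (-(Complex.I * k)) := by
  rw [← Complex.exp_conj]
  simp

/-- The twisted walk is unitary. -/
theorem inner_twistedStep (k : ℝ) (φ ψ : domain.Dart → ℂ) :
    ∑ f, (starRingEnd ℂ) (twistedStep k φ f) * twistedStep k ψ f =
      ∑ f, (starRingEnd ℂ) (φ f) * ψ f := by
  have hE : Complex.exp (-(Complex.I * k)) * Complex.exp (Complex.I * k) = 1 := by
    rw [← Complex.exp_add, neg_add_cancel, Complex.exp_zero]
  have hE' : (starRingEnd ℂ) (Complex.exp (-(Complex.I * k))) = Complex.exp (Complex.I * k) := by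
    rw [← star_exp_I_mul, Complex.conj_conj]
  simp only [sum_domain_darts, twistedStep_ou, twistedStep_od, twistedStep_oo', twistedStep_uo,
    twistedStep_uo', twistedStep_o'u, twistedStep_o'd, twistedStep_o'o, twistedStep_do,
    twistedStep_do', map_mul, map_sub, map_add, star_exp_I_mul, hE']
  have h23 : (starRingEnd ℂ) (2 / 3 : ℂ) = 2 / 3 := by
    rw [map_div₀, Complex.conj_ofNat, Complex.conj_ofNat]
  rw [h23]
  generalize Complex.exp (Complex.I * k) = E at *
  generalize Complex.exp (-(Complex.I * k)) = E' at *
  -- The phases occur only on the two arcs joining 0 and 0', where they cancel by E'E = 1. The rest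
  -- is the orthogonality of the Grover reflections.
  linear_combination ((2 / 3 * ((starRingEnd ℂ) (φ (arc .o' .u)) + (starRingEnd ℂ) (φ (arc .o' .d))
      + (starRingEnd ℂ) (φ (arc .o' .o))) - (starRingEnd ℂ) (φ (arc .o' .o))) *
    (2 / 3 * (ψ (arc .o' .u) + ψ (arc .o' .d) + ψ (arc .o' .o)) - ψ (arc .o' .o)) +
    (2 / 3 * ((starRingEnd ℂ) (φ (arc .o .u)) + (starRingEnd ℂ) (φ (arc .o .d))
      + (starRingEnd ℂ) (φ (arc .o .o'))) - (starRingEnd ℂ) (φ (arc .o .o'))) *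
    (2 / 3 * (ψ (arc .o .u) + ψ (arc .o .d) + ψ (arc .o .o')) - ψ (arc .o .o'))) * hE

/-! ### Eigenvectors -/

/-- The vertex part of the eigenvectors: an eigenvector of the twisted random walk on `𝒟` for the
eigenvalue `L`. -/
def vertexVec (L : ℝ) (k : ℝ) : Cell → ℂ
  | .o => 1 + L * Complex.exp (Complex.I * k)
  | .o' => 3 * L ^ 2 - 1
  | .u => (3 * L + Complex.exp (Complex.I * k)) / 2
  | .d => (3 * L + Complex.exp (Complex.I * k)) / 2

/-- An unnormalized eigenvector of the twisted walk for the eigenvalue `ν_{j,l}(k)`. -/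
def eigVec (j : Fin 3) (l : Fin 2) (k : ℝ) (f : domain.Dart) : ℂ :=
  eigQW j l k * Complex.exp (Complex.I * k * winding f) * vertexVec (eigRW j k) k f.snd -
    vertexVec (eigRW j k) k f.fst

theorem continuous_eigVec (j : Fin 3) (l : Fin 2) (f : domain.Dart) :
    Continuous fun k => eigVec j l k f := by
  have h1 := continuous_eigQW j l
  have h2 := continuous_eigRW j
  have h3 : ∀ a, Continuous fun k => vertexVec (eigRW j k) k a := by
    intro a
    cases a <;> simp only [vertexVec] <;> fun_prop
  unfold eigVec
  have h4 := h3 f.fst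
  have h5 := h3 f.snd
  fun_prop

theorem eigVec_periodic (j : Fin 3) (l : Fin 2) (k : ℝ) (f : domain.Dart) :
    eigVec j l (k + 2 * Real.pi) f = eigVec j l k f := by
  have h1 : ∀ n : ℤ, Complex.exp (Complex.I * ((k + 2 * Real.pi : ℝ) : ℂ) * n) =
      Complex.exp (Complex.I * k * n) := by
    intro n
    rw [← Complex.exp_periodic.int_mul n (Complex.I * k * n)]
    congr 1
    push_cast
    ring
  have h2 := h1 1
  simp only [Int.cast_one, mul_one] at h2
  have h3 : ∀ a, vertexVec (eigRW j k) (k + 2 * Real.pi) a = vertexVec (eigRW j k) k a := by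
    intro a
    cases a <;> simp only [vertexVec, h2]
  unfold eigVec
  rw [eigQW_periodic, eigRW_periodic, h1, h3, h3]

theorem eigQW_add_inv (j : Fin 3) (l : Fin 2) (k : ℝ) :
    eigQW j l k ^ 2 + 1 = 2 * eigRW j k * eigQW j l k := by
  have h : ((√(1 - eigRW j k ^ 2) : ℝ) : ℂ) ^ 2 = 1 - (eigRW j k : ℂ) ^ 2 := by
    exact_mod_cast Real.sq_sqrt (sub_nonneg.2 (eigRW_sq_le_one j k))
  have hs : ((-1 : ℂ) ^ (l : ℕ)) ^ 2 = 1 := by fin_cases l <;> simp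
  unfold eigQW
  linear_combination (((-1) ^ (l : ℕ)) ^ 2 * ((√(1 - eigRW j k ^ 2) : ℝ) : ℂ) ^ 2) * Complex.I_sq
    - ((√(1 - eigRW j k ^ 2) : ℝ) : ℂ) ^ 2 * hs - h

theorem eigQW_sq_ne_one {j : Fin 3} (l : Fin 2) {k : ℝ} (h : eigRW j k ^ 2 < 1) :
    eigQW j l k ^ 2 ≠ 1 := by
  intro h1
  have h2 := eigQW_im j l k
  have hr : 0 < √(1 - eigRW j k ^ 2) := Real.sqrt_pos.2 (by linarith)
  have h3 : (eigQW j l k).im = 0 := by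
    rcases mul_self_eq_one_iff.1 ((sq _).symm.trans h1) with h | h <;> simp [h]
  rw [h3] at h2
  exact mul_ne_zero (pow_ne_zero _ (by norm_num)) hr.ne' h2.symm

/-- The value 1/3 lies in the gap (1/9, 4/9) of λ². The quantity is the entry of `vertexVec` at 0',
by which eigenvectors are normalized below. -/
theorem three_mul_eigRW_sq_ne_one (j : Fin 3) (k : ℝ) : 3 * eigRW j k ^ 2 - 1 ≠ 0 := by
  fin_cases j
  · have := eigRW_zero_mem k
    simp only [Fin.zero_eta]
    nlinarith
  · have := eigRW_one_mem k
    simp only [Fin.mk_one]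
    nlinarith
  · have := eigRW_two_mem k
    simp only [Fin.reduceFinMk]
    nlinarith

/-- The eigenvalue `ν_{j,l}(k)` is simple when `λ_j(k) ∉ {0, 1, -1}`. -/
theorem exists_eq_mul_eigVec {j : Fin 3} {l : Fin 2} {k : ℝ} (h0 : eigRW j k ≠ 0)
    (h1 : eigRW j k ^ 2 < 1) {φ : domain.Dart → ℂ}
    (hφ : ∀ f, twistedStep k φ f = eigQW j l k * φ f) :
    ∃ c, ∀ f, φ f = c * eigVec j l k f := by
  have hν := eigQW_add_inv j l k
  have hν1 : eigQW j l k ^ 2 - 1 ≠ 0 := sub_ne_zero.2 (eigQW_sq_ne_one l h1)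
  have hν0 := eigQW_ne_zero j l k
  have h3 : 3 * (eigRW j k : ℂ) ^ 2 - 1 ≠ 0 := by
    exact_mod_cast three_mul_eigRW_sq_ne_one j k
  have hL : (eigRW j k : ℂ) ≠ 0 := by exact_mod_cast h0
  have hE : Complex.exp (-(Complex.I * k)) * Complex.exp (Complex.I * k) = 1 := by
    rw [← Complex.exp_add, neg_add_cancel, Complex.exp_zero]
  have hw1 : winding (arc .o .o') = 1 := rfl
  have hw2 : winding (arc .o' .o) = -1 := rfl
  have hw : winding (arc .o .u) = 0 ∧ winding (arc .o .d) = 0 ∧ winding (arc .u .o) = 0 ∧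
      winding (arc .u .o') = 0 ∧ winding (arc .o' .u) = 0 ∧ winding (arc .o' .d) = 0 ∧
      winding (arc .d .o) = 0 ∧ winding (arc .d .o') = 0 := by decide
  simp only [forall_domain_darts, twistedStep_ou, twistedStep_od, twistedStep_oo', twistedStep_uo,
    twistedStep_uo', twistedStep_o'u, twistedStep_o'd, twistedStep_o'o, twistedStep_do,
    twistedStep_do'] at hφ
  simp only [eigVec, forall_domain_darts, hw1, hw2, hw, Int.cast_neg, Int.cast_one, Int.cast_zero,
    mul_neg, mul_one, mul_zero, Complex.exp_zero]
  obtain ⟨e1, e2, e3, e4, e5, e6, e7, e8, e9, e10⟩ := hφ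
  generalize eigQW j l k = ν at *
  generalize hLdef : (eigRW j k : ℂ) = L at *
  generalize hEdef : Complex.exp (Complex.I * k) = E at *
  generalize Complex.exp (-(Complex.I * k)) = E' at *
  -- Passage to vertices: s_a is 2/deg(a) times the sum of φ over the arcs leaving a.
  obtain ⟨so, hso⟩ : ∃ s, s = 2 / 3 * (φ (arc .o .u) + φ (arc .o .d) + φ (arc .o .o')) := ⟨_, rfl⟩
  obtain ⟨so', hso'⟩ : ∃ s, s = 2 / 3 * (φ (arc .o' .u) + φ (arc .o' .d) + φ (arc .o' .o)) :=
    ⟨_, rfl⟩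
  obtain ⟨su, hsu⟩ : ∃ s, s = φ (arc .u .o) + φ (arc .u .o') := ⟨_, rfl⟩
  obtain ⟨sd, hsd⟩ : ∃ s, s = φ (arc .d .o) + φ (arc .d .o') := ⟨_, rfl⟩
  rw [← hso'] at e3 e5 e10
  rw [← hso] at e4 e8 e9
  -- The eigenvalue equations at an arc f and at its reversal, combined, recover φ from the vertex
  -- sums: (ν²-1)φ(f) = ν e^{iθ(f)} s_{t(f)} - s_{o(f)}.
  have f1 : (ν ^ 2 - 1) * φ (arc .o .u) = ν * su - so := by
    linear_combination -ν * hsu - ν * e1 + e4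
  have f2 : (ν ^ 2 - 1) * φ (arc .o .d) = ν * sd - so := by
    linear_combination -ν * hsd - ν * e2 + e9
  have f3 : (ν ^ 2 - 1) * φ (arc .o .o') = ν * E * so' - so := by
    linear_combination (-ν) * e3 + E * e8 + (φ (arc .o .o') - so) * hE
  have f4 : (ν ^ 2 - 1) * φ (arc .u .o) = ν * so - su := by
    linear_combination -ν * e4 + e1 + hsu
  have f5 : (ν ^ 2 - 1) * φ (arc .u .o') = ν * so' - su := by
    linear_combination -ν * e5 + e6 + hsu
  have f6 : (ν ^ 2 - 1) * φ (arc .o' .u) = ν * su - so' := by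
    linear_combination -ν * hsu - ν * e6 + e5
  have f7 : (ν ^ 2 - 1) * φ (arc .o' .d) = ν * sd - so' := by
    linear_combination -ν * hsd - ν * e7 + e10
  have f8 : (ν ^ 2 - 1) * φ (arc .o' .o) = ν * E' * so - so' := by
    linear_combination (-ν) * e8 + E' * e3 + (φ (arc .o' .o) - so') * hE
  have f9 : (ν ^ 2 - 1) * φ (arc .d .o) = ν * so - sd := by
    linear_combination -ν * e9 + e2 + hsd
  have f10 : (ν ^ 2 - 1) * φ (arc .d .o') = ν * so' - sd := by
    linear_combination -ν * e10 + e7 + hsd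
  -- Summing over the arcs leaving a vertex and using ν² + 1 = 2λν shows that s is an eigenvector of
  -- the twisted random walk for λ.
  have v1 : 2 * L * su = so + so' := mul_left_cancel₀ hν0 (by
    linear_combination (ν ^ 2 - 1) * hsu + f4 + f5 - su * hν)
  have v2 : 2 * L * sd = so + so' := mul_left_cancel₀ hν0 (by
    linear_combination (ν ^ 2 - 1) * hsd + f9 + f10 - sd * hν)
  have v3 : 3 * L * so = su + sd + E * so' := mul_left_cancel₀ hν0 (by
    linear_combination (3 / 2) * (ν ^ 2 - 1) * hso + f1 + f2 + f3 - 3 / 2 * so * hν)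
  have v4 : 3 * L * so' = su + sd + E' * so := mul_left_cancel₀ hν0 (by
    linear_combination (3 / 2) * (ν ^ 2 - 1) * hso' + f6 + f7 + f8 - 3 / 2 * so' * hν)
  -- Elimination of s_u and s_d gives (3λ²-1)s_0 = (1+λE)s_{0'}, so that s is determined by the
  -- scalar c.
  obtain ⟨c, hc⟩ : ∃ c, so' = c * (3 * L ^ 2 - 1) := ⟨so' / (3 * L ^ 2 - 1), by field_simp⟩
  have hco : so = c * (1 + L * E) := mul_left_cancel₀ h3 (by
    linear_combination L * v3 + v1 / 2 + v2 / 2 + (1 + L * E) * hc)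
  have hcu : su = c * ((3 * L + E) / 2) := mul_left_cancel₀ (mul_ne_zero two_ne_zero hL) (by
    linear_combination v1 + hco + hc)
  have hcd : sd = c * ((3 * L + E) / 2) := mul_left_cancel₀ (mul_ne_zero two_ne_zero hL) (by
    linear_combination v2 + hco + hc)
  simp only [hcu, hcd, hco, hc] at f1 f2 f3 f4 f5 f6 f7 f8 f9 f10
  refine ⟨c / (ν ^ 2 - 1), ?_⟩
  simp only [arc, vertexVec, hLdef, hEdef] at f1 f2 f3 f4 f5 f6 f7 f8 f9 f10 ⊢
  refine ⟨?_, ?_, ?_, ?_, ?_, ?_, ?_, ?_, ?_, ?_⟩ <;>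
    rw [div_mul_eq_mul_div, eq_div_iff hν1]
  · linear_combination f1
  · linear_combination f2
  · linear_combination f3
  · linear_combination f4
  · linear_combination f5
  · linear_combination f6
  · linear_combination f7
  · linear_combination f8
  · linear_combination f9
  · linear_combination f10

/-! ### The homological eigenvectors -/

/-- The eigenvector `w^{(m)}(c) - w^{(m)}(c̄)` on the fundamental domain. -/
def cycleVec (m : Fin 4) (f : domain.Dart) : ℂ :=
  ∑ r : Fin 4, Complex.exp (2 * Real.pi * Complex.I * (m : ℕ) * ((r : ℕ) + 1) / (4 : ℕ)) *
    ((if f = cyc r then 1 else 0) - if f = cycRev r then 1 else 0)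

theorem exp_eq_I_pow (m n : ℕ) :
    Complex.exp (2 * Real.pi * Complex.I * m * n / (4 : ℕ)) = Complex.I ^ (m * n) := by
  rw [show Complex.I ^ (m * n) = Complex.exp (Real.pi / 2 * Complex.I) ^ (m * n) by
    rw [Complex.exp_pi_div_two_mul_I], ← Complex.exp_nat_mul]
  congr 1
  push_cast
  ring

theorem cycleVec_apply (m : Fin 4) :
    cycleVec m (arc .o .u) = -Complex.I ^ ((m : ℕ) * 3) ∧
    cycleVec m (arc .o .d) = Complex.I ^ ((m : ℕ) * 3) ∧
    cycleVec m (arc .o .o') = 0 ∧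
    cycleVec m (arc .u .o) = Complex.I ^ ((m : ℕ) * 2) ∧
    cycleVec m (arc .u .o') = -1 ∧
    cycleVec m (arc .o' .u) = Complex.I ^ (m : ℕ) ∧
    cycleVec m (arc .o' .d) = -Complex.I ^ (m : ℕ) ∧
    cycleVec m (arc .o' .o) = 0 ∧
    cycleVec m (arc .d .o) = -Complex.I ^ ((m : ℕ) * 2) ∧
    cycleVec m (arc .d .o') = 1 := by
  have h : ∀ f, cycleVec m f = ∑ r : Fin 4, Complex.I ^ ((m : ℕ) * ((r : ℕ) + 1)) *
      ((if f = cyc r then 1 else 0) - if f = cycRev r then 1 else 0) := by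
    intro f
    unfold cycleVec
    refine Finset.sum_congr rfl fun r _ => ?_
    rw [← exp_eq_I_pow]
    push_cast
    rfl
  have h4 : Complex.I ^ ((m : ℕ) * 4) = 1 := by
    rw [mul_comm, pow_mul, Complex.I_pow_four, one_pow]
  simp only [h, Fin.sum_univ_four]
  refine ⟨?_, ?_, ?_, ?_, ?_, ?_, ?_, ?_, ?_, ?_⟩ <;>
    simp [cyc, cycRev, arc, h4]

/-- The vector vanishes on the arcs with a phase, and c enters with the sign opposite to c̄, so its
outgoing sum at every vertex is 0. The walk therefore acts as f ↦ -φ(f̄), which is rotation along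
the cycle, for every k. -/
theorem twistedStep_cycleVec (k : ℝ) (m : Fin 4) (f : domain.Dart) :
    twistedStep k (cycleVec m) f = Complex.I ^ (m : ℕ) * cycleVec m f := by
  obtain ⟨h1, h2, h3, h4, h5, h6, h7, h8, h9, h10⟩ := cycleVec_apply m
  revert f
  simp only [forall_domain_darts, twistedStep_ou, twistedStep_od, twistedStep_oo', twistedStep_uo,
    twistedStep_uo', twistedStep_o'u, twistedStep_o'd, twistedStep_o'o, twistedStep_do,
    twistedStep_do', h1, h2, h3, h4, h5, h6, h7, h8, h9, h10]
  have h4 : Complex.I ^ ((m : ℕ) * 4) = 1 := by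
    rw [mul_comm, pow_mul, Complex.I_pow_four, one_pow]
  refine ⟨?_, ?_, ?_, ?_, ?_, ?_, ?_, ?_, ?_, ?_⟩ <;> ring_nf <;> simp [h4]

theorem sum_norm_cycleVec_sq (m : Fin 4) : ∑ f, ‖cycleVec m f‖ ^ 2 = 8 := by
  obtain ⟨h1, h2, h3, h4, h5, h6, h7, h8, h9, h10⟩ := cycleVec_apply m
  rw [sum_domain_darts, h1, h2, h3, h4, h5, h6, h7, h8, h9, h10]
  simp
  norm_num

/-! ### Fourier transforms on the circle of length `2π` -/

/-- `F` is square integrable over a period, and has the Fourier coefficients `ψ`. -/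
structure IsFourierPair (ψ : ℤ → ℂ) (F : ℝ → ℂ) : Prop where
  periodic : Function.Periodic F (2 * Real.pi)
  memLp : MemLp F 2 (volume.restrict (Set.Ioc (-Real.pi) Real.pi))
  inversion : ∀ x : ℤ, ψ x = (1 / (2 * Real.pi) : ℂ) *
    ∫ k in (-Real.pi)..Real.pi, Complex.exp (Complex.I * k * x) * F k

instance fact_two_pi_pos : Fact (0 < 2 * Real.pi) := ⟨Real.two_pi_pos⟩

theorem neg_pi_add_two_pi : -Real.pi + 2 * Real.pi = Real.pi := by ring

theorem fourier_coe_eq_exp (x : ℤ) (k : ℝ) :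
    fourier x (k : AddCircle (2 * Real.pi)) = Complex.exp (Complex.I * k * x) := by
  rw [fourier_coe_apply]
  congr 1
  have : (Real.pi : ℂ) ≠ 0 := by exact_mod_cast Real.pi_ne_zero
  push_cast
  field_simp

theorem fourierCoeff_eq_integral (g : AddCircle (2 * Real.pi) → ℂ) (x : ℤ) :
    fourierCoeff g (-x) = (1 / (2 * Real.pi) : ℂ) *
      ∫ k in (-Real.pi)..Real.pi, Complex.exp (Complex.I * k * x) * g k := by
  rw [fourierCoeff_eq_intervalIntegral g (-x) (-Real.pi), neg_pi_add_two_pi]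
  simp only [fourier_coe_eq_exp, neg_neg, smul_eq_mul, Complex.real_smul]
  push_cast
  rfl

theorem memLp_comp_coe {g : AddCircle (2 * Real.pi) → ℂ} {p : ENNReal} (hg : MemLp g p)
    (t : ℝ) : MemLp (fun k : ℝ => g k) p (volume.restrict (Set.Ioc t (t + 2 * Real.pi))) :=
  hg.comp_measurePreserving (AddCircle.measurePreserving_mk (2 * Real.pi) t)

theorem Function.Periodic.exists_circle_memLp {F : ℝ → ℂ} (hF : Function.Periodic F (2 * Real.pi))
    {p : ENNReal} (h : MemLp F p (volume.restrict (Set.Ioc (-Real.pi) Real.pi))) :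
    ∃ g : AddCircle (2 * Real.pi) → ℂ, MemLp g p ∧ ∀ k : ℝ, F k = g k := by
  refine ⟨AddCircle.liftIoc (2 * Real.pi) (-Real.pi) F, ?_, fun k => ?_⟩
  · have h' : MemLp F p (volume.restrict (Set.Ioc (-Real.pi) (-Real.pi + 2 * Real.pi))) := by
      rwa [neg_pi_add_two_pi]
    exact h'.memLp_liftIoc
  · have h1 := toIocMod_mem_Ioc fact_two_pi_pos.out (-Real.pi) k
    have h2 : ((toIocMod fact_two_pi_pos.out (-Real.pi) k : ℝ) : AddCircle (2 * Real.pi)) = k := by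
      rw [toIocMod, AddCircle.coe_sub, AddCircle.coe_zsmul, AddCircle.coe_period, smul_zero,
        sub_zero]
    rw [← h2, AddCircle.liftIoc_coe_apply h1, toIocMod, hF.sub_zsmul_eq]

namespace IsFourierPair

variable {ψ ψ' : ℤ → ℂ} {F F' : ℝ → ℂ}

/-- The index is negated because the inversion formula integrates against e^{ikx}, whereas
`fourierCoeff` uses e^{-ikx}. -/
theorem exists_circle (h : IsFourierPair ψ F) : ∃ g : AddCircle (2 * Real.pi) → ℂ,
    MemLp g 2 ∧ (∀ k : ℝ, F k = g k) ∧ ∀ x, ψ x = fourierCoeff g (-x) := by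
  obtain ⟨g, hg, hF⟩ := h.periodic.exists_circle_memLp h.memLp
  refine ⟨g, hg, hF, fun x => ?_⟩
  rw [h.inversion, fourierCoeff_eq_integral, funext hF]

theorem of_circle {g : AddCircle (2 * Real.pi) → ℂ} (hg : MemLp g 2) :
    IsFourierPair (fun x => fourierCoeff g (-x)) (fun k : ℝ => g k) where
  periodic := fun k => by simp
  memLp := by
    have := memLp_comp_coe hg (-Real.pi)
    rwa [neg_pi_add_two_pi] at this
  inversion := fun x => fourierCoeff_eq_integral g x

/-- Parseval's identity. -/
theorem hasSum_inner (h : IsFourierPair ψ F) (h' : IsFourierPair ψ' F') :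
    HasSum (fun x => (starRingEnd ℂ) (ψ x) * ψ' x) ((1 / (2 * Real.pi) : ℂ) *
      ∫ k in (-Real.pi)..Real.pi, (starRingEnd ℂ) (F k) * F' k) := by
  obtain ⟨g, hg, hF, hψ⟩ := h.exists_circle
  obtain ⟨g', hg', hF', hψ'⟩ := h'.exists_circle
  have hg := hg.haarAddCircle
  have hg' := hg'.haarAddCircle
  have key := (fourierBasis (T := 2 * Real.pi)).hasSum_inner_mul_inner hg.toLp hg'.toLp
  have h1 : ∀ i, inner ℂ (fourierBasis (T := 2 * Real.pi) i) hg'.toLp = fourierCoeff g' i := by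
    intro i
    rw [← HilbertBasis.repr_apply_apply, fourierBasis_repr, fourierCoeff_congr_ae hg'.coeFn_toLp]
  have h2 : ∀ i, inner ℂ hg.toLp (fourierBasis (T := 2 * Real.pi) i) =
      (starRingEnd ℂ) (fourierCoeff g i) := by
    intro i
    rw [← inner_conj_symm, ← HilbertBasis.repr_apply_apply, fourierBasis_repr,
      fourierCoeff_congr_ae hg.coeFn_toLp]
  have h3 : inner ℂ hg.toLp hg'.toLp = (1 / (2 * Real.pi) : ℂ) *
      ∫ k in (-Real.pi)..Real.pi, (starRingEnd ℂ) (F k) * F' k := by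
    rw [L2.inner_def]
    have : ∀ k : ℝ, (starRingEnd ℂ) (F k) * F' k =
        (fun z : AddCircle (2 * Real.pi) => (starRingEnd ℂ) (g z) * g' z) k := by
      intro k
      rw [hF, hF']
    rw [intervalIntegral.integral_congr (fun k _ => this k)]
    have e := AddCircle.intervalIntegral_preimage (2 * Real.pi) (-Real.pi)
      (fun z : AddCircle (2 * Real.pi) => (starRingEnd ℂ) (g z) * g' z)
    rw [neg_pi_add_two_pi] at e
    rw [e]
    trans ∫ z, (starRingEnd ℂ) (g z) * g' z ∂(AddCircle.haarAddCircle (T := 2 * Real.pi))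
    · refine integral_congr_ae ?_
      filter_upwards [hg.coeFn_toLp, hg'.coeFn_toLp] with z hz hz'
      rw [hz, hz', RCLike.inner_apply']
    · rw [AddCircle.integral_haarAddCircle, Complex.real_smul]
      push_cast
      rw [one_div]
  have e : (fun i => (starRingEnd ℂ) (fourierCoeff g i) * fourierCoeff g' i) = _ :=
    funext fun i => (congrArg₂ (· * ·) (h2 i) (h1 i)).symm
  rw [h3, ← e, ← (Equiv.neg ℤ).hasSum_iff] at key
  simp only [hψ, hψ']
  exact key

theorem integrable (h : IsFourierPair ψ F) :
    IntervalIntegrable F volume (-Real.pi) Real.pi := by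
  rw [intervalIntegrable_iff_integrableOn_Ioc_of_le (by linarith [Real.pi_pos])]
  exact h.memLp.integrable one_le_two

theorem exp_mul_intervalIntegrable (h : IsFourierPair ψ F) (x : ℤ) :
    IntervalIntegrable (fun k : ℝ => Complex.exp (Complex.I * k * x) * F k) volume
      (-Real.pi) Real.pi :=
  h.integrable.continuousOn_mul (by fun_prop)

theorem add (h : IsFourierPair ψ F) (h' : IsFourierPair ψ' F') :
    IsFourierPair (fun x => ψ x + ψ' x) (fun k => F k + F' k) where
  periodic := h.periodic.add h'.periodic
  memLp := h.memLp.add h'.memLp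
  inversion := fun x => by
    simp only [mul_add]
    rw [intervalIntegral.integral_add (h.exp_mul_intervalIntegrable x)
      (h'.exp_mul_intervalIntegrable x), mul_add, ← h.inversion, ← h'.inversion]

theorem const_mul (h : IsFourierPair ψ F) (c : ℂ) :
    IsFourierPair (fun x => c * ψ x) (fun k => c * F k) where
  periodic := fun k => congrArg (c * ·) (h.periodic k)
  memLp := h.memLp.const_mul c
  inversion := fun x => by
    simp only [mul_left_comm _ c]
    rw [intervalIntegral.integral_const_mul, mul_left_comm, ← h.inversion]

theorem sub (h : IsFourierPair ψ F) (h' : IsFourierPair ψ' F') :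
    IsFourierPair (fun x => ψ x - ψ' x) (fun k => F k - F' k) := by
  convert h.add (h'.const_mul (-1)) using 2 <;> ring

theorem zero : IsFourierPair (fun _ => 0) (fun _ => 0) where
  periodic := fun k => rfl
  memLp := MemLp.zero
  inversion := fun x => by simp

theorem sum {ι : Type*} (s : Finset ι) {ψ : ι → ℤ → ℂ} {F : ι → ℝ → ℂ}
    (h : ∀ i, IsFourierPair (ψ i) (F i)) :
    IsFourierPair (fun x => ∑ i ∈ s, ψ i x) (fun k => ∑ i ∈ s, F i k) := by
  classical
  induction s using Finset.induction_on with
  | empty => simpa using zero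
  | insert a s ha ih =>
    simp only [Finset.sum_insert ha]
    exact (h a).add ih

/-- A phase in the Fourier picture is a translation of the label. -/
theorem exp_mul (h : IsFourierPair ψ F) (n : ℤ) :
    IsFourierPair (fun x => ψ (x + n)) (fun k => Complex.exp (Complex.I * k * n) * F k) where
  periodic := fun k => by
    simp only
    rw [h.periodic, ← Complex.exp_periodic.int_mul n (Complex.I * k * n)]
    congr 2
    push_cast
    ring
  memLp := by
    have hm : AEStronglyMeasurable (fun k : ℝ => Complex.exp (Complex.I * k * n) * F k)
        (volume.restrict (Set.Ioc (-Real.pi) Real.pi)) :=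
      (by fun_prop : Continuous fun k : ℝ => Complex.exp (Complex.I * k * n)).aestronglyMeasurable.mul
        h.memLp.1
    refine h.memLp.of_le hm (ae_of_all _ fun k => ?_)
    rw [norm_mul, Complex.norm_exp]
    simp
  inversion := fun x => by
    rw [h.inversion]
    congr 1
    refine intervalIntegral.integral_congr fun k _ => ?_
    rw [← mul_assoc, ← Complex.exp_add]
    congr 2
    push_cast
    ring

/-- A translation of the wave number is a phase in the label. -/
theorem translate (h : IsFourierPair ψ F) (s : ℝ) :
    IsFourierPair (fun x => Complex.exp (Complex.I * s * x) * ψ x) (fun k => F (k - s)) where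
  periodic := fun k => by
    simp only
    rw [← h.periodic (k - s)]
    congr 1
    ring
  memLp := by
    obtain ⟨g, hg, hF, -⟩ := h.exists_circle
    have h1 : MemLp (fun z => g (z - (s : AddCircle (2 * Real.pi)))) 2 :=
      hg.comp_measurePreserving (measurePreserving_sub_right volume (s : AddCircle (2 * Real.pi)))
    have h2 := memLp_comp_coe h1 (-Real.pi)
    rw [neg_pi_add_two_pi] at h2
    convert h2 using 2 with k
    rw [hF, AddCircle.coe_sub]
  inversion := fun x => by
    have hper : Function.Periodic (fun k : ℝ => Complex.exp (Complex.I * k * x) * F k)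
        (2 * Real.pi) := by
      intro k
      simp only
      rw [h.periodic, ← Complex.exp_periodic.int_mul x (Complex.I * k * x)]
      congr 2
      push_cast
      ring
    have h1 : ∀ k : ℝ, Complex.exp (Complex.I * k * x) * F (k - s) =
        Complex.exp (Complex.I * s * x) *
          (fun k : ℝ => Complex.exp (Complex.I * k * x) * F k) (k - s) := by
      intro k
      simp only
      rw [← mul_assoc, ← Complex.exp_add]
      congr 2
      push_cast
      ring
    simp only [h1]
    rw [intervalIntegral.integral_const_mul, intervalIntegral.integral_comp_sub_right
      (fun k : ℝ => Complex.exp (Complex.I * k * x) * F k), h.inversion x]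
    have h2 := hper.intervalIntegral_add_eq (-Real.pi - s) (-Real.pi)
    rw [neg_pi_add_two_pi, show -Real.pi - s + 2 * Real.pi = Real.pi - s by ring] at h2
    rw [h2]
    ring

/-- Riesz–Fischer: the Fourier basis identifies L² of the circle with all of ℓ²(ℤ). -/
theorem exists_of_summable_sq (h : Summable fun x => ‖ψ x‖ ^ 2) : ∃ F, IsFourierPair ψ F := by
  have hm : Memℓp (fun x => ψ (-x)) 2 := by
    refine memℓp_gen ?_
    have := (Equiv.neg ℤ).summable_iff.2 h
    simpa [Function.comp_def] using this
  let a : lp (fun _ : ℤ => ℂ) 2 := ⟨fun x => ψ (-x), hm⟩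
  let g := (fourierBasis (T := 2 * Real.pi)).repr.symm a
  have hg : MemLp g 2 := (Lp.memLp g).of_haarAddCircle
  refine ⟨fun k => g k, ?_⟩
  convert of_circle hg with x
  rw [← fourierBasis_repr]
  simp [g, a]

/-- Absolute convergence permits termwise integration, and orthogonality of the exponentials leaves
only the term y = x. -/
theorem of_summable (h : Summable fun x => ‖ψ x‖) :
    IsFourierPair ψ (fun k => ∑' x : ℤ, Complex.exp (-(Complex.I * k * x)) * ψ x) ∧
      Continuous fun k : ℝ => ∑' x : ℤ, Complex.exp (-(Complex.I * k * x)) * ψ x := by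
  have hnorm : ∀ (k : ℝ) (x : ℤ), ‖Complex.exp (-(Complex.I * k * x)) * ψ x‖ = ‖ψ x‖ := by
    intro k x
    rw [norm_mul, Complex.norm_exp]
    simp
  have hcont : Continuous fun k : ℝ => ∑' x : ℤ, Complex.exp (-(Complex.I * k * x)) * ψ x :=
    continuous_tsum (fun x => by fun_prop) h fun x k => (hnorm k x).le
  refine ⟨⟨fun k => ?_, ?_, fun x => ?_⟩, hcont⟩
  · refine tsum_congr fun x => ?_
    congr 1
    rw [← Complex.exp_periodic.int_mul (-x) (-(Complex.I * k * x))]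
    congr 1
    push_cast
    ring
  · refine MemLp.of_bound hcont.aestronglyMeasurable (∑' x, ‖ψ x‖) (ae_of_all _ fun k => ?_)
    refine (norm_tsum_le_tsum_norm ?_).trans_eq (tsum_congr fun x => hnorm k x)
    simpa only [hnorm] using h
  · have h1 : ∀ k : ℝ, Complex.exp (Complex.I * k * x) *
        ∑' y : ℤ, Complex.exp (-(Complex.I * k * y)) * ψ y =
          ∑' y : ℤ, Complex.exp (Complex.I * k * (x - y : ℤ)) * ψ y := by
      intro k
      rw [← tsum_mul_left]
      refine tsum_congr fun y => ?_
      rw [← mul_assoc, ← Complex.exp_add]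
      congr 2
      push_cast
      ring
    simp only [h1]
    have h2 := intervalIntegral.hasSum_integral_of_dominated_convergence (μ := volume)
      (a := -Real.pi) (b := Real.pi) (ι := ℤ)
      (F := fun y (k : ℝ) => Complex.exp (Complex.I * k * (x - y : ℤ)) * ψ y)
      (f := fun k : ℝ => ∑' y : ℤ, Complex.exp (Complex.I * k * (x - y : ℤ)) * ψ y)
      (fun y _ => ‖ψ y‖) (fun y => (by fun_prop : Continuous _).aestronglyMeasurable)
      (fun y => ae_of_all _ fun k _ => by
        rw [norm_mul, Complex.norm_exp]
        simp) (ae_of_all _ fun _ _ => h) (by simp) (ae_of_all _ fun k _ => by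
        refine Summable.hasSum (Summable.of_norm ?_)
        refine h.congr fun y => ?_
        rw [norm_mul, Complex.norm_exp]
        simp)
    have h3 : ∀ y : ℤ, ∫ k in (-Real.pi)..Real.pi,
        Complex.exp (Complex.I * k * (x - y : ℤ)) * ψ y = if y = x then 2 * Real.pi * ψ x else 0 := by
      intro y
      rw [intervalIntegral.integral_mul_const]
      split_ifs with hxy
      · subst hxy
        simp only [sub_self, Int.cast_zero, mul_zero, Complex.exp_zero,
          intervalIntegral.integral_const, sub_neg_eq_add, Complex.real_smul, mul_one]
        push_cast
        ring
      · have hne : Complex.I * ((x - y : ℤ) : ℂ) ≠ 0 :=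
          mul_ne_zero Complex.I_ne_zero (by exact_mod_cast sub_ne_zero.2 (Ne.symm hxy))
        have : ∀ k : ℝ, Complex.I * k * ((x - y : ℤ) : ℂ) = Complex.I * ((x - y : ℤ) : ℂ) * k :=
          fun k => by ring
        simp only [this]
        rw [integral_exp_mul_complex hne,
          -- For y ≠ x the primitive takes equal values at ±π, as these differ by an integral number
          -- of periods.
          ← Complex.exp_periodic.int_mul (x - y) (Complex.I * ((x - y : ℤ) : ℂ) * (-Real.pi : ℝ))]
        rw [sub_eq_zero.2, zero_div, zero_mul]
        congr 1
        push_cast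
        ring
    simp only [h3] at h2
    rw [h2.unique (hasSum_ite_eq x _)]
    have : (Real.pi : ℂ) ≠ 0 := by exact_mod_cast Real.pi_ne_zero
    field_simp

end IsFourierPair

/-! ### The walk in the Fourier picture -/

/-- `Φ` is a Fourier transform of the state `ψ` along the labels. -/
def IsFourierFamily (ψ : chain.Dart → ℂ) (Φ : ℝ → domain.Dart → ℂ) : Prop :=
  ∀ f, IsFourierPair (fun x => ψ (liftArc x f)) (fun k => Φ k f)

theorem isFourierTransform_iff (Ψ : ArcSpace chain) (Φ : ℝ → domain.Dart → ℂ) :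
    IsFourierTransform Ψ Φ ↔ IsFourierFamily Ψ Φ :=
  ⟨fun h f => ⟨h.periodic f, h.memLp f, fun x => h.inversion x f⟩,
    fun h => ⟨fun f => (h f).periodic, fun f => (h f).memLp, fun x f => (h f).inversion x⟩⟩

/-- A step combines finitely many fibres and shifts the label by the winding; the shift becomes the
phase of `twistedStep`. -/
theorem IsFourierFamily.step {ψ : chain.Dart → ℂ} {Φ : ℝ → domain.Dart → ℂ}
    (h : IsFourierFamily ψ Φ) :
    IsFourierFamily (groverStep chain ψ) (fun k => twistedStep k (Φ k)) := by
  intro f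
  simp only [groverStep_chain, twistedStep]
  exact (IsFourierPair.sum Finset.univ
    fun w : domain.neighborSet f.snd => (h (domain.dartOfNeighborSet f.snd w)).const_mul
      (2 / (domain.degree f.snd : ℂ) - if (w : Cell) = f.fst then 1 else 0)).exp_mul (winding f)

theorem IsFourierFamily.iterate {ψ : chain.Dart → ℂ} {Φ : ℝ → domain.Dart → ℂ}
    (h : IsFourierFamily ψ Φ) (t : ℕ) :
    IsFourierFamily ((groverStep chain)^[t] ψ) (fun k => (twistedStep k)^[t] (Φ k)) := by
  induction t with
  | zero => exact h
  | succ t ih =>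
    simp only [Function.iterate_succ_apply']
    exact ih.step

theorem summable_norm_sq_arcSpace (Ψ : ArcSpace chain) : Summable fun e => ‖Ψ e‖ ^ 2 := by
  have := (lp.memℓp Ψ).summable (by norm_num)
  simpa using this

theorem summable_fiber {g : chain.Dart → ℝ} (hg : Summable g) (f : domain.Dart) :
    Summable fun x : ℤ => g (liftArc x f) :=
  hg.comp_injective (i := fun x : ℤ => liftArc x f) fun x y h =>
    congrArg Prod.fst (bijective_liftArc.injective (a₁ := (x, f)) (a₂ := (y, f)) h)

theorem exists_isFourierTransform (Ψ : ArcSpace chain) : ∃ Φ, IsFourierTransform Ψ Φ := by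
  have : ∀ f, ∃ F, IsFourierPair (fun x => Ψ (liftArc x f)) F := fun f =>
    IsFourierPair.exists_of_summable_sq (summable_fiber (summable_norm_sq_arcSpace Ψ) f)
  choose F hF using this
  exact ⟨fun k f => F f k, (isFourierTransform_iff _ _).2 hF⟩

theorem isFourierTransform_fourierSeries (Ψ : ArcSpace chain) (h : Summable fun e => ‖Ψ e‖) :
    IsFourierTransform Ψ (fourierSeries Ψ) ∧ ∀ f, Continuous fun k => fourierSeries Ψ k f :=
  ⟨(isFourierTransform_iff _ _).2 fun f => (IsFourierPair.of_summable (summable_fiber h f)).1,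
    fun f => (IsFourierPair.of_summable (summable_fiber h f)).2⟩

/-! ### The Hilbert space `ℓ²(A(𝒟))` -/

/-- The Hilbert space `ℓ²(A(𝒟))`. -/
abbrev DomainSpace : Type := EuclideanSpace ℂ domain.Dart

theorem inner_toLp (φ ψ : domain.Dart → ℂ) :
    inner ℂ (WithLp.toLp 2 φ : DomainSpace) (WithLp.toLp 2 ψ) =
      ∑ f, (starRingEnd ℂ) (φ f) * ψ f := by
  simp only [PiLp.inner_apply, RCLike.inner_apply']

theorem norm_toLp_sq (φ : domain.Dart → ℂ) :
    ‖(WithLp.toLp 2 φ : DomainSpace)‖ ^ 2 = ∑ f, ‖φ f‖ ^ 2 :=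
  EuclideanSpace.norm_sq_eq _

theorem twistedStep_add (k : ℝ) (φ ψ : domain.Dart → ℂ) :
    twistedStep k (φ + ψ) = twistedStep k φ + twistedStep k ψ := by
  funext f
  simp only [twistedStep, groverStep, Pi.add_apply, mul_add, Finset.sum_add_distrib]

theorem twistedStep_smul (k : ℝ) (c : ℂ) (φ : domain.Dart → ℂ) :
    twistedStep k (c • φ) = c • twistedStep k φ := by
  funext f
  simp only [twistedStep, groverStep, Pi.smul_apply, smul_eq_mul, Finset.mul_sum,
    mul_left_comm _ c]

/-- The twisted walk as a linear isometry. -/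
def twistedIsometry (k : ℝ) : DomainSpace →ₗᵢ[ℂ] DomainSpace where
  toFun φ := WithLp.toLp 2 (twistedStep k φ.ofLp)
  map_add' φ ψ := by rw [WithLp.ofLp_add, twistedStep_add, WithLp.toLp_add]
  map_smul' c φ := by rw [WithLp.ofLp_smul, twistedStep_smul, WithLp.toLp_smul]; rfl
  norm_map' φ := by
    have h := inner_twistedStep k φ.ofLp φ.ofLp
    rw [← inner_toLp, ← inner_toLp, inner_self_eq_norm_sq_to_K, inner_self_eq_norm_sq_to_K] at h
    have h2 : ‖(WithLp.toLp 2 (twistedStep k φ.ofLp) : DomainSpace)‖ ^ 2 = ‖φ‖ ^ 2 := by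
      exact_mod_cast h
    exact (sq_eq_sq₀ (norm_nonneg _) (norm_nonneg _)).1 h2

theorem toLp_iterate_twistedStep (k : ℝ) (t : ℕ) (φ : domain.Dart → ℂ) :
    (WithLp.toLp 2 ((twistedStep k)^[t] φ) : DomainSpace) =
      (twistedIsometry k)^[t] (WithLp.toLp 2 φ) := by
  induction t with
  | zero => rfl
  | succ t ih =>
    rw [Function.iterate_succ_apply', Function.iterate_succ_apply', ← ih]
    rfl

/-! ### Powers and eigenvectors of isometries. -/

section Isometry

variable {E : Type*} [NormedAddCommGroup E] [InnerProductSpace ℂ E]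

theorem LinearIsometry.norm_iterate (U : E →ₗᵢ[ℂ] E) (t : ℕ) (φ : E) : ‖U^[t] φ‖ = ‖φ‖ := by
  induction t with
  | zero => rfl
  | succ t ih => rw [Function.iterate_succ_apply', U.norm_map, ih]

theorem LinearIsometry.iterate_of_eigenvector (U : E →ₗᵢ[ℂ] E) {p : E} {ν : ℂ}
    (h : U p = ν • p) (t : ℕ) : U^[t] p = ν ^ t • p := by
  induction t with
  | zero => simp
  | succ t ih => rw [Function.iterate_succ_apply', ih, map_smul, h, smul_smul, pow_succ]

theorem LinearIsometry.iterate_sum {ι : Type*} (U : E →ₗᵢ[ℂ] E) (s : Finset ι) (p : ι → E)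
    (t : ℕ) : U^[t] (∑ a ∈ s, p a) = ∑ a ∈ s, U^[t] (p a) := by
  induction t with
  | zero => rfl
  | succ t ih => simp only [Function.iterate_succ_apply', ih, map_sum]

theorem LinearIsometry.inner_eq_zero_of_eigenvectors (U : E →ₗᵢ[ℂ] E) {p q : E} {μ ν : ℂ}
    (hp : U p = μ • p) (hq : U q = ν • q) (hμ : ‖μ‖ = 1) (hμν : μ ≠ ν) : inner ℂ p q = 0 := by
  have h := U.inner_map_map p q
  rw [hp, hq, inner_smul_left, inner_smul_right, ← mul_assoc] at h
  by_contra hne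
  have h1 : (starRingEnd ℂ) μ * ν = 1 := mul_right_cancel₀ hne (by rw [h, one_mul])
  have h2 : (starRingEnd ℂ) μ * μ = 1 := by
    rw [Complex.conj_mul', hμ]; norm_num
  have h3 : (starRingEnd ℂ) μ ≠ 0 := fun h0 => by simp [h0] at h2
  exact hμν (mul_left_cancel₀ h3 (h2.trans h1.symm))

/-- An isometry of a space of dimension `n` with `n` different eigenvalues has an orthogonal basis
of eigenvectors. -/
theorem LinearIsometry.sum_eigenvectors {ι : Type*} [Fintype ι] [FiniteDimensional ℂ E]
    (hcard : Fintype.card ι = Module.finrank ℂ E) (U : E →ₗᵢ[ℂ] E) {u : ι → E} {ν : ι → ℂ}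
    (hu0 : ∀ a, u a ≠ 0) (hu : ∀ a, U (u a) = ν a • u a) (hν : ∀ a, ‖ν a‖ = 1)
    (hinj : Function.Injective ν) (φ : E) :
    φ = ∑ a, (inner ℂ (u a) φ / (‖u a‖ ^ 2 : ℝ)) • u a := by
  have hon : Orthonormal ℂ fun a => ((‖u a‖⁻¹ : ℝ) : ℂ) • u a := by
    refine ⟨fun a => ?_, fun a b hab => ?_⟩
    · have : ‖u a‖ ≠ 0 := norm_ne_zero_iff.2 (hu0 a)
      simp only
      rw [norm_smul, Complex.norm_real, norm_inv, norm_norm, inv_mul_cancel₀ this]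
    · simp only
      rw [inner_smul_left, inner_smul_right,
        U.inner_eq_zero_of_eigenvectors (hu a) (hu b) (hν a) (hinj.ne hab), mul_zero, mul_zero]
  have hspan := hon.linearIndependent.span_eq_top_of_card_eq_finrank' hcard
  have key := (OrthonormalBasis.mk hon hspan.ge).sum_repr' φ
  conv_lhs => rw [← key]
  refine Finset.sum_congr rfl fun a _ => ?_
  simp only [OrthonormalBasis.coe_mk, inner_smul_left, smul_smul]
  congr 1
  rw [Complex.conj_ofReal]
  push_cast
  field_simp

/-- The product is (1 + z_t/t)^t, where z_t = t(conj(ν(k)) ν(k-ξ/t) - 1) is a difference quotient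
tending to iξx. -/
theorem tendsto_eigenvalue_ratio {ν : ℝ → ℂ} {k x : ℝ} (hν : ‖ν k‖ = 1)
    (hd : HasDerivAt ν (-Complex.I * x * ν k) k) (ξ : ℝ) :
    Tendsto (fun t : ℕ => (starRingEnd ℂ) (ν k) ^ t * ν (k - ξ / t) ^ t) atTop
      (𝓝 (Complex.exp (Complex.I * ξ * x))) := by
  have hunit : (starRingEnd ℂ) (ν k) * ν k = 1 := by
    rw [Complex.conj_mul', hν]; norm_num
  have h1 : Tendsto (fun t : ℕ => (t : ℂ) * ((starRingEnd ℂ) (ν k) * ν (k - ξ / t) - 1)) atTop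
      (𝓝 (Complex.I * ξ * x)) := by
    have h0 : Tendsto (fun t : ℕ => k - ξ / (t : ℝ)) atTop (𝓝 k) := by
      simpa using (tendsto_const_nhds (x := k)).sub (tendsto_const_div_atTop_nhds_zero_nat ξ)
    have hg : HasDerivAt (fun s : ℝ => ν (k - ξ * s)) (-ξ * (-Complex.I * x * ν k)) 0 := by
      have h2 : HasDerivAt (fun s : ℝ => k - ξ * s) (-ξ) 0 := by
        simpa using ((hasDerivAt_id (0 : ℝ)).const_mul ξ).const_sub k
      have hd' : HasDerivAt ν (-Complex.I * x * ν k) (k - ξ * 0) := by simpa using hd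
      have h3 := hd'.scomp (0 : ℝ) h2
      refine h3.congr_deriv ?_
      rw [Complex.real_smul]
      push_cast
      ring
    have h4 := hg.tendsto_slope_zero_right
    have h5 : Tendsto (fun t : ℕ => ((t : ℝ))⁻¹) atTop (𝓝[>] 0) :=
      tendsto_inv_atTop_nhdsGT_zero.comp tendsto_natCast_atTop_atTop
    have h6 := (h4.comp h5).const_mul ((starRingEnd ℂ) (ν k))
    have h7 : (starRingEnd ℂ) (ν k) * (-ξ * (-Complex.I * x * ν k)) = Complex.I * ξ * x := by
      linear_combination (Complex.I * ξ * x) * hunit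
    rw [h7] at h6
    refine h6.congr fun t => ?_
    simp only [Function.comp_apply, inv_inv, zero_add, mul_zero, sub_zero, Complex.real_smul,
      Complex.ofReal_natCast, div_eq_mul_inv]
    linear_combination (-(t : ℂ)) * hunit
  have h2 := Complex.tendsto_one_add_pow_exp_of_tendsto h1
  refine h2.congr fun t => ?_
  rw [add_sub_cancel, mul_pow]

/-- The correlation of the evolutions at nearby wave numbers, resolved into eigenvectors. -/
theorem tendsto_inner_iterate {ι : Type*} [Fintype ι] [DecidableEq ι] {U : ℝ → E →ₗᵢ[ℂ] E}
    {k ξ : ℝ} {φ : E}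
    {ν : ι → ℝ → ℂ} {p : ι → ℝ → E} {x : ι → ℝ} (hφ : ∀ᶠ k' in 𝓝 k, φ = ∑ a, p a k')
    (hp : ∀ᶠ k' in 𝓝 k, ∀ a, U k' (p a k') = ν a k' • p a k')
    (hν : ∀ a k', ‖ν a k'‖ = 1) (hcont : ∀ a, ContinuousAt (p a) k)
    (horth : ∀ a b, a ≠ b → inner ℂ (p a k) (p b k) = 0)
    (hd : ∀ a, HasDerivAt (ν a) (-Complex.I * x a * ν a k) k) :
    Tendsto (fun t : ℕ => inner ℂ ((U k)^[t] φ) ((U (k - ξ / t))^[t] φ)) atTop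
      (𝓝 (∑ a, Complex.exp (Complex.I * ξ * x a) * (‖p a k‖ ^ 2 : ℝ))) := by
  have h0 : Tendsto (fun t : ℕ => k - ξ / (t : ℝ)) atTop (𝓝 k) := by
    simpa using (tendsto_const_nhds (x := k)).sub (tendsto_const_div_atTop_nhds_zero_nat ξ)
  have hev : ∀ᶠ t : ℕ in atTop, inner ℂ ((U k)^[t] φ) ((U (k - ξ / t))^[t] φ) =
      ∑ b, ∑ a, ((starRingEnd ℂ) (ν a k) ^ t * ν b (k - ξ / t) ^ t) *
        inner ℂ (p a k) (p b (k - ξ / t)) := by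
    filter_upwards [h0.eventually hφ, h0.eventually hp] with t h1 h2
    conv_lhs => rw [hφ.self_of_nhds]
    -- The left entry is resolved at k and the right one at k - ξ/t, each where its own isometry is
    -- diagonal.
    conv_lhs =>
      enter [3]
      rw [← hφ.self_of_nhds, h1]
    rw [LinearIsometry.iterate_sum, LinearIsometry.iterate_sum, inner_sum]
    refine Finset.sum_congr rfl fun b _ => ?_
    rw [sum_inner]
    refine Finset.sum_congr rfl fun a _ => ?_
    rw [(U k).iterate_of_eigenvector (hp.self_of_nhds a),
      (U _).iterate_of_eigenvector (h2 b), inner_smul_left, inner_smul_right, map_pow]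
    ring
  refine (tendsto_congr' hev).2 ?_
  have hlim : ∀ b a, Tendsto (fun t : ℕ => ((starRingEnd ℂ) (ν a k) ^ t * ν b (k - ξ / t) ^ t) *
        inner ℂ (p a k) (p b (k - ξ / t))) atTop
      (𝓝 (if a = b then Complex.exp (Complex.I * ξ * x b) * (‖p b k‖ ^ 2 : ℝ) else 0)) := by
    intro b a
    have h1 : Tendsto (fun t : ℕ => inner ℂ (p a k) (p b (k - ξ / t))) atTop
        (𝓝 (inner ℂ (p a k) (p b k))) :=
      tendsto_const_nhds.inner ((hcont b).tendsto.comp h0)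
    split_ifs with hab
    · subst hab
      rw [inner_self_eq_norm_sq_to_K] at h1
      have := (tendsto_eigenvalue_ratio (hν a k) (hd a) ξ).mul h1
      push_cast
      exact this
    · rw [horth a b hab] at h1
      -- The powers are unimodular, so a mixed term has the size of ⟨p_a(k), p_b(k-ξ/t)⟩, which
      -- tends to ⟨p_a(k), p_b(k)⟩ = 0.
      refine squeeze_zero_norm (a := fun t : ℕ => ‖inner ℂ (p a k) (p b (k - ξ / t))‖)
        (fun t => ?_) (by simpa using h1.norm)
      rw [norm_mul, norm_mul, norm_pow, norm_pow, RCLike.norm_conj, hν, hν, one_pow, one_mul,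
        one_mul]
  have := tendsto_finsetSum Finset.univ fun b _ => tendsto_finsetSum Finset.univ fun a _ => hlim b a
  simpa using this
end Isometry

/-! ### The eigenmodes of the twisted walk -/

/-- The ten eigenmodes of the twisted walk: the six `ν_{j,l}` and the four homological ones. -/
abbrev Mode : Type := (Fin 3 × Fin 2) ⊕ Fin 4

/-- The eigenvalue of a mode. -/
def modeValue : Mode → ℝ → ℂ
  | .inl p => eigQW p.1 p.2
  | .inr m => fun _ => Complex.I ^ (m : ℕ)

/-- An unnormalized eigenvector of a mode. -/
def modeVec : Mode → ℝ → domain.Dart → ℂ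
  | .inl p => eigVec p.1 p.2
  | .inr m => fun _ => cycleVec m

/-- The velocity of a mode. -/
def modeVelocity : Mode → ℝ → ℝ
  | .inl p => velocity p.1 p.2
  | .inr _ => fun _ => 0

/-- The weight `|⟨u, φ⟩|² / ‖u‖²` of the component of `φ` along `u`. -/
def componentWeight (u φ : domain.Dart → ℂ) : ℝ :=
  ‖∑ f, (starRingEnd ℂ) (u f) * φ f‖ ^ 2 / ∑ f, ‖u f‖ ^ 2

theorem componentWeight_nonneg (u φ : domain.Dart → ℂ) : 0 ≤ componentWeight u φ := by
  unfold componentWeight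
  positivity

/-- Cauchy–Schwarz; for u = 0 the quotient is 0. This supplies integrable majorants for the weights.
-/
theorem componentWeight_le (u φ : domain.Dart → ℂ) :
    componentWeight u φ ≤ ∑ f, ‖φ f‖ ^ 2 := by
  unfold componentWeight
  rw [← inner_toLp, ← norm_toLp_sq, ← norm_toLp_sq]
  have h := norm_inner_le_norm (𝕜 := ℂ) (WithLp.toLp 2 u : DomainSpace) (WithLp.toLp 2 φ)
  refine div_le_of_le_mul₀ (by positivity) (by positivity) ?_
  rw [← mul_pow, mul_comm ‖(WithLp.toLp 2 φ : DomainSpace)‖]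
  exact pow_le_pow_left₀ (norm_nonneg _) h 2

/-- By simplicity of the eigenvalue v is a multiple of `eigVec`, and the weight ignores scalars.
Thus v, which may vary arbitrarily with k, is replaced by a family continuous in k. -/
theorem weight_eq_componentWeight {v : Fin 3 → Fin 2 → ℝ → domain.Dart → ℂ}
    (hv : IsEigenvectorFamily v) (Φ : ℝ → domain.Dart → ℂ) {j : Fin 3} (l : Fin 2) {k : ℝ}
    (h0 : eigRW j k ≠ 0) (h1 : eigRW j k ^ 2 < 1) :
    weight v Φ j l k = componentWeight (eigVec j l k) (Φ k) := by
  obtain ⟨c, hc⟩ := exists_eq_mul_eigVec h0 h1 (hv j l k).2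
  have hn := (hv j l k).1
  unfold weight componentWeight
  simp only [hc, map_mul, mul_assoc, ← Finset.mul_sum, norm_mul, mul_pow,
    RCLike.norm_conj] at hn ⊢
  rw [eq_div_iff (right_ne_zero_of_mul_eq_one hn), mul_right_comm, hn, one_mul]

/-- By uniqueness the given unit eigenvector is a multiple of `eigVec`. The multiple is nonzero, so
`eigVec` inherits both properties without a direct computation. -/
theorem eigVec_eigenvector {v : Fin 3 → Fin 2 → ℝ → domain.Dart → ℂ}
    (hv : IsEigenvectorFamily v) {j : Fin 3} (l : Fin 2) {k : ℝ}
    (h0 : eigRW j k ≠ 0) (h1 : eigRW j k ^ 2 < 1) :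
    eigVec j l k ≠ 0 ∧ twistedStep k (eigVec j l k) = eigQW j l k • eigVec j l k := by
  obtain ⟨c, hc⟩ := exists_eq_mul_eigVec h0 h1 (hv j l k).2
  have hn := (hv j l k).1
  have hvc : v j l k = c • eigVec j l k := funext hc
  have hc0 : c ≠ 0 := by
    rintro rfl
    simp [hvc] at hn
  refine ⟨fun h => ?_, ?_⟩
  · simp [hvc, h] at hn
  · have := funext (hv j l k).2
    have h2 : twistedStep k (v j l k) = eigQW j l k • v j l k := this
    rw [hvc, twistedStep_smul, smul_comm] at h2
    exact smul_right_injective _ hc0 h2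

/-- The wave numbers at which the ten modes are different. -/
def genericSet : Set ℝ := {k | Real.sin k ≠ 0 ∧ Real.cos k ≠ 0}

theorem isOpen_genericSet : IsOpen genericSet :=
  (isOpen_ne_fun Real.continuous_sin continuous_const).inter
    (isOpen_ne_fun Real.continuous_cos continuous_const)

/-- The exceptional points are zeros of sin 2k, hence countable in number. -/
theorem ae_mem_genericSet : ∀ᵐ k : ℝ, k ∈ genericSet := by
  have hc : (genericSetᶜ).Countable := by
    have hsub : genericSetᶜ ⊆ Set.range fun n : ℤ => (n : ℝ) * (Real.pi / 2) := by
      intro k hk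
      have h2 : Real.sin (2 * k) = 0 := by
        rw [Real.sin_two_mul]
        by_contra h
        exact hk ⟨fun h' => h (by simp [h']), fun h' => h (by simp [h'])⟩
      obtain ⟨n, hn⟩ := Real.sin_eq_zero_iff.1 h2
      exact ⟨n, by simp only; linarith⟩
    exact (Set.countable_range _).mono hsub
  exact mem_ae_iff.2 (hc.measure_zero volume)

theorem eigRW_of_mem_genericSet {k : ℝ} (hk : k ∈ genericSet) (j : Fin 3) :
    eigRW j k ≠ 0 ∧ eigRW j k ^ 2 < 1 := by
  have hs : Real.cos k ^ 2 ≠ 1 := fun h => hk.1 (by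
    have := Real.sin_sq_add_cos_sq k
    rw [h] at this
    exact pow_eq_zero_iff two_ne_zero |>.1 (by linarith))
  fin_cases j
  · have h1 := eigRW_zero_lt_one (k := k) fun h => hs (by rw [h]; norm_num)
    have h2 := eigRW_zero_mem k
    simp only [Fin.zero_eta]
    exact ⟨by linarith, by nlinarith⟩
  · have h1 := neg_one_lt_eigRW_one (k := k) fun h => hs (by rw [h]; norm_num)
    have h2 := eigRW_one_mem k
    simp only [Fin.mk_one]
    exact ⟨by linarith, by nlinarith⟩
  · simp only [Fin.reduceFinMk]
    exact ⟨eigRW_two_ne_zero hk.2, eigRW_two_sq_lt_one k⟩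

theorem norm_modeValue (a : Mode) (k : ℝ) : ‖modeValue a k‖ = 1 := by
  rcases a with p | m
  · exact norm_eigQW _ _ _
  · simp [modeValue]

theorem eigRW_injective (k : ℝ) {i j : Fin 3} (h : eigRW i k = eigRW j k) : i = j := by
  have h0 := eigRW_zero_mem k
  have h1 := eigRW_one_mem k
  have h2 := eigRW_two_mem k
  fin_cases i <;> fin_cases j <;> simp only [Fin.zero_eta, Fin.mk_one, Fin.reduceFinMk] at h ⊢ <;>
    exfalso <;> linarith

/-- Real parts distinguish the λ_j from one another and from 0, ±1, the real parts of the i^m. The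
sign of the imaginary part distinguishes l. -/
theorem modeValue_injective {k : ℝ} (hk : k ∈ genericSet) :
    Function.Injective fun a => modeValue a k := by
  have key : ∀ (p : Fin 3 × Fin 2) (m : Fin 4), eigQW p.1 p.2 k ≠ Complex.I ^ (m : ℕ) := by
    intro p m h
    have hre := congrArg Complex.re h
    rw [eigQW_re] at hre
    obtain ⟨h0, h1⟩ := eigRW_of_mem_genericSet hk p.1
    have h2 : (Complex.I ^ (m : ℕ)).re = 1 ∨ (Complex.I ^ (m : ℕ)).re = 0 ∨
        (Complex.I ^ (m : ℕ)).re = -1 := by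
      fin_cases m <;> simp [pow_succ]
    rw [← hre] at h2
    rcases h2 with h2 | h2 | h2
    · rw [h2] at h1; norm_num at h1
    · exact h0 h2
    · rw [h2] at h1; norm_num at h1
  rintro (⟨j, l⟩ | m) (⟨j', l'⟩ | m') h
  · have h' : eigQW j l k = eigQW j' l' k := h
    have hre := congrArg Complex.re h'
    rw [eigQW_re, eigQW_re] at hre
    obtain rfl := eigRW_injective k hre
    have him := congrArg Complex.im h'
    rw [eigQW_im, eigQW_im] at him
    have hr : √(1 - eigRW j k ^ 2) ≠ 0 :=
      (Real.sqrt_pos.2 (by linarith [(eigRW_of_mem_genericSet hk j).2])).ne'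
    have := mul_right_cancel₀ hr him
    congr 2
    fin_cases l <;> fin_cases l' <;> simp at this ⊢ <;> norm_num at this
  · exact (key (j, l) m' h).elim
  · exact (key (j', l') m h.symm).elim
  · have h' : Complex.I ^ (m : ℕ) = Complex.I ^ (m' : ℕ) := h
    congr 1
    fin_cases m <;> fin_cases m' <;> simp [pow_succ, Complex.ext_iff] at h' ⊢ <;> norm_num at h'

theorem modeVec_eigenvector {v : Fin 3 → Fin 2 → ℝ → domain.Dart → ℂ}
    (hv : IsEigenvectorFamily v) {k : ℝ} (hk : k ∈ genericSet) (a : Mode) :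
    modeVec a k ≠ 0 ∧ twistedStep k (modeVec a k) = modeValue a k • modeVec a k := by
  rcases a with ⟨j, l⟩ | m
  · obtain ⟨h0, h1⟩ := eigRW_of_mem_genericSet hk j
    exact eigVec_eigenvector hv l h0 h1
  · refine ⟨fun h => ?_, funext (twistedStep_cycleVec k m)⟩
    have h8 := sum_norm_cycleVec_sq m
    have h' : cycleVec m = 0 := h
    simp [h'] at h8

theorem continuous_modeVec (a : Mode) :
    Continuous fun k => (WithLp.toLp 2 (modeVec a k) : DomainSpace) := by
  refine (PiLp.continuous_toLp 2 _).comp (continuous_pi fun f => ?_)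
  rcases a with ⟨j, l⟩ | m
  · exact continuous_eigVec j l f
  · exact continuous_const

theorem hasDerivAt_modeValue {k : ℝ} (hk : k ∈ genericSet) (a : Mode) :
    HasDerivAt (modeValue a) (-Complex.I * modeVelocity a k * modeValue a k) k := by
  rcases a with ⟨j, l⟩ | m
  · exact hasDerivAt_eigQW j l (eigRW_of_mem_genericSet hk j).2
  · simpa [modeVelocity, modeValue] using hasDerivAt_const k (Complex.I ^ (m : ℕ))

theorem card_mode : Fintype.card Mode = Module.finrank ℂ DomainSpace := by
  rw [finrank_euclideanSpace]
  decide

/-- The projection of `φ` to a mode. -/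
def modeProj (φ : domain.Dart → ℂ) (a : Mode) (k : ℝ) : DomainSpace :=
  (inner ℂ (WithLp.toLp 2 (modeVec a k) : DomainSpace) (WithLp.toLp 2 φ) /
    (‖(WithLp.toLp 2 (modeVec a k) : DomainSpace)‖ ^ 2 : ℝ)) • WithLp.toLp 2 (modeVec a k)

theorem norm_modeProj_sq (φ : domain.Dart → ℂ) (a : Mode) (k : ℝ) :
    ‖modeProj φ a k‖ ^ 2 = componentWeight (modeVec a k) φ := by
  unfold modeProj componentWeight
  rw [norm_smul, mul_pow, norm_div, div_pow, ← inner_toLp, ← norm_toLp_sq, Complex.norm_real,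
    Real.norm_of_nonneg (by positivity)]
  rcases eq_or_ne ‖(WithLp.toLp 2 (modeVec a k) : DomainSpace)‖ 0 with h | h
  · simp [h]
  · field_simp

theorem toLp_ne_zero {u : domain.Dart → ℂ} (h : u ≠ 0) : (WithLp.toLp 2 u : DomainSpace) ≠ 0 :=
  fun h' => h ((WithLp.toLp_eq_zero 2).1 h')

theorem sum_modeProj {v : Fin 3 → Fin 2 → ℝ → domain.Dart → ℂ} (hv : IsEigenvectorFamily v)
    {k : ℝ} (hk : k ∈ genericSet) (φ : domain.Dart → ℂ) :
    WithLp.toLp 2 φ = ∑ a, modeProj φ a k :=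
  (twistedIsometry k).sum_eigenvectors card_mode
    (fun a => toLp_ne_zero (modeVec_eigenvector hv hk a).1)
    (fun a => congrArg (WithLp.toLp 2) (modeVec_eigenvector hv hk a).2)
    (fun a => norm_modeValue a k) (modeValue_injective hk) (WithLp.toLp 2 φ)

theorem twistedIsometry_modeProj {v : Fin 3 → Fin 2 → ℝ → domain.Dart → ℂ}
    (hv : IsEigenvectorFamily v) {k : ℝ} (hk : k ∈ genericSet) (φ : domain.Dart → ℂ) (a : Mode) :
    twistedIsometry k (modeProj φ a k) = modeValue a k • modeProj φ a k := by
  have h : twistedIsometry k (WithLp.toLp 2 (modeVec a k)) =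
      modeValue a k • WithLp.toLp 2 (modeVec a k) :=
    congrArg (WithLp.toLp 2) (modeVec_eigenvector hv hk a).2
  unfold modeProj
  rw [map_smul, h, smul_comm]

/-- The pointwise limit of the correlations. -/
theorem tendsto_inner_twistedIsometry {v : Fin 3 → Fin 2 → ℝ → domain.Dart → ℂ}
    (hv : IsEigenvectorFamily v) {k : ℝ} (hk : k ∈ genericSet) (φ : domain.Dart → ℂ) (ξ : ℝ) :
    Tendsto (fun t : ℕ => inner ℂ ((twistedIsometry k)^[t] (WithLp.toLp 2 φ))
      ((twistedIsometry (k - ξ / t))^[t] (WithLp.toLp 2 φ))) atTop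
      (𝓝 (∑ a, Complex.exp (Complex.I * ξ * modeVelocity a k) *
        componentWeight (modeVec a k) φ)) := by
  have hev : ∀ᶠ k' in 𝓝 k, k' ∈ genericSet := isOpen_genericSet.mem_nhds hk
  simp only [← norm_modeProj_sq]
  refine tendsto_inner_iterate (ν := modeValue) (p := modeProj φ)
    (hev.mono fun k' hk' => sum_modeProj hv hk' φ)
    (hev.mono fun k' hk' a => twistedIsometry_modeProj hv hk' φ a) norm_modeValue
    (fun a => ?_) (fun a b hab => ?_) (hasDerivAt_modeValue hk)
  · have hc := (continuous_modeVec a).continuousAt (x := k)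
    have hne : ((‖(WithLp.toLp 2 (modeVec a k) : DomainSpace)‖ ^ 2 : ℝ) : ℂ) ≠ 0 := by
      have := norm_ne_zero_iff.2 (toLp_ne_zero (modeVec_eigenvector hv hk a).1)
      exact_mod_cast pow_ne_zero 2 this
    exact ((hc.inner continuousAt_const).div
      (Complex.continuous_ofReal.continuousAt.comp (hc.norm.pow 2)) hne).smul hc
  · exact (twistedIsometry k).inner_eq_zero_of_eigenvectors
      (twistedIsometry_modeProj hv hk φ a) (twistedIsometry_modeProj hv hk φ b)
      (norm_modeValue a k) ((modeValue_injective hk).ne hab)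

/-! ### Correlations of the walk -/

/-- Lebesgue measure on one period. -/
abbrev periodMeasure : Measure ℝ := volume.restrict (Set.Ioc (-Real.pi) Real.pi)

theorem neg_pi_le_pi : -Real.pi ≤ Real.pi := by linarith [Real.pi_pos]

theorem IsFourierPair.hasSum_norm_sq {ψ : ℤ → ℂ} {F : ℝ → ℂ} (h : IsFourierPair ψ F) :
    HasSum (fun x => ‖ψ x‖ ^ 2) (1 / (2 * Real.pi) * ∫ k, ‖F k‖ ^ 2 ∂periodMeasure) := by
  have key := h.hasSum_inner h
  simp only [Complex.conj_mul'] at key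
  rw [intervalIntegral.integral_of_le neg_pi_le_pi] at key
  have e : ((1 / (2 * Real.pi) * ∫ k, ‖F k‖ ^ 2 ∂periodMeasure : ℝ) : ℂ) =
      1 / (2 * Real.pi) * ∫ k in Set.Ioc (-Real.pi) Real.pi, (‖F k‖ : ℂ) ^ 2 := by
    push_cast
    rw [← integral_complex_ofReal]
    push_cast
    rfl
  rw [← e] at key
  exact_mod_cast key

/-- By Parseval this is the sum of |e^{isx} - 1|²|ψ(x)|², dominated by 4|ψ(x)|². -/
theorem IsFourierPair.tendsto_translate {ψ : ℤ → ℂ} {F : ℝ → ℂ} (h : IsFourierPair ψ F) :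
    Tendsto (fun s => ∫ k, ‖F (k - s) - F k‖ ^ 2 ∂periodMeasure) (𝓝 0) (𝓝 0) := by
  have h1 : ∀ s : ℝ, ∫ k, ‖F (k - s) - F k‖ ^ 2 ∂periodMeasure =
      2 * Real.pi * ∑' x : ℤ, ‖Complex.exp (Complex.I * s * x) * ψ x - ψ x‖ ^ 2 := by
    intro s
    rw [((h.translate s).sub h).hasSum_norm_sq.tsum_eq]
    field_simp
  have h2 : Tendsto (fun s : ℝ => ∑' x : ℤ, ‖Complex.exp (Complex.I * s * x) * ψ x - ψ x‖ ^ 2)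
      (𝓝 0) (𝓝 (∑' _ : ℤ, 0)) := by
    refine tendsto_tsum_of_dominated_convergence (bound := fun x => 4 * ‖ψ x‖ ^ 2)
      (h.hasSum_norm_sq.summable.mul_left 4) (fun x => ?_) (.of_forall fun s x => ?_)
    · have : Continuous fun s : ℝ => ‖Complex.exp (Complex.I * s * x) * ψ x - ψ x‖ ^ 2 := by
        fun_prop
      simpa using this.tendsto 0
    · have h3 : ‖Complex.exp (Complex.I * s * x) * ψ x - ψ x‖ ≤ 2 * ‖ψ x‖ := by
        refine (norm_sub_le _ _).trans_eq ?_
        rw [norm_mul, Complex.norm_exp]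
        simp
        ring
      rw [Real.norm_of_nonneg (by positivity)]
      calc _ ≤ (2 * ‖ψ x‖) ^ 2 := pow_le_pow_left₀ (norm_nonneg _) h3 2
        _ = _ := by ring
  rw [tsum_zero] at h2
  simpa only [h1, mul_zero] using h2.const_mul (2 * Real.pi)

namespace IsFourierFamily

variable {ψ : chain.Dart → ℂ} {Φ : ℝ → domain.Dart → ℂ}

theorem memLp_toLp (h : IsFourierFamily ψ Φ) :
    MemLp (fun k => (WithLp.toLp 2 (Φ k) : DomainSpace)) 2 periodMeasure :=
  MemLp.of_eval_piLp fun f => (h f).memLp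

theorem memLp_toLp_translate (h : IsFourierFamily ψ Φ) (s : ℝ) :
    MemLp (fun k => (WithLp.toLp 2 (Φ (k - s)) : DomainSpace)) 2 periodMeasure :=
  MemLp.of_eval_piLp fun f => ((h f).translate s).memLp

theorem integrable_norm_sq (h : IsFourierFamily ψ Φ) :
    Integrable (fun k => ∑ f, ‖Φ k f‖ ^ 2) periodMeasure :=
  integrable_finsetSum _ fun f _ => (h f).memLp.integrable_norm_pow two_ne_zero

/-- The characteristic function of the label as a correlation of Fourier transforms. -/
theorem hasSum_exp (h : IsFourierFamily ψ Φ) (s : ℝ) :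
    HasSum (fun x : ℤ => ((∑ f, ‖ψ (liftArc x f)‖ ^ 2 : ℝ) : ℂ) * Complex.exp (Complex.I * s * x))
      (1 / (2 * Real.pi) * ∫ k, inner ℂ (WithLp.toLp 2 (Φ k) : DomainSpace)
        (WithLp.toLp 2 (Φ (k - s))) ∂periodMeasure) := by
  have key := hasSum_sum fun f (_ : f ∈ Finset.univ) => (h f).hasSum_inner ((h f).translate s)
  simp only [inner_toLp]
  rw [integral_finsetSum _ fun f _ => by
    exact MemLp.integrable_mul (p := 2) (q := 2) (h f).memLp.star ((h f).translate s).memLp,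
    Finset.mul_sum]
  convert key using 2 with x f
  · rw [Complex.ofReal_sum, Finset.sum_mul]
    refine Finset.sum_congr rfl fun f _ => ?_
    rw [mul_left_comm, Complex.conj_mul', mul_comm]
    push_cast
    rfl
  · rw [intervalIntegral.integral_of_le neg_pi_le_pi]

theorem tendsto_translate (h : IsFourierFamily ψ Φ) :
    Tendsto (fun s => ∫ k, ‖(WithLp.toLp 2 (Φ (k - s)) : DomainSpace) - WithLp.toLp 2 (Φ k)‖ ^ 2
      ∂periodMeasure) (𝓝 0) (𝓝 0) := by
  have h1 := tendsto_finsetSum Finset.univ fun f (_ : f ∈ Finset.univ) => (h f).tendsto_translate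
  rw [Finset.sum_const_zero] at h1
  refine h1.congr fun s => ?_
  rw [← integral_finsetSum _ fun f _ =>
    (((h f).translate s).sub (h f)).memLp.integrable_norm_pow two_ne_zero]
  refine integral_congr_ae (ae_of_all _ fun k => ?_)
  simp only
  rw [← WithLp.toLp_sub, norm_toLp_sq]
  rfl

end IsFourierFamily

/-- The function c allows the wave number of the walk to differ from that of Φ, as in the
correlations at k and k - s. -/
theorem aestronglyMeasurable_iterate_twistedStep {μ : Measure ℝ} {Φ : ℝ → domain.Dart → ℂ}
    (hΦ : ∀ f, AEStronglyMeasurable (fun k => Φ k f) μ) {c : ℝ → ℝ} (hc : Continuous c) (t : ℕ)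
    (f : domain.Dart) :
    AEStronglyMeasurable (fun k => (twistedStep (c k))^[t] (Φ k) f) μ := by
  induction t generalizing f with
  | zero => exact hΦ f
  | succ t ih =>
    simp only [Function.iterate_succ_apply']
    have h1 : Continuous fun k => Complex.exp (Complex.I * (c k : ℝ) * winding f) := by fun_prop
    refine h1.aestronglyMeasurable.mul ?_
    unfold groverStep
    exact Finset.aestronglyMeasurable_fun_sum _ fun w _ => (ih _).const_mul _

/-- Linearity, isometry and Cauchy–Schwarz, pointwise and then in L². The bound depends on t only
through s, so s may be taken as ξ/t. -/
theorem IsFourierFamily.norm_integral_error_le {ψ : chain.Dart → ℂ} {Φ : ℝ → domain.Dart → ℂ}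
    (h : IsFourierFamily ψ Φ) (s : ℝ) (t : ℕ) :
    ‖∫ k, inner ℂ ((twistedIsometry k)^[t] (WithLp.toLp 2 (Φ k)))
        ((twistedIsometry (k - s))^[t] (WithLp.toLp 2 (Φ (k - s)))) ∂periodMeasure -
      ∫ k, inner ℂ ((twistedIsometry k)^[t] (WithLp.toLp 2 (Φ k)))
        ((twistedIsometry (k - s))^[t] (WithLp.toLp 2 (Φ k))) ∂periodMeasure‖ ≤
    (∫ k, ‖(WithLp.toLp 2 (Φ k) : DomainSpace)‖ ^ (2 : ℝ) ∂periodMeasure) ^ (1 / 2 : ℝ) *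
    (∫ k, ‖(WithLp.toLp 2 (Φ (k - s)) : DomainSpace) - WithLp.toLp 2 (Φ k)‖ ^ (2 : ℝ)
      ∂periodMeasure) ^ (1 / 2 : ℝ) := by
  have hint : ∀ G : ℝ → domain.Dart → ℂ, MemLp (fun k => (WithLp.toLp 2 (G k) : DomainSpace)) 2
      periodMeasure → Integrable (fun k => inner ℂ ((twistedIsometry k)^[t] (WithLp.toLp 2 (Φ k)))
        ((twistedIsometry (k - s))^[t] (WithLp.toLp 2 (G k)))) periodMeasure := by
    intro G hG
    refine (MemLp.integrable_mul (p := 2) (q := 2) h.memLp_toLp.norm hG.norm).mono' ?_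
      (ae_of_all _ fun k => ?_)
    · simp only [← toLp_iterate_twistedStep, inner_toLp]
      refine Finset.aestronglyMeasurable_fun_sum _ fun f _ => ?_
      exact (aestronglyMeasurable_iterate_twistedStep (fun f => (h f).memLp.1)
        continuous_id t f).star.mul (aestronglyMeasurable_iterate_twistedStep
          (fun f => (hG.eval_piLp f).1) (continuous_id.sub continuous_const) t f)
    · refine (norm_inner_le_norm _ _).trans_eq ?_
      rw [LinearIsometry.norm_iterate, LinearIsometry.norm_iterate]
      rfl
  rw [← integral_sub (hint _ (h.memLp_toLp_translate s)) (hint _ h.memLp_toLp)]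
  refine (norm_integral_le_integral_norm _).trans ?_
  have hd := (h.memLp_toLp_translate s).sub h.memLp_toLp
  have hH := integral_mul_le_Lp_mul_Lq_of_nonneg (μ := periodMeasure) (p := 2) (q := 2)
    Real.HolderConjugate.two_two
    (f := fun k => ‖(WithLp.toLp 2 (Φ k) : DomainSpace)‖)
    (g := fun k => ‖(WithLp.toLp 2 (Φ (k - s)) : DomainSpace) - WithLp.toLp 2 (Φ k)‖)
    (ae_of_all _ fun _ => norm_nonneg _) (ae_of_all _ fun _ => norm_nonneg _)
    (by simpa using h.memLp_toLp.norm) (by simpa using hd.norm)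
  refine (integral_mono_of_nonneg (ae_of_all _ fun _ => norm_nonneg _)
    (MemLp.integrable_mul (p := 2) (q := 2) h.memLp_toLp.norm hd.norm)
    (ae_of_all _ fun k => ?_)).trans hH
  simp only [← inner_sub_right, ← iterate_map_sub]
  refine (norm_inner_le_norm _ _).trans_eq ?_
  rw [LinearIsometry.norm_iterate, LinearIsometry.norm_iterate]
  rfl

/-- The rescaled characteristic functions of the label converge. -/
theorem IsFourierFamily.tendsto_correlation {ψ : chain.Dart → ℂ} {Φ : ℝ → domain.Dart → ℂ}
    (h : IsFourierFamily ψ Φ) {v : Fin 3 → Fin 2 → ℝ → domain.Dart → ℂ}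
    (hv : IsEigenvectorFamily v) (ξ : ℝ) :
    Tendsto (fun t : ℕ => ∑' x : ℤ,
      ((∑ f, ‖(groverStep chain)^[t] ψ (liftArc x f)‖ ^ 2 : ℝ) : ℂ) *
        Complex.exp (Complex.I * (ξ / t : ℝ) * x)) atTop
      (𝓝 (1 / (2 * Real.pi) * ∫ k, ∑ a, Complex.exp (Complex.I * ξ * modeVelocity a k) *
        componentWeight (modeVec a k) (Φ k) ∂periodMeasure)) := by
  have h1 : ∀ t : ℕ, ∑' x : ℤ, ((∑ f, ‖(groverStep chain)^[t] ψ (liftArc x f)‖ ^ 2 : ℝ) : ℂ) *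
      Complex.exp (Complex.I * (ξ / t : ℝ) * x) = 1 / (2 * Real.pi) *
      ∫ k, inner ℂ ((twistedIsometry k)^[t] (WithLp.toLp 2 (Φ k)))
        ((twistedIsometry (k - ξ / t))^[t] (WithLp.toLp 2 (Φ (k - ξ / t)))) ∂periodMeasure := by
    intro t
    have := ((h.iterate t).hasSum_exp (ξ / t)).tsum_eq
    rw [this]
    simp only [toLp_iterate_twistedStep]
  simp only [h1]
  refine Tendsto.const_mul _ ?_
  have hs : Tendsto (fun t : ℕ => ξ / (t : ℝ)) atTop (𝓝 0) :=
    tendsto_const_div_atTop_nhds_zero_nat ξ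
  -- With Φ frozen at k the integrand converges almost everywhere and is bounded by ‖Φ(k)‖².
  have hmain : Tendsto (fun t : ℕ => ∫ k, inner ℂ ((twistedIsometry k)^[t] (WithLp.toLp 2 (Φ k)))
        ((twistedIsometry (k - ξ / t))^[t] (WithLp.toLp 2 (Φ k))) ∂periodMeasure) atTop
      (𝓝 (∫ k, ∑ a, Complex.exp (Complex.I * ξ * modeVelocity a k) *
        componentWeight (modeVec a k) (Φ k) ∂periodMeasure)) := by
    refine tendsto_integral_of_dominated_convergence (fun k => ∑ f, ‖Φ k f‖ ^ 2) (fun t => ?_)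
      h.integrable_norm_sq (fun t => ae_of_all _ fun k => ?_) ?_
    · simp only [← toLp_iterate_twistedStep, inner_toLp]
      refine Finset.aestronglyMeasurable_fun_sum _ fun f _ => ?_
      exact (aestronglyMeasurable_iterate_twistedStep (fun f => (h f).memLp.1)
        continuous_id t f).star.mul (aestronglyMeasurable_iterate_twistedStep
          (fun f => (h f).memLp.1) (continuous_id.sub continuous_const) t f)
    · refine (norm_inner_le_norm _ _).trans_eq ?_
      rw [LinearIsometry.norm_iterate, LinearIsometry.norm_iterate, ← norm_toLp_sq, sq]
    · exact ae_restrict_of_ae (ae_mem_genericSet.mono fun k hk =>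
        tendsto_inner_twistedIsometry hv hk (Φ k) ξ)
  have herr : Tendsto (fun t : ℕ =>
      ∫ k, inner ℂ ((twistedIsometry k)^[t] (WithLp.toLp 2 (Φ k)))
        ((twistedIsometry (k - ξ / t))^[t] (WithLp.toLp 2 (Φ (k - ξ / t)))) ∂periodMeasure -
      ∫ k, inner ℂ ((twistedIsometry k)^[t] (WithLp.toLp 2 (Φ k)))
        ((twistedIsometry (k - ξ / t))^[t] (WithLp.toLp 2 (Φ k))) ∂periodMeasure) atTop (𝓝 0) := by
    refine squeeze_zero_norm (fun t => h.norm_integral_error_le (ξ / t) t) ?_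
    have h2 := (((h.tendsto_translate.comp hs).rpow_const
      (p := (1 / 2 : ℝ)) (Or.inr (by norm_num))).const_mul
      ((∫ k, ‖(WithLp.toLp 2 (Φ k) : DomainSpace)‖ ^ (2 : ℝ) ∂periodMeasure) ^ (1 / 2 : ℝ)))
    rw [Real.zero_rpow (by norm_num), mul_zero] at h2
    simpa using h2
  simpa using hmain.add herr

/-! ### Densities of images of measures on intervals -/

/-- The image of the measure `W(k) dk / 2π` under a diffeomorphism of intervals has a density. -/
theorem exists_density {f f' W : ℝ → ℝ} {a b c d : ℝ}
    (hbij : Set.BijOn f (Set.Ioo a b) (Set.Ioo c d))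
    (hder : ∀ k ∈ Set.Ioo a b, HasDerivAt f (f' k) k) (hne : ∀ k ∈ Set.Ioo a b, f' k ≠ 0)
    (hcont : ContinuousOn f' (Set.Ioo a b)) (hW : ∀ k, 0 ≤ W k)
    (hWint : IntegrableOn W (Set.Ioo a b)) :
    ∃ ρ : ℝ → ℝ, (∀ y, 0 ≤ ρ y) ∧ Integrable ρ ∧
      (∀ k ∈ Set.Ioo a b, ρ (f k) = W k / (2 * Real.pi * |f' k|)) ∧
      (∀ y, y ∉ Set.Ioo c d → ρ y = 0) ∧
      (ContinuousOn W (Set.Ioo a b) → ContinuousOn ρ (Set.Ioo c d)) ∧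
      ∀ ξ : ℝ, ∫ y : ℝ, Complex.exp (Complex.I * ξ * y) * ρ y =
        1 / (2 * Real.pi) * ∫ k in Set.Ioo a b, Complex.exp (Complex.I * ξ * f k) * W k := by
  classical
  set g := Function.invFunOn f (Set.Ioo a b) with hg
  set ρ : ℝ → ℝ := (Set.Ioo c d).indicator fun y => W (g y) / (2 * Real.pi * |f' (g y)|) with hρ
  have hρf : ∀ k ∈ Set.Ioo a b, ρ (f k) = W k / (2 * Real.pi * |f' k|) := by
    intro k hk
    have : g (f k) = k := hbij.injOn.leftInvOn_invFunOn hk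
    rw [hρ, Set.indicator_of_mem (hbij.mapsTo hk), this]
  have hρ0 : ∀ y, y ∉ Set.Ioo c d → ρ y = 0 := fun y hy => Set.indicator_of_notMem hy _
  have hder' : ∀ k ∈ Set.Ioo a b, HasDerivWithinAt f (f' k) (Set.Ioo a b) k :=
    fun k hk => (hder k hk).hasDerivWithinAt
  have himg : f '' Set.Ioo a b = Set.Ioo c d := hbij.image_eq
  -- The Jacobian cancels the denominator of ρ, so that both integrability and the transform reduce
  -- to W.
  have hmul : ∀ k ∈ Set.Ioo a b, |f' k| * ρ (f k) = 1 / (2 * Real.pi) * W k := by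
    intro k hk
    rw [hρf k hk]
    have := abs_ne_zero.2 (hne k hk)
    have := Real.pi_ne_zero
    field_simp
  have hon : IntegrableOn ρ (Set.Ioo c d) := by
    rw [← himg, integrableOn_image_iff_integrableOn_abs_deriv_smul measurableSet_Ioo hder'
      hbij.injOn]
    exact IntegrableOn.congr_fun (f := fun k => 1 / (2 * Real.pi) * W k) (hWint.const_mul _)
      (fun k hk => (hmul k hk).symm) measurableSet_Ioo
  refine ⟨ρ, fun y => Set.indicator_nonneg (fun y _ => ?_) y, ?_, hρf, hρ0, fun hWc => ?_,
    fun ξ => ?_⟩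
  · have := hW (g y)
    positivity
  · exact (integrableOn_iff_integrable_of_support_subset fun y hy =>
      by_contra fun h => hy (hρ0 y h)).1 hon
  · rw [← himg]
    rintro _ ⟨k, hk, rfl⟩
    refine ContinuousAt.continuousWithinAt ?_
    have hnhds : Set.Ioo a b ∈ 𝓝 k := Ioo_mem_nhds hk.1 hk.2
    have hs : HasStrictDerivAt f (f' k) k :=
      hasStrictDerivAt_of_hasDerivAt_of_continuousAt (eventually_of_mem hnhds hder)
        (hcont.continuousAt hnhds)
    -- By the inverse function theorem f maps the neighbourhoods of k onto those of f(k), so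
    -- continuity of ρ can be tested after composition with f.
    rw [ContinuousAt, ← hs.map_nhds_eq (hne k hk), tendsto_map'_iff, hρf k hk]
    have hc : ContinuousAt (fun k => W k / (2 * Real.pi * |f' k|)) k := by
      refine (hWc.continuousAt hnhds).div (continuousAt_const.mul
        (hcont.continuousAt hnhds).abs) ?_
      have := abs_pos.2 (hne k hk)
      positivity
    refine hc.tendsto.congr' ?_
    filter_upwards [hnhds] with k' hk' using (hρf k' hk').symm
  · have h1 : ∫ y : ℝ, Complex.exp (Complex.I * ξ * y) * ρ y =
        ∫ y in f '' Set.Ioo a b, Complex.exp (Complex.I * ξ * y) * ρ y := by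
      rw [himg, setIntegral_eq_integral_of_forall_compl_eq_zero]
      intro y hy
      rw [hρ0 y hy, Complex.ofReal_zero, mul_zero]
    rw [h1, integral_image_eq_integral_abs_deriv_smul measurableSet_Ioo hder' hbij.injOn,
      ← integral_const_mul]
    refine setIntegral_congr_fun measurableSet_Ioo fun k hk => ?_
    have := congrArg (fun r : ℝ => (r : ℂ)) (hmul k hk)
    push_cast at this
    simp only [Complex.real_smul]
    rw [mul_left_comm, this]
    ring

/-! ### Convergence of distribution functions -/

/-- The probability mass function of a family of nonnegative numbers with sum `1`. -/
def pmfOfHasSum {q : ℤ → ℝ} (h0 : ∀ j, 0 ≤ q j) (h1 : HasSum q 1) : PMF ℤ :=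
  ⟨fun j => ENNReal.ofReal (q j), by
    rw [ENNReal.summable.hasSum_iff, ← ENNReal.ofReal_tsum_of_nonneg h0 h1.summable, h1.tsum_eq,
      ENNReal.ofReal_one]⟩

theorem pmfOfHasSum_toReal {q : ℤ → ℝ} (h0 : ∀ j, 0 ≤ q j) (h1 : HasSum q 1) (j : ℤ) :
    (pmfOfHasSum h0 h1 j).toReal = q j :=
  ENNReal.toReal_ofReal (h0 j)

/-- Lévy's continuity theorem with limit D δ₀ + R(y) dy. The only possible atom is at 0, so (-∞, x]
is a continuity set under the hypothesis on x. -/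
theorem tendsto_distribution {q : ℕ → ℤ → ℝ} (h0 : ∀ t j, 0 ≤ q t j) (h1 : ∀ t, HasSum (q t) 1)
    {D : ℝ} (hD : 0 ≤ D) {R : ℝ → ℝ} (hR : ∀ y, 0 ≤ R y) (hRint : Integrable R)
    (hchar : ∀ ξ : ℝ, Tendsto (fun t : ℕ => ∑' j : ℤ,
      (q t j : ℂ) * Complex.exp (Complex.I * (ξ / t : ℝ) * j)) atTop
      (𝓝 (D + ∫ y : ℝ, Complex.exp (Complex.I * ξ * y) * R y))) {x : ℝ} (hx : x ≠ 0 ∨ D = 0) :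
    Tendsto (fun t : ℕ => ∑' j : ℤ, if (j : ℝ) / (t : ℝ) ≤ x then q t j else 0) atTop
      (𝓝 ((if 0 ≤ x then D else 0) + ∫ y in Set.Iic x, R y)) := by
  let P : ℕ → Measure ℝ := fun t =>
    (pmfOfHasSum (h0 t) (h1 t)).toMeasure.map fun j : ℤ => (j : ℝ) / (t : ℝ)
  have hmeas : ∀ t : ℕ, Measurable fun j : ℤ => (j : ℝ) / (t : ℝ) := fun t =>
    measurable_of_countable _
  have hP : ∀ t, IsProbabilityMeasure (P t) := fun t =>
    Measure.isProbabilityMeasure_map (hmeas t).aemeasurable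
  have hPchar : ∀ t ξ, charFun (P t) ξ =
      ∑' j : ℤ, (q t j : ℂ) * Complex.exp (Complex.I * (ξ / t : ℝ) * j) := by
    intro t ξ
    rw [charFun_apply_real, integral_map (hmeas t).aemeasurable (by fun_prop),
      PMF.integral_eq_tsum]
    · refine tsum_congr fun j => ?_
      rw [pmfOfHasSum_toReal, Complex.real_smul]
      congr 2
      push_cast
      ring
    · refine Integrable.of_bound (measurable_of_countable _).aestronglyMeasurable 1
        (ae_of_all _ fun j => ?_)
      rw [Complex.norm_exp]
      simp
  let N : Measure ℝ := volume.withDensity fun y => ENNReal.ofReal (R y)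
  have hNfin : IsFiniteMeasure N := isFiniteMeasure_withDensity_ofReal hRint.2
  let M : Measure ℝ := ENNReal.ofReal D • Measure.dirac 0 + N
  have hDfin : IsFiniteMeasure (ENNReal.ofReal D • Measure.dirac (0 : ℝ)) :=
    Measure.smul_finite _ ENNReal.ofReal_ne_top
  have hMfin : IsFiniteMeasure M := inferInstanceAs (IsFiniteMeasure (_ + _))
  have hMchar : ∀ ξ, charFun M ξ = D + ∫ y : ℝ, Complex.exp (Complex.I * ξ * y) * R y := by
    intro ξ
    have hb : ∀ (μ : Measure ℝ) [IsFiniteMeasure μ],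
        Integrable (fun y : ℝ => Complex.exp (ξ * y * Complex.I)) μ := fun μ _ =>
      Integrable.of_bound (by fun_prop) 1 (ae_of_all _ fun y => by
        rw [← Complex.ofReal_mul, Complex.norm_exp_ofReal_mul_I])
    rw [charFun_apply_real, integral_add_measure (hb _) (hb _), integral_smul_measure,
      integral_dirac, ENNReal.toReal_ofReal hD,
      integral_withDensity_eq_integral_toReal_smul₀ hRint.1.aemeasurable.ennreal_ofReal
        (ae_of_all _ fun _ => ENNReal.ofReal_lt_top)]
    congr 1
    · simp
    · refine integral_congr_ae (ae_of_all _ fun y => ?_)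
      simp only [ENNReal.toReal_ofReal (hR y), Complex.real_smul]
      rw [mul_comm]
      congr 2
      ring
  have hM1 : IsProbabilityMeasure M := by
    -- The characteristic functions at ξ = 0 show that the limit measure has mass 1.
    have h2 := hchar 0
    rw [← hMchar] at h2
    simp only [← hPchar, charFun_zero] at h2
    have h3 := tendsto_nhds_unique h2 (tendsto_const_nhds.congr fun t => by
      rw [measureReal_def, (hP t).measure_univ, ENNReal.toReal_one])
    refine ⟨?_⟩
    rw [← ENNReal.toReal_eq_one_iff]
    exact_mod_cast h3
  let P' : ℕ → ProbabilityMeasure ℝ := fun t => ⟨P t, hP t⟩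
  let M' : ProbabilityMeasure ℝ := ⟨M, hM1⟩
  have hconv : Tendsto P' atTop (𝓝 M') := by
    refine ProbabilityMeasure.tendsto_of_tendsto_charFun fun ξ => ?_
    change Tendsto (fun t => charFun (P t) ξ) atTop (𝓝 (charFun M ξ))
    simp only [hPchar, hMchar]
    exact hchar ξ
  have hnull : M (frontier (Set.Iic x)) = 0 := by
    rw [frontier_Iic, Measure.add_apply, Measure.smul_apply,
      withDensity_absolutelyContinuous _ _ Real.volume_singleton, add_zero,
      Measure.dirac_apply' _ (measurableSet_singleton x)]
    rcases hx with hx | hx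
    · rw [Set.indicator_of_notMem (fun h => hx h.symm), smul_zero]
    · rw [hx, ENNReal.ofReal_zero, zero_smul]
  have key := ProbabilityMeasure.tendsto_measure_of_null_frontier_of_tendsto' hconv hnull
  have key2 := (ENNReal.tendsto_toReal (measure_ne_top M _)).comp key
  have hMx : (M (Set.Iic x)).toReal = (if 0 ≤ x then D else 0) + ∫ y in Set.Iic x, R y := by
    rw [Measure.add_apply, ENNReal.toReal_add (measure_ne_top _ _) (measure_ne_top _ _)]
    congr 1
    · rw [Measure.smul_apply, Measure.dirac_apply' _ measurableSet_Iic, smul_eq_mul,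
        ENNReal.toReal_mul, ENNReal.toReal_ofReal hD]
      by_cases h : 0 ≤ x <;> simp [h]
    · rw [withDensity_apply _ measurableSet_Iic, integral_eq_lintegral_of_nonneg_ae
        (ae_of_all _ hR) hRint.1.restrict]
  rw [← hMx]
  refine key2.congr fun t => ?_
  change (P t (Set.Iic x)).toReal = _
  rw [Measure.map_apply (hmeas t) measurableSet_Iic, PMF.toMeasure_apply (hs := hmeas t measurableSet_Iic), ENNReal.tsum_toReal_eq fun j => ?_]
  · refine tsum_congr fun j => ?_
    by_cases h : (j : ℝ) / (t : ℝ) ≤ x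
    · rw [Set.indicator_of_mem (show j ∈ _ from h), if_pos h, pmfOfHasSum_toReal]
    · rw [Set.indicator_of_notMem (show j ∉ _ from h), if_neg h, ENNReal.toReal_zero]
  · exact ne_top_of_le_ne_top (PMF.apply_ne_top _ j) (Set.indicator_le_self _ _ j)

/-! ### The mass of the homological eigenspaces -/

/-- The generator of a homological eigenspace. -/
def homVec (j : ℤ) (m : Fin 4) : ArcSpace chain :=
  pathVec chain m (fun r => liftArc j (cyc r)) - pathVec chain m (fun r => liftArc j (cycRev r))

theorem inner_pathVec {V : Type} [DecidableEq V] (G : SimpleGraph V) {n : ℕ} (m : ℕ)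
    (p : Fin n → G.Dart) (Ψ : ArcSpace G) :
    inner ℂ (pathVec G m p) Ψ = ∑ r : Fin n, (starRingEnd ℂ)
      (Complex.exp (2 * Real.pi * Complex.I * m * ((r : ℕ) + 1) / n)) * Ψ (p r) := by
  unfold pathVec
  rw [sum_inner]
  refine Finset.sum_congr rfl fun r _ => ?_
  rw [inner_smul_left, lp.inner_single_left, RCLike.inner_apply', map_one, one_mul]

theorem inner_homVec (j : ℤ) (m : Fin 4) (Ψ : ArcSpace chain) :
    inner ℂ (homVec j m) Ψ = ∑ f, (starRingEnd ℂ) (cycleVec m f) * Ψ (liftArc j f) := by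
  unfold homVec cycleVec
  rw [inner_sub_left, inner_pathVec, inner_pathVec]
  simp only [map_sum, map_mul, Finset.sum_mul]
  rw [Finset.sum_comm, ← Finset.sum_sub_distrib]
  refine Finset.sum_congr rfl fun r _ => ?_
  rw [← mul_sub]
  simp only [mul_assoc]
  rw [← Finset.mul_sum]
  congr 1
  simp only [map_sub, apply_ite (starRingEnd ℂ), map_one, map_zero, sub_mul, ite_mul, one_mul, zero_mul,
    Finset.sum_sub_distrib, Finset.sum_ite_eq', Finset.mem_univ, if_true]

theorem homVec_apply (j : ℤ) (m : Fin 4) (f : domain.Dart) :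
    homVec j m (liftArc j f) = cycleVec m f := by
  have hinj : ∀ g, liftArc j f = liftArc j g ↔ f = g := fun g =>
    ⟨fun h => congrArg Prod.snd (bijective_liftArc.injective (a₁ := (j, f)) (a₂ := (j, g)) h),
      fun h => congrArg _ h⟩
  unfold homVec cycleVec pathVec
  simp only [lp.coeFn_sub, lp.coeFn_sum, Pi.sub_apply, Finset.sum_apply, lp.coeFn_smul,
    Pi.smul_apply, lp.single_apply, Pi.single_apply, hinj, smul_eq_mul, mul_sub,
    Finset.sum_sub_distrib]

theorem norm_homVec_sq (j : ℤ) (m : Fin 4) : ‖homVec j m‖ ^ 2 = 8 := by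
  have h := inner_homVec j m (homVec j m)
  simp only [homVec_apply, Complex.conj_mul'] at h
  rw [inner_self_eq_norm_sq_to_K] at h
  rw [← sum_norm_cycleVec_sq m, ← Complex.ofReal_inj]
  push_cast
  exact h

/-- Projection to a line whose generator is a copy of `cycleVec`, both having squared norm 8. -/
theorem norm_starProjection_homSpace_sq (j : ℤ) (m : Fin 4) (Ψ : ArcSpace chain) :
    ‖(homSpace j m).starProjection Ψ‖ ^ 2 =
      componentWeight (cycleVec m) (fun f => Ψ (liftArc j f)) := by
  have h : (homSpace j m).starProjection Ψ =
      (inner ℂ (homVec j m) Ψ / ((‖homVec j m‖ ^ 2 : ℝ) : ℂ)) • homVec j m :=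
    Submodule.starProjection_singleton ℂ Ψ
  rw [h, norm_smul, mul_pow, norm_div, div_pow, Complex.norm_real, norm_homVec_sq, inner_homVec,
    componentWeight, sum_norm_cycleVec_sq]
  norm_num
  ring

/-- As `cycleVec` does not depend on k, the inner products with its copies are the Fourier
coefficients of ⟨cycleVec, Φ(k)⟩, and Parseval applies. -/
theorem homMass_eq_integral {Ψ : ArcSpace chain} {Φ : ℝ → domain.Dart → ℂ}
    (h : IsFourierFamily Ψ Φ) :
    homMass Ψ = 1 / (2 * Real.pi) *
      ∫ k, ∑ m, componentWeight (cycleVec m) (Φ k) ∂periodMeasure := by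
  have hp : ∀ m, IsFourierPair
      (fun j => ∑ f, (starRingEnd ℂ) (cycleVec m f) * Ψ (liftArc j f))
      (fun k => ∑ f, (starRingEnd ℂ) (cycleVec m f) * Φ k f) := fun m =>
    IsFourierPair.sum _ fun f => (h f).const_mul _
  unfold homMass
  simp only [norm_starProjection_homSpace_sq, componentWeight]
  rw [integral_finsetSum _ fun m _ => ((hp m).memLp.integrable_norm_pow two_ne_zero).div_const _,
    Finset.mul_sum]
  refine HasSum.tsum_eq (hasSum_sum fun m _ => ?_)
  rw [integral_div, ← mul_div_assoc]
  exact (hp m).hasSum_norm_sq.div_const _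

theorem homMass_nonneg (Ψ : ArcSpace chain) : 0 ≤ homMass Ψ :=
  tsum_nonneg fun _ => Finset.sum_nonneg fun _ _ => by positivity

/-! ### The total mass -/

theorem labelProb_eq (Ψ : ArcSpace chain) (t : ℕ) (j : ℤ) :
    labelProb Ψ t j = ∑ f, ‖(groverStep chain)^[t] Ψ (liftArc j f)‖ ^ 2 :=
  sum_vertexWeight _ j

theorem hasSum_label {ψ : chain.Dart → ℂ} {Φ : ℝ → domain.Dart → ℂ} (h : IsFourierFamily ψ Φ) :
    HasSum (fun j : ℤ => ∑ f, ‖ψ (liftArc j f)‖ ^ 2)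
      (1 / (2 * Real.pi) * ∫ k, ‖(WithLp.toLp 2 (Φ k) : DomainSpace)‖ ^ 2 ∂periodMeasure) := by
  have h1 := hasSum_sum fun f (_ : f ∈ Finset.univ) => (h f).hasSum_norm_sq
  simp only [norm_toLp_sq]
  rwa [integral_finsetSum _ fun f _ => (h f).memLp.integrable_norm_pow two_ne_zero,
    Finset.mul_sum]

/-- Conservation of probability is checked in the Fourier picture, where each step is an isometry
for every k. -/
theorem hasSum_labelProb {Ψ : ArcSpace chain} (hΨ : ‖Ψ‖ = 1) (t : ℕ) :
    HasSum (labelProb Ψ t) 1 := by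
  obtain ⟨Φ, hΦ⟩ := exists_isFourierTransform Ψ
  have h := (isFourierTransform_iff _ _).1 hΦ
  have h0 := hasSum_label h
  have ht := hasSum_label (h.iterate t)
  simp only [toLp_iterate_twistedStep, LinearIsometry.norm_iterate] at ht
  have h1 : HasSum (fun j : ℤ => ∑ f, ‖Ψ (liftArc j f)‖ ^ 2) 1 := by
    have h2 : HasSum (fun e => ‖Ψ e‖ ^ 2) 1 := by
      have := lp.hasSum_norm (p := 2) (by norm_num) Ψ
      simpa [hΨ] using this
    have h3 := (liftEquiv.hasSum_iff (f := fun e => ‖Ψ e‖ ^ 2)).2 h2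
    exact h3.prod_fiberwise fun j => hasSum_fintype _
  rw [h0.unique h1] at ht
  exact (funext (labelProb_eq Ψ t)) ▸ ht

theorem labelProb_nonneg (Ψ : ArcSpace chain) (t : ℕ) (j : ℤ) : 0 ≤ labelProb Ψ t j := by
  rw [labelProb_eq]
  positivity

/-! ### Integrals of periodic functions over symmetric intervals -/

section Periodic

variable {E : Type*} [NormedAddCommGroup E] {G : ℝ → E}

theorem Function.Periodic.intervalIntegrable_of_periodMeasure
    (hG : Function.Periodic G (2 * Real.pi)) (hi : Integrable G periodMeasure) (a b : ℝ) :
    IntervalIntegrable G volume a b := by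
  refine hG.intervalIntegrable Real.two_pi_pos.ne' (t := -Real.pi) ?_ a b
  rwa [neg_pi_add_two_pi, intervalIntegrable_iff_integrableOn_Ioc_of_le neg_pi_le_pi]

theorem integrable_periodMeasure_pi_sub (hG : Function.Periodic G (2 * Real.pi))
    (hi : Integrable G periodMeasure) (a b : ℝ) :
    IntervalIntegrable (fun k => G (Real.pi - k)) volume a b := by
  simpa using (hG.intervalIntegrable_of_periodMeasure hi (Real.pi - a)
    (Real.pi - b)).comp_sub_left Real.pi

variable [NormedSpace ℝ E]

theorem integral_periodMeasure_eq (hG : Function.Periodic G (2 * Real.pi)) (a : ℝ) :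
    ∫ k, G k ∂periodMeasure = ∫ k in a..(a + 2 * Real.pi), G k := by
  rw [← hG.intervalIntegral_add_eq (-Real.pi) a, neg_pi_add_two_pi,
    intervalIntegral.integral_of_le neg_pi_le_pi]

theorem integral_Ioo_add_pi_sub {G' : ℝ → E} (hG : Function.Periodic G (2 * Real.pi))
    (hi : Integrable G periodMeasure) (hG' : Function.Periodic G' (2 * Real.pi))
    (hi' : Integrable G' periodMeasure) :
    ∫ k in Set.Ioo 0 (2 * Real.pi), (G k + G' (Real.pi - k)) =
      ∫ k, G k ∂periodMeasure + ∫ k, G' k ∂periodMeasure := by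
  rw [← integral_Ioc_eq_integral_Ioo, ← intervalIntegral.integral_of_le Real.two_pi_pos.le,
    intervalIntegral.integral_add (hG.intervalIntegrable_of_periodMeasure hi _ _)
      (integrable_periodMeasure_pi_sub hG' hi' _ _),
    intervalIntegral.integral_comp_sub_left G', integral_periodMeasure_eq hG 0,
    integral_periodMeasure_eq hG' (Real.pi - 2 * Real.pi), zero_add, sub_add_cancel, sub_zero]

/-- The reflection takes (-π/2, π/2) to (π/2, 3π/2), and the two intervals make up one period. -/
theorem integral_Ioo_add_pi_sub_self (hG : Function.Periodic G (2 * Real.pi))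
    (hi : Integrable G periodMeasure) :
    ∫ k in Set.Ioo (-(Real.pi / 2)) (Real.pi / 2), (G k + G (Real.pi - k)) =
      ∫ k, G k ∂periodMeasure := by
  have h := hG.intervalIntegrable_of_periodMeasure hi
  rw [← integral_Ioc_eq_integral_Ioo,
    ← intervalIntegral.integral_of_le (by linarith [Real.pi_pos]),
    intervalIntegral.integral_add (h _ _) (integrable_periodMeasure_pi_sub hG hi _ _),
    intervalIntegral.integral_comp_sub_left G, integral_periodMeasure_eq hG (-(Real.pi / 2)),
    show Real.pi - Real.pi / 2 = Real.pi / 2 by ring,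
    intervalIntegral.integral_add_adjacent_intervals (h _ _) (h _ _)]
  congr 1
  ring

end Periodic

/-! ### The integrands of the modes -/

theorem velocity_periodic (j : Fin 3) (l : Fin 2) :
    Function.Periodic (velocity j l) (2 * Real.pi) := by
  intro k
  unfold velocity
  rw [eigQW_periodic, ← deriv_comp_add_const]
  simp only [eigQW_periodic]

theorem measurable_velocity (j : Fin 3) (l : Fin 2) : Measurable (velocity j l) := by
  have h1 := measurable_deriv (eigQW j l)
  have h2 := (continuous_eigQW j l).measurable
  unfold velocity
  exact Complex.measurable_re.comp ((h1.const_mul _).div h2)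

namespace IsFourierFamily

variable {ψ : chain.Dart → ℂ} {Φ : ℝ → domain.Dart → ℂ}

theorem componentWeight_periodic (h : IsFourierFamily ψ Φ) (j : Fin 3) (l : Fin 2) :
    Function.Periodic (fun k => componentWeight (eigVec j l k) (Φ k)) (2 * Real.pi) := by
  intro k
  have h1 : Φ (k + 2 * Real.pi) = Φ k := funext fun f => (h f).periodic k
  have h2 : eigVec j l (k + 2 * Real.pi) = eigVec j l k := funext fun f => eigVec_periodic j l k f
  simp only [h1, h2]

theorem integrable_componentWeight (h : IsFourierFamily ψ Φ) (j : Fin 3) (l : Fin 2) :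
    Integrable (fun k => componentWeight (eigVec j l k) (Φ k)) periodMeasure := by
  refine h.integrable_norm_sq.mono' ?_ (ae_of_all _ fun k => ?_)
  · unfold componentWeight
    have h1 : AEStronglyMeasurable (fun k => ∑ f, (starRingEnd ℂ) (eigVec j l k f) * Φ k f)
        periodMeasure := Finset.aestronglyMeasurable_fun_sum _ fun f _ =>
      (continuous_eigVec j l f).star.aestronglyMeasurable.mul (h f).memLp.1
    have h2 : Continuous fun k => ∑ f, ‖eigVec j l k f‖ ^ 2 :=
      continuous_finsetSum _ fun f _ => (continuous_eigVec j l f).norm.pow 2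
    exact ((h1.norm.pow 2).aemeasurable.div h2.measurable.aemeasurable).aestronglyMeasurable
  · rw [Real.norm_of_nonneg (componentWeight_nonneg _ _)]
    exact componentWeight_le _ _

end IsFourierFamily

/-- The contribution of the mode `(j, l)` to the limit characteristic function. -/
def modeIntegrand (Φ : ℝ → domain.Dart → ℂ) (ξ : ℝ) (j : Fin 3) (l : Fin 2) (k : ℝ) : ℂ :=
  Complex.exp (Complex.I * ξ * velocity j l k) * componentWeight (eigVec j l k) (Φ k)

namespace IsFourierFamily

variable {ψ : chain.Dart → ℂ} {Φ : ℝ → domain.Dart → ℂ}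

theorem modeIntegrand_periodic (h : IsFourierFamily ψ Φ) (ξ : ℝ) (j : Fin 3) (l : Fin 2) :
    Function.Periodic (modeIntegrand Φ ξ j l) (2 * Real.pi) := by
  intro k
  have := h.componentWeight_periodic j l k
  simp only at this
  unfold modeIntegrand
  rw [velocity_periodic, this]

theorem integrable_modeIntegrand (h : IsFourierFamily ψ Φ) (ξ : ℝ) (j : Fin 3) (l : Fin 2) :
    Integrable (modeIntegrand Φ ξ j l) periodMeasure := by
  have hm : Measurable fun k => Complex.exp (Complex.I * ξ * velocity j l k) := by
    have := measurable_velocity j l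
    fun_prop
  refine (h.integrable_componentWeight j l).mono'
    (hm.aestronglyMeasurable.mul (Complex.continuous_ofReal.comp_aestronglyMeasurable
      (h.integrable_componentWeight j l).1)) (ae_of_all _ fun k => ?_)
  unfold modeIntegrand
  rw [norm_mul, Complex.norm_exp, Complex.norm_real,
    Real.norm_of_nonneg (componentWeight_nonneg _ _)]
  simp

/-- The homological modes have velocity 0, so their exponential is 1 and their contribution is
constant in ξ. -/
theorem integral_sum_mode (h : IsFourierFamily ψ Φ) (ξ : ℝ) :
    ∫ k, ∑ a, Complex.exp (Complex.I * ξ * modeVelocity a k) *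
        componentWeight (modeVec a k) (Φ k) ∂periodMeasure =
      ∑ l, (∫ k, modeIntegrand Φ ξ 0 l k ∂periodMeasure +
        ∫ k, modeIntegrand Φ ξ 1 l k ∂periodMeasure +
        ∫ k, modeIntegrand Φ ξ 2 l k ∂periodMeasure) +
      (∫ k, ∑ m, componentWeight (cycleVec m) (Φ k) ∂periodMeasure : ℝ) := by
  have hc : ∀ m, Integrable (fun k => componentWeight (cycleVec m) (Φ k)) periodMeasure := by
    intro m
    have hp : IsFourierPair _ (fun k => ∑ f, (starRingEnd ℂ) (cycleVec m f) * Φ k f) :=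
      IsFourierPair.sum _ fun f => (h f).const_mul _
    exact (hp.memLp.integrable_norm_pow two_ne_zero).div_const _
  have h1 : ∀ k, ∑ a, Complex.exp (Complex.I * ξ * modeVelocity a k) *
        componentWeight (modeVec a k) (Φ k) =
      ∑ l, (modeIntegrand Φ ξ 0 l k + modeIntegrand Φ ξ 1 l k + modeIntegrand Φ ξ 2 l k) +
        ((∑ m, componentWeight (cycleVec m) (Φ k) : ℝ) : ℂ) := by
    intro k
    rw [Fintype.sum_sum_type, Fintype.sum_prod_type_right]
    simp only [Fin.sum_univ_three, modeVelocity, modeVec, modeIntegrand, Complex.ofReal_zero,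
      mul_zero, Complex.exp_zero, one_mul, Complex.ofReal_sum]
  have hl : ∀ l, Integrable (fun k => modeIntegrand Φ ξ 0 l k + modeIntegrand Φ ξ 1 l k)
      periodMeasure := fun l =>
    (h.integrable_modeIntegrand ξ 0 l).add (h.integrable_modeIntegrand ξ 1 l)
  have hl' : ∀ l, Integrable (fun k => modeIntegrand Φ ξ 0 l k + modeIntegrand Φ ξ 1 l k +
      modeIntegrand Φ ξ 2 l k) periodMeasure := fun l =>
    (hl l).add (h.integrable_modeIntegrand ξ 2 l)
  have hc' : Integrable (fun k => ((∑ m, componentWeight (cycleVec m) (Φ k) : ℝ) : ℂ))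
      periodMeasure := by
    have := integrable_finsetSum Finset.univ fun m _ => hc m
    exact this.ofReal
  simp only [h1]
  rw [integral_add (integrable_finsetSum _ fun l _ => hl' l) hc', integral_complex_ofReal,
    integral_finsetSum _ fun l _ => hl' l]
  congr 1
  refine Finset.sum_congr rfl fun l _ => ?_
  rw [integral_add (hl l) (h.integrable_modeIntegrand ξ 2 l),
    integral_add (h.integrable_modeIntegrand ξ 0 l) (h.integrable_modeIntegrand ξ 1 l)]

/-- The density of a pair of bands that are exchanged by `k ↦ π - k`. -/
theorem exists_band_density (h : IsFourierFamily ψ Φ)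
    {v : Fin 3 → Fin 2 → ℝ → domain.Dart → ℂ} (hv : IsEigenvectorFamily v) {i j : Fin 3}
    (hij : ∀ k, eigRW j (Real.pi - k) = -eigRW i k) (l : Fin 2) {a b c d : ℝ} (hab : a ≤ b)
    (hbij : Set.BijOn (velocity i l) (Set.Ioo a b) (Set.Ioo c d))
    (h0 : ∀ k ∈ Set.Ioo a b, eigRW i k ≠ 0) (h1 : ∀ k ∈ Set.Ioo a b, eigRW i k ^ 2 < 1)
    (hd : ∀ k ∈ Set.Ioo a b, deriv (velocity i 0) k ≠ 0) :
    ∃ ρ : ℝ → ℝ, (∀ y, 0 ≤ ρ y) ∧ Integrable ρ ∧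
      (∀ k ∈ Set.Ioo a b, ρ (velocity i l k) =
        (weight v Φ i l k + weight v Φ j l (Real.pi - k)) /
          (2 * Real.pi * |deriv (velocity i 0) k|)) ∧
      (∀ y, y ∉ Set.Ioo c d → ρ y = 0) ∧
      ((∀ f, Continuous fun k => Φ k f) → ContinuousOn ρ (Set.Ioo c d)) ∧
      ∀ ξ : ℝ, ∫ y : ℝ, Complex.exp (Complex.I * ξ * y) * ρ y =
        1 / (2 * Real.pi) * ∫ k in Set.Ioo a b,
          (modeIntegrand Φ ξ i l k + modeIntegrand Φ ξ j l (Real.pi - k)) := by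
  have hj0 : ∀ k ∈ Set.Ioo a b, eigRW j (Real.pi - k) ≠ 0 := fun k hk => by
    rw [hij]; exact neg_ne_zero.2 (h0 k hk)
  have hj1 : ∀ k ∈ Set.Ioo a b, eigRW j (Real.pi - k) ^ 2 < 1 := fun k hk => by
    rw [hij, neg_sq]; exact h1 k hk
  have hW : ∀ k ∈ Set.Ioo a b, weight v Φ i l k + weight v Φ j l (Real.pi - k) =
      componentWeight (eigVec i l k) (Φ k) +
        componentWeight (eigVec j l (Real.pi - k)) (Φ (Real.pi - k)) := fun k hk => by
    rw [weight_eq_componentWeight hv Φ l (h0 k hk) (h1 k hk),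
      weight_eq_componentWeight hv Φ l (hj0 k hk) (hj1 k hk)]
  have hder : ∀ (l : Fin 2), ∀ k ∈ Set.Ioo a b, HasDerivAt (velocity i l) _ k :=
    fun l k hk => hasDerivAt_velocity i l (h1 k hk)
  -- The velocities for l = 0, 1 differ by a sign, so the density may use the derivative for l = 0
  -- in both cases.
  have habs : ∀ k ∈ Set.Ioo a b, |(-1) ^ (l : ℕ) * (3 * eigRW i k * √(1 - eigRW i k ^ 2) *
      (27 * eigRW i k ^ 2 + 33)) / (27 * eigRW i k ^ 2 - 7) ^ 3| =
      |deriv (velocity i 0) k| := by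
    intro k hk
    rw [(hder 0 k hk).deriv]
    simp only [abs_div, abs_mul, abs_pow, abs_neg, abs_one, one_pow]
  have hcont : ContinuousOn (fun k => (-1) ^ (l : ℕ) * (3 * eigRW i k * √(1 - eigRW i k ^ 2) *
      (27 * eigRW i k ^ 2 + 33)) / (27 * eigRW i k ^ 2 - 7) ^ 3) (Set.Ioo a b) := by
    have := continuous_eigRW i
    refine Continuous.continuousOn (Continuous.div (by fun_prop) (by fun_prop) fun k => ?_)
    exact pow_ne_zero 3 (eigRW_denominator_ne_zero i k)
  have hint : IntegrableOn (fun k => weight v Φ i l k + weight v Φ j l (Real.pi - k))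
      (Set.Ioo a b) := by
    refine IntegrableOn.congr_fun (f := fun k => componentWeight (eigVec i l k) (Φ k) +
      componentWeight (eigVec j l (Real.pi - k)) (Φ (Real.pi - k))) ?_
      (fun k hk => (hW k hk).symm) measurableSet_Ioo
    rw [← intervalIntegrable_iff_integrableOn_Ioo_of_le hab]
    exact ((h.componentWeight_periodic i l).intervalIntegrable_of_periodMeasure
      (h.integrable_componentWeight i l) a b).add (integrable_periodMeasure_pi_sub
        (h.componentWeight_periodic j l) (h.integrable_componentWeight j l) a b)
  obtain ⟨ρ, hρ0, hρi, hρv, hρs, hρc, hρξ⟩ := exists_density hbij (hder l)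
    (fun k hk => abs_ne_zero.1 (by rw [habs k hk]; exact abs_ne_zero.2 (hd k hk))) hcont
    (W := fun k => weight v Φ i l k + weight v Φ j l (Real.pi - k))
    (fun k => add_nonneg (sq_nonneg _) (sq_nonneg _)) hint
  refine ⟨ρ, hρ0, hρi, fun k hk => by rw [hρv k hk, habs k hk], hρs, fun hΦ => hρc ?_,
    fun ξ => ?_⟩
  -- Continuity is proved for the explicit eigenvectors, since v itself need not be continuous.
  · have hcw : ∀ (i : Fin 3) (k : ℝ), eigVec i l k ≠ 0 →
        ContinuousAt (fun k => componentWeight (eigVec i l k) (Φ k)) k := by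
      intro i k hne
      have hs : ∑ f, ‖eigVec i l k f‖ ^ 2 ≠ 0 := by
        rw [← norm_toLp_sq]
        exact pow_ne_zero 2 (norm_ne_zero_iff.2 (toLp_ne_zero hne))
      unfold componentWeight
      refine ContinuousAt.div ?_ ?_ hs
      · exact ((continuous_finsetSum _ fun f _ =>
          (continuous_eigVec i l f).star.mul (hΦ f)).norm.pow 2).continuousAt
      · exact (continuous_finsetSum _ fun f _ =>
          (continuous_eigVec i l f).norm.pow 2).continuousAt
    refine ContinuousOn.congr (fun k hk => ?_) hW
    refine ((hcw i k (eigVec_eigenvector hv l (h0 k hk) (h1 k hk)).1).add ?_).continuousWithinAt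
    exact ContinuousAt.comp (f := fun k => Real.pi - k)
      (hcw j _ (eigVec_eigenvector hv l (hj0 k hk) (hj1 k hk)).1) (by fun_prop)
  · rw [hρξ]
    congr 1
    refine setIntegral_congr_fun measurableSet_Ioo fun k hk => ?_
    -- Equal velocities at k and π - k let the two bands share one exponential.
    simp only [modeIntegrand, hW k hk, velocity_pi_sub hij l (h1 k hk)]
    push_cast
    ring

end IsFourierFamily

/-- The support and the graph of a function given along a parametrization. -/
theorem support_and_graph_of_parametrization {f W g ρ : ℝ → ℝ} {s t : Set ℝ}
    (hbij : Set.BijOn f s t) (hg : ∀ k ∈ s, g k ≠ 0) (hρ : ∀ k ∈ s, ρ (f k) = W k / g k)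
    (h0 : ∀ y, y ∉ t → ρ y = 0) :
    (Function.support ρ ⊆ t ∧ Function.support ρ = f '' {k ∈ s | W k ≠ 0}) ∧
      {p : ℝ × ℝ | p.1 ∈ t ∧ p.2 = ρ p.1} = (fun k => (f k, W k / g k)) '' s := by
  have hs : Function.support ρ ⊆ t := fun y hy => by_contra fun h => hy (h0 y h)
  refine ⟨⟨hs, Set.Subset.antisymm (fun y hy => ?_) ?_⟩, Set.Subset.antisymm ?_ ?_⟩
  · obtain ⟨k, hk, rfl⟩ := hbij.surjOn (hs hy)
    refine ⟨k, ⟨hk, fun h => hy ?_⟩, rfl⟩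
    rw [hρ k hk, h, zero_div]
  · rintro _ ⟨k, ⟨hk, hw⟩, rfl⟩
    rw [Function.mem_support, hρ k hk]
    exact div_ne_zero hw (hg k hk)
  · rintro ⟨y, z⟩ ⟨hy, hz⟩
    simp only at hy hz
    obtain ⟨k, hk, rfl⟩ := hbij.surjOn hy
    exact ⟨k, hk, by rw [hz, hρ k hk]⟩
  · rintro _ ⟨k, hk, rfl⟩
    exact ⟨hbij.mapsTo hk, (hρ k hk).symm⟩

end

/-! ### The limit theorem. -/

theorem mainTheorem2 (Ψ₀ : ArcSpace chain) (hΨ₀ : ‖Ψ₀‖ = 1)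
    (v : Fin 3 → Fin 2 → ℝ → domain.Dart → ℂ) (hv : IsEigenvectorFamily v) :
    -- the Fourier transform exists, and is the continuous Fourier series for summable states
    (∃ Φ, IsFourierTransform Ψ₀ Φ) ∧
    ((Summable fun e => ‖Ψ₀ e‖) →
      IsFourierTransform Ψ₀ (fourierSeries Ψ₀) ∧
        ∀ f, Continuous fun k => fourierSeries Ψ₀ k f) ∧
    -- the parameter intervals are mapped onto the supporting intervals
    (∀ l : Fin 2,
      Set.BijOn (velocity 0 l) (Set.Ioo 0 (2 * Real.pi)) (Set.Ioo (-(1 / √10)) (1 / √10)) ∧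
      Set.BijOn (velocity 2 l) (Set.Ioo (-(Real.pi / 2)) (Real.pi / 2))
        (Set.Ioo (-(2 / 7)) (2 / 7))) ∧
    (∀ k ∈ Set.Ioo 0 (2 * Real.pi), deriv (velocity 0 0) k ≠ 0) ∧
    (∀ k ∈ Set.Ioo (-(Real.pi / 2)) (Real.pi / 2), deriv (velocity 2 0) k ≠ 0) ∧
    -- the weak limit
    ∀ Φ, IsFourierTransform Ψ₀ Φ →
      ∃ ρ : Fin 2 → Fin 2 → ℝ → ℝ,
        (∀ m l y, 0 ≤ ρ m l y) ∧
        (∀ m l, Integrable (ρ m l)) ∧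
        (∀ x : ℝ, (x ≠ 0 ∨ homMass Ψ₀ = 0) →
          Tendsto (fun t : ℕ => scaledCdf Ψ₀ t x) atTop
            (𝓝 ((if 0 ≤ x then homMass Ψ₀ else 0) +
              ∫ y in Set.Iic x, ∑ m : Fin 2, ∑ l : Fin 2, ρ m l y))) ∧
        -- supports
        (∀ l, Function.support (ρ 0 l) ⊆ Set.Ioo (-(1 / √10)) (1 / √10) ∧
          Function.support (ρ 0 l) = velocity 0 l '' {k ∈ Set.Ioo 0 (2 * Real.pi) |
            weight v Φ 0 l k + weight v Φ 1 l (Real.pi - k) ≠ 0}) ∧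
        (∀ l, Function.support (ρ 1 l) ⊆ Set.Ioo (-(2 / 7)) (2 / 7) ∧
          Function.support (ρ 1 l) = velocity 2 l '' {k ∈ Set.Ioo (-(Real.pi / 2)) (Real.pi / 2) |
            weight v Φ 2 l k + weight v Φ 2 l (Real.pi - k) ≠ 0}) ∧
        -- continuity
        ((∀ f, Continuous fun k => Φ k f) → ∀ l,
          ContinuousOn (ρ 0 l) (Set.Ioo (-(1 / √10)) (1 / √10)) ∧
          ContinuousOn (ρ 1 l) (Set.Ioo (-(2 / 7)) (2 / 7))) ∧
        -- parametric description of the graphs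
        (∀ l, {p : ℝ × ℝ | p.1 ∈ Set.Ioo (-(1 / √10)) (1 / √10) ∧ p.2 = ρ 0 l p.1} =
          (fun k => (velocity 0 l k, (weight v Φ 0 l k + weight v Φ 1 l (Real.pi - k)) /
            (2 * Real.pi * |deriv (velocity 0 0) k|))) '' Set.Ioo 0 (2 * Real.pi)) ∧
        (∀ l, {p : ℝ × ℝ | p.1 ∈ Set.Ioo (-(2 / 7)) (2 / 7) ∧ p.2 = ρ 1 l p.1} =
          (fun k => (velocity 2 l k, (weight v Φ 2 l k + weight v Φ 2 l (Real.pi - k)) /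
            (2 * Real.pi * |deriv (velocity 2 0) k|))) ''
              Set.Ioo (-(Real.pi / 2)) (Real.pi / 2)) := by
  refine ⟨exists_isFourierTransform Ψ₀, isFourierTransform_fourierSeries Ψ₀, bijOn_velocity,
    fun k hk => (deriv_velocity_zero_pos hk).ne', fun k hk => (deriv_velocity_two_pos hk).ne',
    fun Φ hΦ => ?_⟩
  have h := (isFourierTransform_iff _ _).1 hΦ
  have hpi := Real.pi_pos
  -- Band 1 is folded onto band 0 over a whole period.
  choose ρ₀ hnn₀ hint₀ hval₀ hout₀ hcont₀ hchar₀ using fun l =>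
    h.exists_band_density hv eigRW_one_pi_sub l Real.two_pi_pos.le (bijOn_velocity l).1
      (fun k _ => by linarith [(eigRW_zero_mem k).1]) (fun k hk => eigRW_zero_sq_lt_one hk)
      (fun k hk => (deriv_velocity_zero_pos hk).ne')
  -- Band 2 is folded onto itself, so half a period suffices.
  choose ρ₁ hnn₁ hint₁ hval₁ hout₁ hcont₁ hchar₁ using fun l =>
    h.exists_band_density hv eigRW_two_pi_sub l (by linarith) (bijOn_velocity l).2
      (fun k hk => eigRW_two_ne_zero (Real.cos_pos_of_mem_Ioo hk).ne')
      (fun k _ => eigRW_two_sq_lt_one k) (fun k hk => (deriv_velocity_two_pos hk).ne')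
  have hnn : ∀ m l y, 0 ≤ (![ρ₀, ρ₁] : Fin 2 → Fin 2 → ℝ → ℝ) m l y :=
    Fin.forall_fin_two.2 ⟨hnn₀, hnn₁⟩
  have hint : ∀ m l, Integrable ((![ρ₀, ρ₁] : Fin 2 → Fin 2 → ℝ → ℝ) m l) :=
    Fin.forall_fin_two.2 ⟨hint₀, hint₁⟩
  have hg₀ : ∀ k ∈ Set.Ioo 0 (2 * Real.pi), 2 * Real.pi * |deriv (velocity 0 0) k| ≠ 0 :=
    fun k hk => mul_ne_zero Real.two_pi_pos.ne' (abs_ne_zero.2 (deriv_velocity_zero_pos hk).ne')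
  have hg₁ : ∀ k ∈ Set.Ioo (-(Real.pi / 2)) (Real.pi / 2),
      2 * Real.pi * |deriv (velocity 2 0) k| ≠ 0 :=
    fun k hk => mul_ne_zero Real.two_pi_pos.ne' (abs_ne_zero.2 (deriv_velocity_two_pos hk).ne')
  have hsg₀ := fun l =>
    support_and_graph_of_parametrization (bijOn_velocity l).1 hg₀ (hval₀ l) (hout₀ l)
  have hsg₁ := fun l =>
    support_and_graph_of_parametrization (bijOn_velocity l).2 hg₁ (hval₁ l) (hout₁ l)
  refine ⟨![ρ₀, ρ₁], hnn, hint, fun x hx => ?_, fun l => (hsg₀ l).1, fun l => (hsg₁ l).1,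
    fun hc l => ⟨hcont₀ l hc, hcont₁ l hc⟩, fun l => (hsg₀ l).2, fun l => (hsg₁ l).2⟩
  refine tendsto_distribution (labelProb_nonneg Ψ₀) (hasSum_labelProb hΨ₀) (homMass_nonneg Ψ₀)
    (fun y => Finset.sum_nonneg fun m _ => Finset.sum_nonneg fun l _ => hnn m l y)
    (integrable_finsetSum _ fun m _ => integrable_finsetSum _ fun l _ => hint m l)
    (fun ξ => ?_) hx
  have key := h.tendsto_correlation hv ξ
  simp only [← labelProb_eq] at key
  rw [h.integral_sum_mode ξ] at key
  refine key.trans (le_of_eq (congrArg 𝓝 ?_))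
  have hexp : ∀ m l, Integrable fun y : ℝ => Complex.exp (Complex.I * ξ * y) *
      ((![ρ₀, ρ₁] : Fin 2 → Fin 2 → ℝ → ℝ) m l y : ℂ) := fun m l => by
    refine (hint m l).norm.mono' ((by fun_prop : Continuous fun y : ℝ =>
      Complex.exp (Complex.I * ξ * y)).aestronglyMeasurable.mul
        (Complex.continuous_ofReal.comp_aestronglyMeasurable (hint m l).1))
      (ae_of_all _ fun y => ?_)
    rw [norm_mul, Complex.norm_exp, Complex.norm_real]
    simp
  simp only [Complex.ofReal_sum, Finset.mul_sum]
  rw [integral_finsetSum _ fun m _ => integrable_finsetSum _ fun l _ => hexp m l]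
  simp only [integral_finsetSum _ fun l _ => hexp _ l]
  rw [homMass_eq_integral h]
  -- For each l the two densities together have the characteristic function of the three bands:
  -- unfolding the reflections restores the integrals over a full period.
  have hl : ∀ l, (∫ y : ℝ, Complex.exp (Complex.I * ξ * y) *
        ((![ρ₀, ρ₁] : Fin 2 → Fin 2 → ℝ → ℝ) 0 l y : ℂ)) +
      ∫ y : ℝ, Complex.exp (Complex.I * ξ * y) *
        ((![ρ₀, ρ₁] : Fin 2 → Fin 2 → ℝ → ℝ) 1 l y : ℂ) =
      1 / (2 * Real.pi) * (∫ k, modeIntegrand Φ ξ 0 l k ∂periodMeasure +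
        ∫ k, modeIntegrand Φ ξ 1 l k ∂periodMeasure +
        ∫ k, modeIntegrand Φ ξ 2 l k ∂periodMeasure) := fun l => by
    rw [mul_add, ← integral_Ioo_add_pi_sub (h.modeIntegrand_periodic ξ 0 l)
      (h.integrable_modeIntegrand ξ 0 l) (h.modeIntegrand_periodic ξ 1 l)
      (h.integrable_modeIntegrand ξ 1 l), ← integral_Ioo_add_pi_sub_self
      (h.modeIntegrand_periodic ξ 2 l) (h.integrable_modeIntegrand ξ 2 l)]
    exact congrArg₂ (· + ·) (hchar₀ l ξ) (hchar₁ l ξ)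
  simp only [Fin.sum_univ_two, Complex.ofReal_mul, Complex.ofReal_div, Complex.ofReal_one,
    Complex.ofReal_ofNat]
  linear_combination -(hl 0) - hl 1
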